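/- Throughout, manifolds are Hausdorff, smooth ($C^\infty$), without boundary and modelled on a real Banach space. An affine connection $B$ on a manifold $M$ modelled on $E$ is given by smooth local representations $B^\varphi\colon V\to\mathcal L^2(E,E)$ (continuous bilinear maps), one for each chart $\varphi\colon U\to V\subseteq E$, such that for charts $\varphi_1,\varphi_2$ and $h=\varphi_2\circ\varphi_1^{-1}$ $$B^{\varphi_2}_{h(x)}(dh(x)v,dh(x)w)=d^2h(x)(v,w)+dh(x)\bigl(B^{\varphi_1}_x(v,w)\bigr);$$ equivalently, $B$ is a bilinear bundle morphism $TM\oplus TM\to TTM$ that is a section of $(\pi_{TM},T\pi)$. Its covariant derivative is $(\nabla_\xi\eta)^\varphi=d\eta^\varphi(\xi^\varphi)-B^\varphi(\eta^\varphi,\xi^\varphi)$, its torsion and curvature tensors are given by $$\mathrm{Tor}(\xi,\eta)=\nabla_\xi\eta-\nabla_\eta\xi-[\xi,\eta],\qquad R(\xi,\eta,\zeta)=\nabla_\xi\nabla_\eta\zeta-\nabla_\eta\nabla_\xi\zeta-\nabla_{[\xi,\eta]}\zeta,$$ and they are called parallel if $\nabla\mathrm{Tor}=0$ and $\nabla R=0$.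 The pair $(M,B)$ is an affine Banach manifold. A geodesic is a smooth curve $\alpha$ with $\nabla_{\alpha'}\alpha'=0$, and $(M,B)$ is geodesically complete if for every $v\in TM$ the maximal geodesic with initial velocity $v$ is defined on all of $\mathbb R$. A smooth map $f\colon M_1\to M_2$ between affine Banach manifolds is affine if $TTf\circ B_1=B_2\circ(Tf\oplus Tf)$, i.e., if in all charts $$d^2f^\varphi(x)(v,w)+df^\varphi(x)\bigl((B_1)_x(v,w)\bigr)=(B_2)_{f^\varphi(x)}\bigl(df^\varphi(x)v,df^\varphi(x)w\bigr).$$ **Theorem (Integrability Theorem).** Let $(M_1,B_1,b_1)$ and $(M_2,B_2,b_2)$ be affine Banach manifolds with base points, where $M_1$ is $1$-connected (connected and simply connected), $M_2$ is geodesically complete, and the torsion and curvature tensors of both are parallel. Let $A\colon T_{b_1}M_1\to T_{b_2}M_2$ be a continuous linear map (not necessarily an isomorphism) such that $$A\,\mathrm{Tor}_1(v,w)=\mathrm{Tor}_2(Av,Aw)\quad\text{and}\quad A\,R_1(v,w,z)=R_2(Av,Aw,Az)$$ for all $v,w,z\in T_{b_1}M_1$, the tensors being taken at $b_1$ and $b_2$.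 Then there exists a unique affine map $f\colon M_1\to M_2$ with $f(b_1)=b_2$ and $T_{b_1}f=A$. -/

import Mathlib

open scoped Manifold ContDiff

/-- An affine connection on (the tangent bundle of) a smooth manifold `M` modelled on the real
Banach space `E`: to every chart `φ : U → V ⊆ E` of the smooth structure there belongs a smooth map
`B^φ : V → L²(E, E)`, and these local representations are related by
`B^{φ₂}_{h x} (dh x v) (dh x w) = d²h x (v, w) + dh x (B^{φ₁}_x (v, w))`, `h = φ₂ ∘ φ₁⁻¹`,
which says that `(x, v, w) ↦ (x, v, w, B^φ_x (v, w))` are the chart expressions of one bilinear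
bundle morphism `B : TM ⊕ TM → TTM` with `(π_{TM}, Tπ) ∘ B = id`.
The associated covariant derivative is `(∇_ξ η)^φ (x) = dη x (ξ x) - B^φ_x (η x, ξ x)`.
(Values of `localRep φ` outside `φ.target`, or for `φ` that is not a chart of the smooth
structure, are irrelevant and never used.) -/
structure AffineConnection (E : Type*) [NormedAddCommGroup E] [NormedSpace ℝ E]
    (M : Type*) [TopologicalSpace M] [ChartedSpace E M] where
  localRep : OpenPartialHomeomorph M E → E → E →L[ℝ] E →L[ℝ] E
  contDiffOn_localRep : ∀ φ ∈ IsManifold.maximalAtlas 𝓘(ℝ, E) ∞ M,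
    ContDiffOn ℝ ∞ (localRep φ) φ.target
  localRep_change : ∀ φ₁ ∈ IsManifold.maximalAtlas 𝓘(ℝ, E) ∞ M,
    ∀ φ₂ ∈ IsManifold.maximalAtlas 𝓘(ℝ, E) ∞ M,
    ∀ x ∈ (φ₁.symm ≫ₕ φ₂).source, ∀ v w : E,
      localRep φ₂ (φ₂ (φ₁.symm x))
          (fderiv ℝ (φ₂ ∘ φ₁.symm) x v) (fderiv ℝ (φ₂ ∘ φ₁.symm) x w) =
        fderiv ℝ (fderiv ℝ (φ₂ ∘ φ₁.symm)) x v w +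
          fderiv ℝ (φ₂ ∘ φ₁.symm) x (localRep φ₁ x v w)

namespace AffineConnection

variable {E : Type*} [NormedAddCommGroup E] [NormedSpace ℝ E]
  {M : Type*} [TopologicalSpace M] [ChartedSpace E M]

/-- The torsion tensor in the chart `φ`, at a point `x` of the image of the chart;
the tensor of `Tor (ξ, η) = ∇_ξ η - ∇_η ξ - [ξ, η]`. -/
noncomputable def torsionLoc (B : AffineConnection E M) (φ : OpenPartialHomeomorph M E) (x v w : E) : E :=
  B.localRep φ x v w - B.localRep φ x w v

/-- The curvature tensor in the chart `φ`, at a point `x` of the image of the chart;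
the tensor of `R (ξ, η, ζ) = ∇_ξ ∇_η ζ - ∇_η ∇_ξ ζ - ∇_[ξ, η] ζ`. -/
noncomputable def curvatureLoc (B : AffineConnection E M) (φ : OpenPartialHomeomorph M E)
    (x v w z : E) : E :=
  B.localRep φ x (B.localRep φ x z w) v - B.localRep φ x (B.localRep φ x z v) w
    + fderiv ℝ (B.localRep φ) x w z v - fderiv ℝ (B.localRep φ) x v z w

/-- The torsion tensor `Tor_p : T_p M × T_p M → T_p M`. In Mathlib `T_p M` is the model space `E`,
by means of the preferred chart `chartAt E p` at `p`. -/
noncomputable def torsion (B : AffineConnection E M) (p : M) (v w : TangentSpace 𝓘(ℝ, E) p) :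
    TangentSpace 𝓘(ℝ, E) p :=
  B.torsionLoc (chartAt E p) (chartAt E p p) v w

/-- The curvature tensor `R_p : T_p M × T_p M × T_p M → T_p M`. -/
noncomputable def curvature (B : AffineConnection E M) (p : M)
    (v w z : TangentSpace 𝓘(ℝ, E) p) : TangentSpace 𝓘(ℝ, E) p :=
  B.curvatureLoc (chartAt E p) (chartAt E p p) v w z

/-- `∇ Tor = 0`, where
`(∇_u Tor)(v, w) = ∇_u (Tor (v, w)) - Tor (∇_u v, w) - Tor (v, ∇_u w)`, written in charts. -/
def HasParallelTorsion (B : AffineConnection E M) : Prop :=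
  ∀ φ ∈ IsManifold.maximalAtlas 𝓘(ℝ, E) ∞ M, ∀ x ∈ φ.target, ∀ u v w : E,
    fderiv ℝ (fun y => B.torsionLoc φ y v w) x u
      - B.localRep φ x (B.torsionLoc φ x v w) u
      + B.torsionLoc φ x (B.localRep φ x v u) w
      + B.torsionLoc φ x v (B.localRep φ x w u) = 0

/-- `∇ R = 0`, where `(∇_u R)(v, w, z) =
∇_u (R (v, w, z)) - R (∇_u v, w, z) - R (v, ∇_u w, z) - R (v, w, ∇_u z)`, written in charts. -/
def HasParallelCurvature (B : AffineConnection E M) : Prop :=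
  ∀ φ ∈ IsManifold.maximalAtlas 𝓘(ℝ, E) ∞ M, ∀ x ∈ φ.target, ∀ u v w z : E,
    fderiv ℝ (fun y => B.curvatureLoc φ y v w z) x u
      - B.localRep φ x (B.curvatureLoc φ x v w z) u
      + B.curvatureLoc φ x (B.localRep φ x v u) w z
      + B.curvatureLoc φ x v (B.localRep φ x w u) z
      + B.curvatureLoc φ x v w (B.localRep φ x z u) = 0

/-- A smooth curve `α : ℝ → M` is a geodesic (with domain `ℝ`) if `∇_{α'} α' = 0`, i.e.,
`(α^φ)'' = B^φ_{α^φ} ((α^φ)', (α^φ)')` in every chart `φ`. -/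
def IsGeodesic (B : AffineConnection E M) (α : ℝ → M) : Prop :=
  ContMDiff 𝓘(ℝ, ℝ) 𝓘(ℝ, E) ∞ α ∧
    ∀ φ ∈ IsManifold.maximalAtlas 𝓘(ℝ, E) ∞ M, ∀ t : ℝ, α t ∈ φ.source →
      deriv (deriv (φ ∘ α)) t =
        B.localRep φ (φ (α t)) (deriv (φ ∘ α) t) (deriv (φ ∘ α) t)

/-- Geodesic completeness: for every tangent vector `v ∈ TM`, the maximal geodesic `α` with
`α'(0) = v` is defined on all of `ℝ`. -/
def IsGeodesicallyComplete (B : AffineConnection E M) : Prop :=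
  ∀ v : TangentBundle 𝓘(ℝ, E) M, ∃ α : ℝ → M, B.IsGeodesic α ∧
    tangentMap 𝓘(ℝ, ℝ) 𝓘(ℝ, E) α ⟨(0 : ℝ), (1 : ℝ)⟩ = v

end AffineConnection

/-- A smooth map `f : M₁ → M₂` is affine if `TTf ∘ B₁ = B₂ ∘ (Tf ⊕ Tf)`, i.e., if in all charts
`φ₁`, `φ₂` its local representation `F = φ₂ ∘ f ∘ φ₁⁻¹` satisfies
`d²F x (v, w) + dF x (B₁_x (v, w)) = B₂_{F x} (dF x v, dF x w)` wherever `F` is defined. -/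
def IsAffineMap {E₁ : Type*} [NormedAddCommGroup E₁] [NormedSpace ℝ E₁]
    {M₁ : Type*} [TopologicalSpace M₁] [ChartedSpace E₁ M₁]
    {E₂ : Type*} [NormedAddCommGroup E₂] [NormedSpace ℝ E₂]
    {M₂ : Type*} [TopologicalSpace M₂] [ChartedSpace E₂ M₂]
    (B₁ : AffineConnection E₁ M₁) (B₂ : AffineConnection E₂ M₂) (f : M₁ → M₂) : Prop :=
  ContMDiff 𝓘(ℝ, E₁) 𝓘(ℝ, E₂) ∞ f ∧
    ∀ φ₁ ∈ IsManifold.maximalAtlas 𝓘(ℝ, E₁) ∞ M₁,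
    ∀ φ₂ ∈ IsManifold.maximalAtlas 𝓘(ℝ, E₂) ∞ M₂,
    ∀ x ∈ φ₁.target, f (φ₁.symm x) ∈ φ₂.source → ∀ v w : E₁,
      fderiv ℝ (fderiv ℝ (φ₂ ∘ f ∘ φ₁.symm)) x v w +
          fderiv ℝ (φ₂ ∘ f ∘ φ₁.symm) x (B₁.localRep φ₁ x v w) =
        B₂.localRep φ₂ (φ₂ (f (φ₁.symm x)))
          (fderiv ℝ (φ₂ ∘ f ∘ φ₁.symm) x v) (fderiv ℝ (φ₂ ∘ f ∘ φ₁.symm) x w)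

/-! In charts, a smooth map f is affine exactly when its 1-jet x ↦ (f x, df x) solves the total
differential equation with right-hand side `jetField`. The integrability condition of this equation
at a jet (x, y, A) says that A respects torsion and curvature (`fderiv_jetField_symm_iff`). It holds
only on a subset of the jet space that need not be open or a submanifold, so the usual Frobenius
theorem does not apply directly. However, solutions carry parallel fields to parallel fields, and
parallel tensors turn parallel fields into parallel fields. A jet that respects the tensors at one
time therefore does so along the whole curve (`intertwines_of_hasDerivAt_jetField`). The version
`exists_hasFDerivAt_of_integrable_on` asks for integrability only along solutions over rays, and
`exists_isAffineNear` obtains from it a local affine map with prescribed 1-jet. Nowhere is A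
inverted.

The jet equation is nonlinear, so its solutions along an arbitrary curve might break down. An affine
map, however, sends a geodesic of M₁ to a geodesic of M₂, and completeness supplies the latter for
all times. Once this image curve is fixed, the equation for A is linear, so germs of affine maps can
be continued along the whole geodesic (`exists_affine_continuation`,
`continuableAlong_of_geodesic`).

Every point of M₁ has a neighbourhood swept out by geodesics from that point
(`exists_geodesic_star_neighborhood`). Transporting a germ back to the centre and out again extends
it over the neighbourhood. Hence the space of germs of affine maps is a covering of M₁
(`EtaleSpace.isCoveringMap_proj`), and simple connectedness yields a global section through the
given germ. Uniqueness follows because a 1-jet determines the germ of an affine map and germs obey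
an identity principle. -/

set_option maxSynthPendingDepth 3

/-! ### Ordinary differential equations. -/

open Set Filter Topology Metric in
/-- Uniqueness for `u' = G (e t, u)` with `e` continuous and `G` of class `C¹` along a solution. -/
theorem ode_unique_of_contDiffAt {P Y : Type*} [NormedAddCommGroup P] [NormedSpace ℝ P]
    [NormedAddCommGroup Y] [NormedSpace ℝ Y] {G : P × Y → Y} {e : ℝ → P} {f g : ℝ → Y}
    {s : Set ℝ} (hs : IsOpen s) (hsc : IsPreconnected s) (he : ContinuousOn e s)
    (hG : ∀ t ∈ s, ContDiffAt ℝ 1 G (e t, f t))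
    (hf : ∀ t ∈ s, HasDerivAt f (G (e t, f t)) t)
    (hg : ∀ t ∈ s, HasDerivAt g (G (e t, g t)) t) {t₀ : ℝ} (ht₀ : t₀ ∈ s) (h₀ : f t₀ = g t₀) :
    EqOn f g s := by
  have hloc : ∀ t ∈ s, f t = g t → f =ᶠ[𝓝 t] g := by
    intro t ht hfg
    obtain ⟨K, N, hN, hK⟩ := (hG t ht).exists_lipschitzOnWith
    obtain ⟨U, hU, W, hW, hUW⟩ := mem_nhds_prod_iff.1 hN
    have hec : ∀ᶠ τ in 𝓝 t, e τ ∈ U := (he.continuousAt (hs.mem_nhds ht)) hU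
    have hfc : ∀ᶠ τ in 𝓝 t, f τ ∈ W := (hf t ht).continuousAt hW
    have hgc : ∀ᶠ τ in 𝓝 t, g τ ∈ W := (hg t ht).continuousAt (hfg ▸ hW)
    have hst : ∀ᶠ τ in 𝓝 t, τ ∈ s := hs.mem_nhds ht
    refine ODE_solution_unique_of_eventually (v := fun τ y => G (e τ, y)) (s := fun _ => W) (K := K)
      ?_ ?_ ?_ hfg
    · filter_upwards [hec] with τ hτ
      refine LipschitzOnWith.of_dist_le_mul fun y hy z hz => ?_
      refine (hK.dist_le_mul _ (hUW ⟨hτ, hy⟩) _ (hUW ⟨hτ, hz⟩)).trans ?_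
      simp [Prod.dist_eq]
    · filter_upwards [hfc, hst] with τ h1 h2 using ⟨hf τ h2, h1⟩
    · filter_upwards [hgc, hst] with τ h1 h2 using ⟨hg τ h2, h1⟩
  -- The times near which f and g agree form an open set. At a limit point in s, continuity gives
  -- equal values, and local uniqueness applies again.
  have hsub : s ⊆ {t | f =ᶠ[𝓝 t] g} := by
    refine hsc.subset_of_closure_inter_subset (isOpen_iff_mem_nhds.2 fun t ht =>
      eventually_eventually_nhds.2 ht) ⟨t₀, ht₀, hloc t₀ ht₀ h₀⟩ ?_
    rintro t ⟨htc, hts⟩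
    refine hloc t hts ?_
    have hne := mem_closure_iff_nhdsWithin_neBot.1 htc
    refine tendsto_nhds_unique ((hf t hts).continuousAt.tendsto.mono_left
      (nhdsWithin_le_nhds (s := {τ | f =ᶠ[𝓝 τ] g})))
      (((hg t hts).continuousAt.tendsto.mono_left nhdsWithin_le_nhds).congr' ?_)
    filter_upwards [self_mem_nhdsWithin] with τ hτ using (Eventually.self_of_nhds hτ).symm
  exact fun t ht => (hsub ht).self_of_nhds

open Set Metric in
/-- A linear ODE has a solution on any interval that is short compared to its coefficients. -/
theorem exists_solution_linear_ode {Y : Type*} [NormedAddCommGroup Y] [NormedSpace ℝ Y]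
    [CompleteSpace Y] {L : ℝ → Y →L[ℝ] Y} {a b C : ℝ} (hL : ContinuousOn L (Icc a b))
    (hC : ∀ t ∈ Icc a b, ‖L t‖ ≤ C) (hab : (b - a) * C ≤ 1 / 2) {t₀ : ℝ} (ht₀ : t₀ ∈ Icc a b)
    (z₀ : Y) :
    ∃ z : ℝ → Y, z t₀ = z₀ ∧ ∀ t ∈ Ioo a b, HasDerivAt z (L t (z t)) t := by
  have hC0 : 0 ≤ C := (norm_nonneg _).trans (hC t₀ ht₀)
  lift C to NNReal using hC0
  -- The radius of the ball grows with ‖z₀‖, in step with the bound C(2‖z₀‖ + 1) of the field on it.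
  -- Thus the admissible length of the interval does not depend on z₀.
  have hp : IsPicardLindelof (fun t y => L t y) (⟨t₀, ht₀⟩ : Icc a b) z₀
      (‖z₀‖₊ + 1) 0 (C * (2 * ‖z₀‖₊ + 1)) C := by
    refine ⟨fun t ht => ?_, fun x _ => ?_, fun t ht x hx => ?_, ?_⟩
    · exact ((L t).lipschitz.weaken (by exact_mod_cast hC t ht)).lipschitzOnWith
    · exact hL.clm_apply continuousOn_const
    · refine ((L t).le_opNorm x).trans ?_
      push_cast
      refine mul_le_mul (hC t ht) ?_ (norm_nonneg _) C.2
      have := norm_sub_norm_le x z₀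
      have h2 := mem_closedBall_iff_norm.1 hx
      push_cast at h2
      linarith
    · have hm : max (b - t₀) (t₀ - a) ≤ b - a :=
        max_le (by linarith [ht₀.1]) (by linarith [ht₀.2])
      push_cast
      have h1 : (C : ℝ) * (2 * ‖z₀‖ + 1) * max (b - t₀) (t₀ - a)
          ≤ (C : ℝ) * (2 * ‖z₀‖ + 1) * (b - a) := by gcongr
      nlinarith [norm_nonneg z₀]
  obtain ⟨z, hz, hz'⟩ := hp.exists_eq_forall_mem_Icc_hasDerivWithinAt₀
  exact ⟨z, hz, fun t ht => (hz' t (Ioo_subset_Icc_self ht)).hasDerivAt (Icc_mem_nhds ht.1 ht.2)⟩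

open Set Metric in
/-- The Picard–Lindelöf theorem, with the information that the solution stays in the ball. -/
theorem IsPicardLindelof.exists_solution_mem_closedBall {Y : Type*} [NormedAddCommGroup Y]
    [NormedSpace ℝ Y] [CompleteSpace Y] {f : ℝ → Y → Y} {tmin tmax : ℝ} {t₀ : Icc tmin tmax}
    {x₀ : Y} {a L K : NNReal} (hf : IsPicardLindelof f t₀ x₀ a 0 L K) :
    ∃ α : ℝ → Y, α t₀ = x₀ ∧ ∀ t ∈ Icc tmin tmax,
      HasDerivWithinAt α (f t (α t)) (Icc tmin tmax) t ∧ α t ∈ closedBall x₀ a := by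
  have hx : x₀ ∈ closedBall x₀ ((0 : NNReal) : ℝ) := mem_closedBall_self le_rfl
  obtain ⟨α, hα⟩ := ODE.FunSpace.exists_isFixedPt_next hf hx
  refine ⟨α.compProj, by rw [ODE.FunSpace.compProj_val, ← hα, ODE.FunSpace.next_apply₀],
    fun t ht => ⟨?_, α.compProj_mem_closedBall hf.mul_max_le⟩⟩
  apply ODE.hasDerivWithinAt_picard_Icc t₀.2 hf.continuousOn_uncurry
    α.continuous_compProj.continuousOn (fun _ ht' ↦ α.compProj_mem_closedBall hf.mul_max_le)
    x₀ ht |>.congr_of_mem _ ht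
  intro t' ht'
  nth_rw 1 [← hα]
  rw [ODE.FunSpace.compProj_of_mem ht', ODE.FunSpace.next_apply]

/-! ### Frobenius theorem with integrability along rays only. -/

section Frobenius

open Set Metric Filter Topology

variable {X Y : Type*} [NormedAddCommGroup X] [NormedSpace ℝ X] [NormedAddCommGroup Y]
  [NormedSpace ℝ Y]

/-- Second-order Taylor estimate for a map whose derivative is Lipschitz on a convex set. -/
theorem norm_sub_sub_fderiv_le_of_lipschitzOnWith {F : X → Y} {s : Set X} {K : NNReal}
    (hs : Convex ℝ s) (hd : ∀ p ∈ s, DifferentiableAt ℝ F p)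
    (hK : LipschitzOnWith K (fderiv ℝ F) s) {p h : X} (hp : p ∈ s) (hph : p + h ∈ s) :
    ‖F (p + h) - F p - fderiv ℝ F p h‖ ≤ K * ‖h‖ ^ 2 := by
  have hseg : segment ℝ p (p + h) ⊆ s := hs.segment_subset hp hph
  have := (convex_segment (𝕜 := ℝ) p (p + h)).norm_image_sub_le_of_norm_fderiv_le'
    (f := F) (φ := fderiv ℝ F p) (C := K * ‖h‖) (fun z hz => hd z (hseg hz)) (fun z hz => ?_)
    (left_mem_segment ℝ p (p + h)) (right_mem_segment ℝ p (p + h))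
  · simpa [pow_two, mul_assoc] using this
  · refine (hK.norm_sub_le (hseg hz) hp).trans ?_
    gcongr
    obtain ⟨c, hc, rfl⟩ := (segment_eq_image' ℝ p (p + h)) ▸ hz
    simp only [add_sub_cancel_left]
    rw [norm_smul, Real.norm_of_nonneg hc.1]
    exact mul_le_of_le_one_left (norm_nonneg _) hc.2

/-- A neighbourhood on which a `C²` map is bounded, together with its derivative, and both are
Lipschitz. -/
theorem ContDiffAt.exists_closedBall_bounds {F : X → Y} {p : X} (hF : ContDiffAt ℝ 2 F p)
    {N : Set X} (hN : N ∈ 𝓝 p) :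
    ∃ a > 0, ∃ K : NNReal, 1 ≤ K ∧ closedBall p a ⊆ N ∧
      (∀ q ∈ closedBall p a, DifferentiableAt ℝ F q ∧ ‖F q‖ ≤ K ∧ ‖fderiv ℝ F q‖ ≤ K) ∧
      LipschitzOnWith K F (closedBall p a) ∧ LipschitzOnWith K (fderiv ℝ F) (closedBall p a) := by
  have hF' : ContDiffAt ℝ 1 (fderiv ℝ F) p := hF.fderiv_right (by norm_num)
  obtain ⟨K₁, N₁, hN₁, hK₁⟩ := (hF.of_le (by norm_num : (1 : WithTop ℕ∞) ≤ 2)).exists_lipschitzOnWith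
  obtain ⟨K₂, N₂, hN₂, hK₂⟩ := hF'.exists_lipschitzOnWith
  have hev : ∀ᶠ q in 𝓝 p, DifferentiableAt ℝ F q :=
    (hF.eventually (by simp)).mono fun q hq => hq.differentiableAt (by norm_num)
  have hb : ∀ᶠ q in 𝓝 p, ‖F q‖ < ‖F p‖ + 1 :=
    hF.continuousAt.norm.eventually_lt continuousAt_const (by simp)
  have hb' : ∀ᶠ q in 𝓝 p, ‖fderiv ℝ F q‖ < ‖fderiv ℝ F p‖ + 1 :=
    hF'.continuousAt.norm.eventually_lt continuousAt_const (by simp)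
  obtain ⟨a, ha, hsub⟩ := nhds_basis_closedBall.mem_iff.1
    (inter_mem hN (inter_mem hN₁ (inter_mem hN₂ (inter_mem hev (inter_mem hb hb')))))
  refine ⟨a, ha, K₁ + K₂ + ‖F p‖₊ + ‖fderiv ℝ F p‖₊ + 1, by simp, fun q hq => (hsub hq).1,
    fun q hq => ?_, ?_, ?_⟩
  · obtain ⟨-, -, -, h1, h2, h3⟩ := hsub hq
    refine ⟨h1, (le_of_lt h2).trans ?_, (le_of_lt h3).trans ?_⟩ <;> push_cast
    · linarith [K₁.2, K₂.2, norm_nonneg (fderiv ℝ F p), show (0 : ℝ) ≤ K₁ from K₁.2,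
        show (0 : ℝ) ≤ K₂ from K₂.2]
    · linarith [K₁.2, K₂.2, norm_nonneg (F p), show (0 : ℝ) ≤ K₁ from K₁.2,
        show (0 : ℝ) ≤ K₂ from K₂.2]
  · refine (hK₁.mono fun q hq => (hsub hq).2.1).weaken ?_
    rw [show K₁ + K₂ + ‖F p‖₊ + ‖fderiv ℝ F p‖₊ + 1 = K₁ + (K₂ + ‖F p‖₊ + ‖fderiv ℝ F p‖₊ + 1) by ring]
    exact le_self_add
  · refine (hK₂.mono fun q hq => (hsub hq).2.2.1).weaken ?_
    rw [show K₁ + K₂ + ‖F p‖₊ + ‖fderiv ℝ F p‖₊ + 1 = K₂ + (K₁ + ‖F p‖₊ + ‖fderiv ℝ F p‖₊ + 1) by ring]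
    exact le_self_add

/-- Frobenius theorem, where the integrability condition is only known on a set `S` that contains
the solutions of the equation along rays. -/
theorem exists_hasFDerivAt_of_integrable_on [CompleteSpace Y] {F : X × Y → X →L[ℝ] Y}
    {S N : Set (X × Y)} {x₀ : X} {y₀ : Y} (hF : ContDiffAt ℝ 2 F (x₀, y₀))
    (hN : N ∈ 𝓝 (x₀, y₀)) {ρ : ℝ} (hρ : 0 < ρ)
    (hsym : ∀ p ∈ N, p ∈ S → ∀ v w, fderiv ℝ F p (v, F p v) w = fderiv ℝ F p (w, F p w) v)
    (hinv : ∀ v, ‖v‖ < ρ → ∀ u : ℝ → Y, u 0 = y₀ →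
      (∀ t ∈ Ioo (-2 : ℝ) 2, HasDerivAt u (F (x₀ + t • v, u t) v) t ∧ (x₀ + t • v, u t) ∈ N) →
      ∀ t ∈ Ioo (-2 : ℝ) 2, (x₀ + t • v, u t) ∈ S) :
    ∃ u : X → Y, u x₀ = y₀ ∧ ∀ᶠ x in 𝓝 x₀, HasFDerivAt u (F (x, u x)) x := by
  obtain ⟨a, ha, K, hK1, haN, hbd, hL, hL'⟩ := hF.exists_closedBall_bounds hN
  have hK1' : (1 : ℝ) ≤ K := hK1
  have hK0 : (0 : ℝ) < K := by linarith
  lift a to NNReal using ha.le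
  -- With speed at most K r, a solution moves by at most a/2 within time 2. The other a/2 is room
  -- for the comparison curve `q` below, which adds at most K · 2r.
  set r : ℝ := min (ρ / 2) (a / (4 * K)) with hr
  have hr0 : 0 < r := by positivity
  obtain ⟨r', hr'⟩ : ∃ r' : NNReal, (r' : ℝ) = r := ⟨⟨r, hr0.le⟩, rfl⟩
  have hrρ : r < ρ := (min_le_left _ _).trans_lt (by linarith)
  have hra : r * (4 * K) ≤ a := (le_div_iff₀ (by positivity)).1 (min_le_right _ _)
  have hra' : 2 * r ≤ a := by nlinarith
  have hmem : ∀ v : X, ‖v‖ ≤ r → ∀ t ∈ Icc (-2 : ℝ) 2, x₀ + t • v ∈ closedBall x₀ (a : ℝ) := by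
    intro v hv t ht
    rw [mem_closedBall_iff_norm, add_sub_cancel_left, norm_smul]
    have : |t| ≤ 2 := abs_le.2 ht
    calc |t| * ‖v‖ ≤ 2 * r := by gcongr
      _ ≤ a := hra'
  have hray : ∀ v : X, ‖v‖ ≤ r → ∃ u : ℝ → Y, u 0 = y₀ ∧ ∀ t ∈ Ioo (-2 : ℝ) 2,
      HasDerivAt u (F (x₀ + t • v, u t) v) t ∧ u t ∈ closedBall y₀ ((a : ℝ) / 2) := by
    intro v hv
    have hp : IsPicardLindelof (fun t y => F (x₀ + t • v, y) v)
        (⟨0, by norm_num⟩ : Icc (-2 : ℝ) 2) y₀ (a / 2) 0 (K * r') (K * r') := by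
      have hin : ∀ t ∈ Icc (-2 : ℝ) 2, ∀ y ∈ closedBall y₀ ((a / 2 : NNReal) : ℝ),
          (x₀ + t • v, y) ∈ closedBall (x₀, y₀) (a : ℝ) := by
        intro t ht y hy
        rw [← closedBall_prod_same]
        exact ⟨hmem v hv t ht, closedBall_subset_closedBall (by simp) hy⟩
      refine ⟨fun t ht => ?_, fun y hy => ?_, fun t ht y hy => ?_, ?_⟩
      · refine LipschitzOnWith.of_dist_le_mul fun y hy z hz => ?_
        have h1 := hL.dist_le_mul _ (hin t ht y hy) _ (hin t ht z hz)
        rw [dist_eq_norm, ← sub_apply]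
        refine (ContinuousLinearMap.le_opNorm _ _).trans ?_
        rw [← dist_eq_norm]
        push_cast
        have h2 : dist (x₀ + t • v, y) (x₀ + t • v, z) = dist y z := by simp [Prod.dist_eq]
        rw [h2] at h1
        calc _ ≤ (K * dist y z) * r := by gcongr
          _ = _ := by rw [hr']; ring
      · refine ContinuousOn.clm_apply ?_ continuousOn_const
        refine hL.continuousOn.comp (by fun_prop) fun t ht => hin t ht y hy
      · refine (ContinuousLinearMap.le_opNorm _ _).trans ?_
        push_cast
        rw [hr']
        exact mul_le_mul (hbd _ (hin t ht y hy)).2.1 hv (norm_nonneg _) hK0.le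
      · push_cast
        simp only [sub_zero, zero_sub, neg_neg, max_self, hr']
        linarith
    obtain ⟨u, hu0, hu⟩ := hp.exists_solution_mem_closedBall
    refine ⟨u, hu0, fun t ht => ⟨(hu t (Ioo_subset_Icc_self ht)).1.hasDerivAt
      (Icc_mem_nhds ht.1 ht.2), ?_⟩⟩
    simpa using (hu t (Ioo_subset_Icc_self ht)).2
  choose! U hU0 hU using hray
  have hball : ∀ v, ‖v‖ ≤ r → ∀ t ∈ Ioo (-2 : ℝ) 2,
      (x₀ + t • v, U v t) ∈ closedBall (x₀, y₀) (a : ℝ) := by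
    intro v hv t ht
    rw [← closedBall_prod_same]
    exact ⟨hmem v hv t (Ioo_subset_Icc_self ht),
      closedBall_subset_closedBall (by simp) (hU v hv t ht).2⟩
  have hUS : ∀ v, ‖v‖ ≤ r → ∀ t ∈ Ioo (-2 : ℝ) 2, (x₀ + t • v, U v t) ∈ S := fun v hv =>
    hinv v (hv.trans_lt hrρ) (U v) (hU0 v hv)
      fun t ht => ⟨(hU v hv t ht).1, haN (hball v hv t ht)⟩
  -- A quadratic error here says that x ↦ U (x - x₀) 1 has derivative F at each nearby x.
  have hest : ∀ v w, ‖v‖ ≤ r → ‖v + w‖ ≤ r →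
      ‖U (v + w) 1 - U v 1 - F (x₀ + v, U v 1) w‖ ≤
        ((K ^ 2 + K ^ 3 * r) / (K * r) * (Real.exp (K * r) - 1)) * ‖w‖ ^ 2 := by
    intro v w hv hvw
    have hw : ‖w‖ ≤ 2 * r := by
      have := norm_sub_le (v + w) v
      rw [add_sub_cancel_left] at this
      linarith
    have h01 : ∀ t ∈ Icc (0 : ℝ) 1, t ∈ Ioo (-2 : ℝ) 2 := fun t ht =>
      ⟨by linarith [ht.1], by linarith [ht.2]⟩
    set P : ℝ → X × Y := fun t => (x₀ + t • v, U v t) with hP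
    -- The expected first-order change of the solution when the ray v is replaced by v + w. It is
    -- shown to solve the equation along the new ray up to O(‖w‖²), and Grönwall compares it with
    -- the true solution.
    set q : ℝ → Y := fun t => U v t + t • F (P t) w with hq
    set h : ℝ → X × Y := fun t => (t • w, t • F (P t) w) with hh
    have hPder : ∀ t ∈ Icc (0 : ℝ) 1, HasDerivAt P (v, F (P t) v) t := by
      intro t ht
      refine HasDerivAt.prodMk ?_ (hU v hv t (h01 t ht)).1
      simpa using ((hasDerivAt_id t).smul_const v).const_add x₀
    have hqder : ∀ t ∈ Icc (0 : ℝ) 1, HasDerivAt q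
        (F (P t) v + (t • fderiv ℝ F (P t) (v, F (P t) v) w + F (P t) w)) t := by
      intro t ht
      have h1 : HasDerivAt (fun t => F (P t)) (fderiv ℝ F (P t) (v, F (P t) v)) t :=
        (hbd _ (hball v hv t (h01 t ht))).1.hasFDerivAt.comp_hasDerivAt t (hPder t ht)
      have h2 : HasDerivAt (fun t => F (P t) w) (fderiv ℝ F (P t) (v, F (P t) v) w) t := by
        simpa using h1.clm_apply (hasDerivAt_const t w)
      have h3 := (hasDerivAt_id t).smul h2
      refine ((hU v hv t (h01 t ht)).1.add h3).congr_deriv ?_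
      simp [hP]
    have hFw : ∀ t ∈ Icc (0 : ℝ) 1, ‖F (P t) w‖ ≤ K * ‖w‖ := fun t ht =>
      ((F (P t)).le_opNorm w).trans (by gcongr; exact (hbd _ (hball v hv t (h01 t ht))).2.1)
    have hqmem : ∀ t ∈ Icc (0 : ℝ) 1, q t ∈ closedBall y₀ (a : ℝ) := by
      intro t ht
      rw [mem_closedBall_iff_norm]
      have h1 := mem_closedBall_iff_norm.1 (hU v hv t (h01 t ht)).2
      calc ‖U v t + t • F (P t) w - y₀‖ = ‖(U v t - y₀) + t • F (P t) w‖ := by congr 1; abel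
        _ ≤ a / 2 + 1 * (K * (2 * r)) := by
          refine (norm_add_le _ _).trans (add_le_add h1 ?_)
          rw [norm_smul, Real.norm_of_nonneg ht.1]
          exact mul_le_mul ht.2 ((hFw t ht).trans (by gcongr)) (norm_nonneg _) zero_le_one
        _ ≤ a := by linarith
    have hPh : ∀ t, P t + h t = (x₀ + t • (v + w), q t) := by
      intro t
      simp only [hP, hh, hq, Prod.mk_add_mk, smul_add, add_assoc]
    have hPhmem : ∀ t ∈ Icc (0 : ℝ) 1, P t + h t ∈ closedBall (x₀, y₀) (a : ℝ) := by
      intro t ht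
      rw [hPh, ← closedBall_prod_same]
      exact ⟨hmem _ hvw t (Ioo_subset_Icc_self (h01 t ht)), hqmem t ht⟩
    have hwF : ∀ t ∈ Icc (0 : ℝ) 1, ‖((w, F (P t) w) : X × Y)‖ ≤ K * ‖w‖ := fun t ht =>
      max_le (le_mul_of_one_le_left (norm_nonneg _) hK1') (hFw t ht)
    have hhn : ∀ t ∈ Icc (0 : ℝ) 1, ‖h t‖ ≤ K * ‖w‖ := by
      intro t ht
      have : h t = t • ((w, F (P t) w) : X × Y) := rfl
      rw [this, norm_smul, Real.norm_of_nonneg ht.1]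
      exact (mul_le_of_le_one_left (norm_nonneg _) ht.2).trans (hwF t ht)
    have hgron := dist_le_of_approx_trajectories_ODE_of_mem (a := 0) (b := 1)
      (v := fun t y => F (x₀ + t • (v + w), y) (v + w)) (s := fun _ => closedBall y₀ (a : ℝ))
      (K := K * r') (f := U (v + w)) (g := q) (εf := 0)
      (εg := (K ^ 2 + K ^ 3 * r) * ‖w‖ ^ 2) (δ := 0)
      (f' := fun t => F (x₀ + t • (v + w), U (v + w) t) (v + w))
      (g' := fun t => F (P t) v + (t • fderiv ℝ F (P t) (v, F (P t) v) w + F (P t) w))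
      ?_ ?_ ?_ ?_ ?_ ?_ ?_ ?_ ?_ ?_ 1 (by norm_num)
    · rw [dist_eq_norm, gronwallBound_of_K_ne_0 (by push_cast; rw [hr']; positivity)]
        at hgron
      have e1 : U (v + w) 1 - q 1 = U (v + w) 1 - U v 1 - F (x₀ + v, U v 1) w := by
        simp only [hq, hP, one_smul]; abel
      rw [e1] at hgron
      refine hgron.trans (le_of_eq ?_)
      push_cast
      rw [hr']
      simp
      ring
    · intro t ht
      refine LipschitzOnWith.of_dist_le_mul fun y hy z hz => ?_
      have hin : ∀ y ∈ closedBall y₀ (a : ℝ),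
          (x₀ + t • (v + w), y) ∈ closedBall (x₀, y₀) (a : ℝ) := by
        intro y hy
        rw [← closedBall_prod_same]
        exact ⟨hmem _ hvw t (Ioo_subset_Icc_self (h01 t (Ico_subset_Icc_self ht))), hy⟩
      have h1 := hL.dist_le_mul _ (hin y hy) _ (hin z hz)
      rw [dist_eq_norm, ← sub_apply]
      refine (ContinuousLinearMap.le_opNorm _ _).trans ?_
      rw [← dist_eq_norm]
      push_cast
      have h2 : dist (x₀ + t • (v + w), y) (x₀ + t • (v + w), z) = dist y z := by
        simp [Prod.dist_eq]
      rw [h2] at h1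
      calc _ ≤ (K * dist y z) * r := by gcongr
        _ = _ := by rw [hr']; ring
    · exact fun t ht => (hU _ hvw t (h01 t ht)).1.continuousAt.continuousWithinAt
    · exact fun t ht => (hU _ hvw t (h01 t (Ico_subset_Icc_self ht))).1.hasDerivWithinAt
    · simp
    · exact fun t ht => closedBall_subset_closedBall (by simp)
        (hU _ hvw t (h01 t (Ico_subset_Icc_self ht))).2
    · exact fun t ht => (hqder t ht).continuousAt.continuousWithinAt
    · exact fun t ht => (hqder t (Ico_subset_Icc_self ht)).hasDerivWithinAt
    · intro t ht
      replace ht := Ico_subset_Icc_self ht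
      have hT := norm_sub_sub_fderiv_le_of_lipschitzOnWith (convex_closedBall _ _)
        (fun p hp => (hbd p hp).1) hL' (hball v hv t (h01 t ht)) (hPhmem t ht)
      -- Integrability enters here: exchanging v and w makes the terms of first order in w cancel,
      -- leaving only quadratic ones.
      have hsy := hsym (P t) (haN (hball v hv t (h01 t ht))) (hUS v hv t (h01 t ht)) v w
      rw [← hPh, dist_eq_norm, hsy]
      set R := F (P t + h t) - F (P t) - fderiv ℝ F (P t) (h t) with hR
      have e1 : F (P t + h t) = R + F (P t) + t • fderiv ℝ F (P t) (w, F (P t) w) := by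
        have : h t = t • ((w, F (P t) w) : X × Y) := rfl
        rw [hR, this, map_smul]; abel
      have e2 : F (P t) v + (t • fderiv ℝ F (P t) (w, F (P t) w) v + F (P t) w)
          - F (P t + h t) (v + w)
          = -(t • fderiv ℝ F (P t) (w, F (P t) w) w) - R (v + w) := by
        rw [e1]
        simp only [add_apply, smul_apply, map_add]
        abel
      rw [e2]
      calc _ ≤ ‖t • fderiv ℝ F (P t) (w, F (P t) w) w‖ + ‖R (v + w)‖ := by
            rw [← norm_neg (t • _)]; exact norm_sub_le _ _
        _ ≤ (K * (K * ‖w‖)) * ‖w‖ + (K * (K * ‖w‖) ^ 2) * r := by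
          refine add_le_add ?_ ?_
          · rw [norm_smul, Real.norm_of_nonneg ht.1]
            refine (mul_le_of_le_one_left (norm_nonneg _) ht.2).trans ?_
            refine (ContinuousLinearMap.le_opNorm _ _).trans ?_
            gcongr
            refine (ContinuousLinearMap.le_opNorm _ _).trans ?_
            exact mul_le_mul (hbd _ (hball v hv t (h01 t ht))).2.2 (hwF t ht) (norm_nonneg _) hK0.le
          · refine (ContinuousLinearMap.le_opNorm _ _).trans ?_
            gcongr
            refine hT.trans ?_
            gcongr
            exact hhn t ht
        _ = (K ^ 2 + K ^ 3 * r) * ‖w‖ ^ 2 := by ring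
    · exact fun t ht => hqmem t (Ico_subset_Icc_self ht)
    · simp [hq, hU0 v hv, hU0 _ hvw]
  refine ⟨fun x => U (x - x₀) 1, ?_, ?_⟩
  · have hn0 : ‖(0 : X)‖ ≤ r := by simpa using hr0.le
    have hc : ∀ t ∈ Icc (0 : ℝ) 1, U 0 t = U 0 0 := by
      refine constant_of_has_deriv_right_zero (f := U 0) (a := 0) (b := 1)
        (fun t ht => (hU 0 hn0 t ⟨by linarith [ht.1], by linarith [ht.2]⟩).1.continuousAt.continuousWithinAt)
        fun t ht => ?_
      simpa using (hU 0 hn0 t ⟨by linarith [ht.1], by linarith [ht.2]⟩).1.hasDerivWithinAt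
    simp only [sub_self]
    rw [hc 1 (by norm_num), hU0 0 hn0]
  · filter_upwards [ball_mem_nhds x₀ hr0] with x hx
    have hv : ‖x - x₀‖ < r := mem_ball_iff_norm.1 hx
    rw [hasFDerivAt_iff_isLittleO_nhds_zero]
    refine Asymptotics.IsBigO.trans_isLittleO (g := fun w : X => ‖w‖ ^ 2) ?_ ?_
    · refine Asymptotics.IsBigO.of_bound
        ((K ^ 2 + K ^ 3 * r) / (K * r) * (Real.exp (K * r) - 1)) ?_
      have : ∀ᶠ w : X in 𝓝 0, ‖x - x₀ + w‖ < r := by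
        refine ContinuousAt.eventually_lt (f := fun w : X => ‖x - x₀ + w‖) (by fun_prop)
          continuousAt_const (by simpa using hv)
      filter_upwards [this] with w hw
      have := hest (x - x₀) w hv.le hw.le
      rw [show x₀ + (x - x₀) = x by abel, show x - x₀ + w = x + w - x₀ by abel] at this
      simpa using this
    · exact Asymptotics.isLittleO_norm_pow_id one_lt_two

end Frobenius

/-! ### The jet equation of affine maps in a chart and its integrability condition. -/

section LocalGeometry

open Set Metric Filter Topology

variable {X Y : Type*} [NormedAddCommGroup X] [NormedSpace ℝ X] [NormedAddCommGroup Y]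
  [NormedSpace ℝ Y]

/-- Solutions of a smooth total differential equation are smooth. -/
theorem contDiffAt_infty_of_hasFDerivAt {F : X × Y → X →L[ℝ] Y} {u : X → Y} {x₀ : X}
    (hF : ∀ᶠ x in 𝓝 x₀, ContDiffAt ℝ ∞ F (x, u x))
    (hu : ∀ᶠ x in 𝓝 x₀, HasFDerivAt u (F (x, u x)) x) : ContDiffAt ℝ ∞ u x₀ := by
  obtain ⟨W, hW, hWo, hx₀⟩ := _root_.eventually_nhds_iff.1 (hF.and hu)
  have key : ∀ n : ℕ, ∀ x ∈ W, ContDiffAt ℝ n u x := by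
    intro n
    induction n with
    | zero =>
      intro x hx
      refine contDiffAt_zero.2 ⟨W, hWo.mem_nhds hx, fun y hy => ?_⟩
      exact (hW y hy).2.continuousAt.continuousWithinAt
    | succ n ih =>
      intro x hx
      refine contDiffAt_succ_iff_hasFDerivAt.2 ⟨fun y => F (y, u y),
        ⟨W, hWo.mem_nhds hx, fun y hy => (hW y hy).2⟩, ?_⟩
      exact ((hW x hx).1.of_le (by exact_mod_cast le_top)).comp x (contDiffAt_id.prodMk (ih x hx))
  exact contDiffAt_infty.2 fun n => key n x₀ hx₀

variable {E : Type*} [NormedAddCommGroup E] [NormedSpace ℝ E]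
  {E₁ : Type*} [NormedAddCommGroup E₁] [NormedSpace ℝ E₁]
  {E₂ : Type*} [NormedAddCommGroup E₂] [NormedSpace ℝ E₂]
  {E₃ : Type*} [NormedAddCommGroup E₃] [NormedSpace ℝ E₃]

/-- Torsion of the local representation `Γ` of a connection. -/
noncomputable def localTorsion (Γ : E → E →L[ℝ] E →L[ℝ] E) (x v w : E) : E := Γ x v w - Γ x w v

/-- Curvature of the local representation `Γ` of a connection. -/
noncomputable def localCurvature (Γ : E → E →L[ℝ] E →L[ℝ] E) (x v w z : E) : E :=
  Γ x (Γ x z w) v - Γ x (Γ x z v) w + fderiv ℝ Γ x w z v - fderiv ℝ Γ x v z w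

/-- The continuous linear map `A` from the tangent space at `x` to the one at `y` respects torsion
and curvature. -/
def Intertwines (Γ₁ : E₁ → E₁ →L[ℝ] E₁ →L[ℝ] E₁) (Γ₂ : E₂ → E₂ →L[ℝ] E₂ →L[ℝ] E₂) (x : E₁) (y : E₂)
    (A : E₁ →L[ℝ] E₂) : Prop :=
  (∀ v w, A (localTorsion Γ₁ x v w) = localTorsion Γ₂ y (A v) (A w)) ∧
    ∀ v w z, A (localCurvature Γ₁ x v w z) = localCurvature Γ₂ y (A v) (A w) (A z)

/-- Torsion and curvature of `Γ` are parallel at `x`. -/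
def ParallelTensorsAt (Γ : E → E →L[ℝ] E →L[ℝ] E) (x : E) : Prop :=
  (∀ u v w, fderiv ℝ (fun y => localTorsion Γ y v w) x u - Γ x (localTorsion Γ x v w) u
      + localTorsion Γ x (Γ x v u) w + localTorsion Γ x v (Γ x w u) = 0) ∧
    ∀ u v w z, fderiv ℝ (fun y => localCurvature Γ y v w z) x u
      - Γ x (localCurvature Γ x v w z) u + localCurvature Γ x (Γ x v u) w z
      + localCurvature Γ x v (Γ x w u) z + localCurvature Γ x v w (Γ x z u) = 0

/-- Near `x`, the map `F` is smooth and affine for the connections with local representations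
`Γ₁` and `Γ₂`. -/
def IsAffineNear (Γ₁ : E₁ → E₁ →L[ℝ] E₁ →L[ℝ] E₁) (Γ₂ : E₂ → E₂ →L[ℝ] E₂ →L[ℝ] E₂) (F : E₁ → E₂)
    (x : E₁) : Prop :=
  ∀ᶠ z in 𝓝 x, ContDiffAt ℝ ∞ F z ∧ ∀ v w, fderiv ℝ (fderiv ℝ F) z v w + fderiv ℝ F z (Γ₁ z v w) =
    Γ₂ (F z) (fderiv ℝ F z v) (fderiv ℝ F z w)

/-- The total differential equation for the 1-jet of an affine map. -/
noncomputable def jetField (Γ₁ : E₁ → E₁ →L[ℝ] E₁ →L[ℝ] E₁) (Γ₂ : E₂ → E₂ →L[ℝ] E₂ →L[ℝ] E₂)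
    (p : E₁ × (E₂ × (E₁ →L[ℝ] E₂))) : E₁ →L[ℝ] (E₂ × (E₁ →L[ℝ] E₂)) :=
  p.2.2.prod
    (((ContinuousLinearMap.compL ℝ E₁ E₂ E₂).flip p.2.2 ∘L ((Γ₂ p.2.1).flip ∘L p.2.2)) -
      (ContinuousLinearMap.compL ℝ E₁ E₁ E₂ p.2.2) ∘L (Γ₁ p.1).flip)

section

variable {Γ₁ : E₁ → E₁ →L[ℝ] E₁ →L[ℝ] E₁} {Γ₂ : E₂ → E₂ →L[ℝ] E₂ →L[ℝ] E₂}
  {Γ₃ : E₃ → E₃ →L[ℝ] E₃ →L[ℝ] E₃} {Γ : E → E →L[ℝ] E →L[ℝ] E}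

@[simp] theorem jetField_apply_fst (p : E₁ × (E₂ × (E₁ →L[ℝ] E₂))) (v : E₁) :
    (jetField Γ₁ Γ₂ p v).1 = p.2.2 v := rfl

-- The direction v of differentiation fills the second slot of both connections, as in ∇_ξ η = dη(ξ)
-- - B(η, ξ). The equation for the linear part thus says that it is parallel.
@[simp] theorem jetField_apply_snd (p : E₁ × (E₂ × (E₁ →L[ℝ] E₂))) (v z : E₁) :
    (jetField Γ₁ Γ₂ p v).2 z = Γ₂ p.2.1 (p.2.2 z) (p.2.2 v) - p.2.2 (Γ₁ p.1 z v) := rfl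

theorem contDiffAt_jetField {n : WithTop ℕ∞} {p : E₁ × (E₂ × (E₁ →L[ℝ] E₂))}
    (h₁ : ContDiffAt ℝ n Γ₁ p.1) (h₂ : ContDiffAt ℝ n Γ₂ p.2.1) :
    ContDiffAt ℝ n (jetField Γ₁ Γ₂) p := by
  have hA : ContDiffAt ℝ n (fun p : E₁ × (E₂ × (E₁ →L[ℝ] E₂)) => p.2.2) p := by fun_prop
  have hΓ₁ : ContDiffAt ℝ n (fun p : E₁ × (E₂ × (E₁ →L[ℝ] E₂)) => (Γ₁ p.1).flip) p :=
    ((ContinuousLinearMap.flipₗᵢ ℝ E₁ E₁ E₁).contDiff.contDiffAt).comp p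
      (h₁.comp p contDiffAt_fst)
  have hΓ₂ : ContDiffAt ℝ n (fun p : E₁ × (E₂ × (E₁ →L[ℝ] E₂)) => (Γ₂ p.2.1).flip) p :=
    ((ContinuousLinearMap.flipₗᵢ ℝ E₂ E₂ E₂).contDiff.contDiffAt).comp p
      (h₂.comp p (by fun_prop : ContDiffAt ℝ n (fun p : E₁ × (E₂ × (E₁ →L[ℝ] E₂)) => p.2.1) p))
  have hA₁ : ContDiffAt ℝ n (fun p : E₁ × (E₂ × (E₁ →L[ℝ] E₂)) =>
      (ContinuousLinearMap.compL ℝ E₁ E₂ E₂).flip p.2.2) p :=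
    ContDiff.comp_contDiffAt (g := (ContinuousLinearMap.compL ℝ E₁ E₂ E₂).flip) p
      (ContinuousLinearMap.contDiff _) hA
  have hA₂ : ContDiffAt ℝ n (fun p : E₁ × (E₂ × (E₁ →L[ℝ] E₂)) =>
      ContinuousLinearMap.compL ℝ E₁ E₁ E₂ p.2.2) p :=
    ContDiff.comp_contDiffAt (g := ContinuousLinearMap.compL ℝ E₁ E₁ E₂) p
      (ContinuousLinearMap.contDiff _) hA
  have h1 : ContDiffAt ℝ n (fun p : E₁ × (E₂ × (E₁ →L[ℝ] E₂)) =>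
      (ContinuousLinearMap.compL ℝ E₁ E₂ E₂).flip p.2.2 ∘L ((Γ₂ p.2.1).flip ∘L p.2.2)) p :=
    hA₁.clm_comp (hΓ₂.clm_comp hA)
  have h2 : ContDiffAt ℝ n (fun p : E₁ × (E₂ × (E₁ →L[ℝ] E₂)) =>
      (ContinuousLinearMap.compL ℝ E₁ E₁ E₂ p.2.2) ∘L (Γ₁ p.1).flip) p :=
    hA₂.clm_comp hΓ₁
  refine (((contDiffAt_const (c := ContinuousLinearMap.inl ℝ E₂ (E₁ →L[ℝ] E₂))).clm_comp hA).add
    ((contDiffAt_const (c := ContinuousLinearMap.inr ℝ E₂ (E₁ →L[ℝ] E₂))).clm_comp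
      (h1.sub h2))).congr_of_eventuallyEq (Eventually.of_forall fun q => ?_)
  refine ContinuousLinearMap.ext fun v => Prod.ext ?_ ?_
  · simp [jetField]
  · simp [jetField]

/-- Along a curve through `p`, the derivative of `jetField` applied to `w`. -/
theorem fderiv_jetField_apply {p : E₁ × (E₂ × (E₁ →L[ℝ] E₂))}
    (h₁ : ContDiffAt ℝ 1 Γ₁ p.1) (h₂ : ContDiffAt ℝ 1 Γ₂ p.2.1)
    (h : E₁ × (E₂ × (E₁ →L[ℝ] E₂))) (w : E₁) :
    (fderiv ℝ (jetField Γ₁ Γ₂) p h w).1 = h.2.2 w ∧ ∀ z, (fderiv ℝ (jetField Γ₁ Γ₂) p h w).2 z =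
      fderiv ℝ Γ₂ p.2.1 h.2.1 (p.2.2 z) (p.2.2 w) + Γ₂ p.2.1 (h.2.2 z) (p.2.2 w)
        + Γ₂ p.2.1 (p.2.2 z) (h.2.2 w) - h.2.2 (Γ₁ p.1 z w) - p.2.2 (fderiv ℝ Γ₁ p.1 h.1 z w) := by
  have hd := ((contDiffAt_jetField h₁ h₂).differentiableAt one_ne_zero).hasFDerivAt
  have hl : HasDerivAt (fun t : ℝ => p + t • h) h 0 := by
    simpa using ((hasDerivAt_id (0 : ℝ)).smul_const h).const_add p
  have hp0 : p + (0 : ℝ) • h = p := by simp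
  have hc : HasDerivAt (fun t : ℝ => jetField Γ₁ Γ₂ (p + t • h) w)
      (fderiv ℝ (jetField Γ₁ Γ₂) p h w) 0 := by
    have h0 : HasDerivAt (fun t : ℝ => jetField Γ₁ Γ₂ (p + t • h))
        (fderiv ℝ (jetField Γ₁ Γ₂) p h) 0 := hd.comp_hasDerivAt_of_eq 0 hl hp0.symm
    have := h0.clm_apply (hasDerivAt_const (0 : ℝ) w)
    rwa [map_zero, add_zero] at this
  have hA : HasDerivAt (fun t : ℝ => (p + t • h).2.2) h.2.2 0 := hl.snd.snd
  have hΓ₁ : HasDerivAt (fun t : ℝ => Γ₁ (p + t • h).1) (fderiv ℝ Γ₁ p.1 h.1) 0 :=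
    (h₁.differentiableAt one_ne_zero).hasFDerivAt.comp_hasDerivAt_of_eq 0 hl.fst (by rw [hp0])
  have hΓ₂ : HasDerivAt (fun t : ℝ => Γ₂ (p + t • h).2.1) (fderiv ℝ Γ₂ p.2.1 h.2.1) 0 :=
    (h₂.differentiableAt one_ne_zero).hasFDerivAt.comp_hasDerivAt_of_eq 0 hl.snd.fst (by rw [hp0])
  refine ⟨?_, fun z => ?_⟩
  · have := hA.clm_apply (hasDerivAt_const (0 : ℝ) w)
    rw [map_zero, add_zero] at this
    have hc1 : HasDerivAt (fun t : ℝ => (jetField Γ₁ Γ₂ (p + t • h) w).1)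
      (fderiv ℝ (jetField Γ₁ Γ₂) p h w).1 0 := hc.fst
    exact hc1.unique this
  · have hc2 : HasDerivAt (fun t : ℝ => (jetField Γ₁ Γ₂ (p + t • h) w).2)
      (fderiv ℝ (jetField Γ₁ Γ₂) p h w).2 0 := hc.snd
    have e1 := hc2.clm_apply (hasDerivAt_const (0 : ℝ) z)
    have hz := hA.clm_apply (hasDerivAt_const (0 : ℝ) z)
    have hw := hA.clm_apply (hasDerivAt_const (0 : ℝ) w)
    have e2 := ((hΓ₂.clm_apply hz).clm_apply hw).sub (hA.clm_apply
      ((hΓ₁.clm_apply (hasDerivAt_const (0 : ℝ) z)).clm_apply (hasDerivAt_const (0 : ℝ) w)))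
    have := e1.unique e2
    simp only [zero_smul, add_zero, map_zero, add_apply] at this
    rw [this]
    abel

/-- The integrability condition for `jetField` at a jet is that the jet respects torsion and
curvature. -/
theorem fderiv_jetField_symm_iff {p : E₁ × (E₂ × (E₁ →L[ℝ] E₂))}
    (h₁ : ContDiffAt ℝ 1 Γ₁ p.1) (h₂ : ContDiffAt ℝ 1 Γ₂ p.2.1) :
    (∀ v w, fderiv ℝ (jetField Γ₁ Γ₂) p (v, jetField Γ₁ Γ₂ p v) w =
      fderiv ℝ (jetField Γ₁ Γ₂) p (w, jetField Γ₁ Γ₂ p w) v) ↔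
      Intertwines Γ₁ Γ₂ p.1 p.2.1 p.2.2 := by
  have hT : ∀ v w, (fderiv ℝ (jetField Γ₁ Γ₂) p (v, jetField Γ₁ Γ₂ p v) w).1 -
      (fderiv ℝ (jetField Γ₁ Γ₂) p (w, jetField Γ₁ Γ₂ p w) v).1 =
      p.2.2 (localTorsion Γ₁ p.1 v w) - localTorsion Γ₂ p.2.1 (p.2.2 v) (p.2.2 w) := by
    intro v w
    rw [(fderiv_jetField_apply h₁ h₂ _ w).1, (fderiv_jetField_apply h₁ h₂ _ v).1]
    simp only [jetField_apply_snd, localTorsion, map_sub]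
    abel
  -- This component is the curvature defect only up to a term in the torsion defect, so torsion has
  -- to be settled before curvature.
  have hR : ∀ v w z, (fderiv ℝ (jetField Γ₁ Γ₂) p (v, jetField Γ₁ Γ₂ p v) w).2 z -
      (fderiv ℝ (jetField Γ₁ Γ₂) p (w, jetField Γ₁ Γ₂ p w) v).2 z =
      p.2.2 (localCurvature Γ₁ p.1 v w z)
        - localCurvature Γ₂ p.2.1 (p.2.2 v) (p.2.2 w) (p.2.2 z)
        + Γ₂ p.2.1 (p.2.2 z)
          (p.2.2 (localTorsion Γ₁ p.1 v w) - localTorsion Γ₂ p.2.1 (p.2.2 v) (p.2.2 w)) := by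
    intro v w z
    rw [(fderiv_jetField_apply h₁ h₂ _ w).2, (fderiv_jetField_apply h₁ h₂ _ v).2]
    simp only [jetField_apply_snd, jetField_apply_fst, localTorsion, localCurvature, map_sub,
      map_add, sub_apply]
    abel
  constructor
  · intro h
    have hT' : ∀ v w, p.2.2 (localTorsion Γ₁ p.1 v w) = localTorsion Γ₂ p.2.1 (p.2.2 v) (p.2.2 w) :=
      fun v w => by rw [← sub_eq_zero, ← hT, h, sub_self]
    refine ⟨hT', fun v w z => ?_⟩
    have := hR v w z
    rw [h, hT', sub_self, sub_self, map_zero, add_zero] at this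
    exact (sub_eq_zero.1 this.symm)
  · rintro ⟨h1, h2⟩ v w
    refine Prod.ext ?_ ?_
    · rw [← sub_eq_zero, hT, h1, sub_self]
    · ext z
      rw [← sub_eq_zero, hR, h1, h2, sub_self, sub_self, map_zero, add_zero]

theorem IsAffineNear.eventually {F : E₁ → E₂} {x : E₁} (h : IsAffineNear Γ₁ Γ₂ F x) :
    ∀ᶠ z in 𝓝 x, IsAffineNear Γ₁ Γ₂ F z :=
  eventually_eventually_nhds.2 h

/-- The equation of affine maps has the direction of differentiation in the first slot, the jet
equation in the second. The symmetry of the second derivative converts one into the other. -/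
theorem hasFDerivAt_jet_of_affine {F : E₁ → E₂} {z : E₁} (hs : ContDiffAt ℝ ∞ F z)
    (h : ∀ v w, fderiv ℝ (fderiv ℝ F) z v w + fderiv ℝ F z (Γ₁ z v w) =
      Γ₂ (F z) (fderiv ℝ F z v) (fderiv ℝ F z w)) :
    HasFDerivAt (fun z => (F z, fderiv ℝ F z)) (jetField Γ₁ Γ₂ (z, (F z, fderiv ℝ F z))) z := by
  have h1 := (hs.differentiableAt (by simp)).hasFDerivAt
  have h2 := ((hs.fderiv_right (m := ∞) (by simp)).differentiableAt (by simp)).hasFDerivAt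
  refine (h1.prodMk h2).congr_fderiv ?_
  refine ContinuousLinearMap.ext fun v => Prod.ext rfl ?_
  ext w
  have hsym := hs.isSymmSndFDerivAt (by simp; exact WithTop.coe_le_coe.2 (le_top (a := (2 : ℕ∞)))) v w
  simp only [ContinuousLinearMap.prod_apply, jetField_apply_snd]
  rw [hsym, ← h]
  abel

theorem IsAffineNear.hasFDerivAt_jet {F : E₁ → E₂} {x : E₁} (h : IsAffineNear Γ₁ Γ₂ F x) :
    ∀ᶠ z in 𝓝 x, HasFDerivAt (fun z => (F z, fderiv ℝ F z))
      (jetField Γ₁ Γ₂ (z, (F z, fderiv ℝ F z))) z :=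
  h.mono fun _ hz => hasFDerivAt_jet_of_affine hz.1 hz.2

/-- The derivative of an affine map respects torsion and curvature. -/
theorem IsAffineNear.intertwines {F : E₁ → E₂} {x : E₁} (h : IsAffineNear Γ₁ Γ₂ F x)
    (h₁ : ContDiffAt ℝ 1 Γ₁ x) (h₂ : ContDiffAt ℝ 1 Γ₂ (F x)) :
    Intertwines Γ₁ Γ₂ x (F x) (fderiv ℝ F x) := by
  set u : E₁ → E₂ × (E₁ →L[ℝ] E₂) := fun z => (F z, fderiv ℝ F z) with hu
  have hj : ∀ᶠ z in 𝓝 x, HasFDerivAt u (jetField Γ₁ Γ₂ (z, u z)) z := h.hasFDerivAt_jet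
  have hd : HasFDerivAt (jetField Γ₁ Γ₂) (fderiv ℝ (jetField Γ₁ Γ₂) (x, u x)) (x, u x) :=
    ((contDiffAt_jetField (p := (x, u x)) h₁ h₂).differentiableAt one_ne_zero).hasFDerivAt
  have h2 : HasFDerivAt (fun z => jetField Γ₁ Γ₂ (z, u z)) (fderiv ℝ (jetField Γ₁ Γ₂) (x, u x) ∘L
      (ContinuousLinearMap.id ℝ E₁).prod (jetField Γ₁ Γ₂ (x, u x))) x :=
    HasFDerivAt.comp (g := jetField Γ₁ Γ₂) (f := fun z => (z, u z)) x hd ((hasFDerivAt_id x).prodMk hj.self_of_nhds)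
  -- The integrability condition at the jet is the symmetry of the second derivative of the jet map
  -- `u`.
  refine (fderiv_jetField_symm_iff (p := (x, u x)) h₁ h₂).1 fun v w => ?_
  simpa using second_derivative_symmetric_of_eventually hj h2 v w

/-- A solution of the total differential equation for jets is the jet of an affine map. -/
theorem isAffineNear_of_hasFDerivAt_jetField {u : E₁ → E₂ × (E₁ →L[ℝ] E₂)} {x : E₁}
    (h₁ : ∀ᶠ z in 𝓝 x, ContDiffAt ℝ ∞ Γ₁ z) (h₂ : ∀ᶠ y in 𝓝 (u x).1, ContDiffAt ℝ ∞ Γ₂ y)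
    (hu : ∀ᶠ z in 𝓝 x, HasFDerivAt u (jetField Γ₁ Γ₂ (z, u z)) z) :
    IsAffineNear Γ₁ Γ₂ (fun z => (u z).1) x ∧ fderiv ℝ (fun z => (u z).1) x = (u x).2 := by
  have hd : ∀ᶠ z in 𝓝 x, fderiv ℝ (fun z => (u z).1) z = (u z).2 :=
    hu.mono fun z hz => (hz.fst).fderiv
  have hc : ContinuousAt (fun z => (u z).1) x := hu.self_of_nhds.fst.continuousAt
  have hsm : ∀ᶠ z in 𝓝 x, ContDiffAt ℝ ∞ u z := by
    have : ∀ᶠ z in 𝓝 x, ContDiffAt ℝ ∞ (jetField Γ₁ Γ₂) (z, u z) := by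
      filter_upwards [h₁, hc.eventually h₂] with z hz1 hz2
      exact contDiffAt_jetField (p := (z, u z)) hz1 hz2
    filter_upwards [eventually_eventually_nhds.2 this, eventually_eventually_nhds.2 hu]
      with z hz1 hz2 using contDiffAt_infty_of_hasFDerivAt hz1 hz2
  refine ⟨?_, hd.self_of_nhds⟩
  filter_upwards [hsm, hu, eventually_eventually_nhds.2 hd] with z hz1 hz2 hz3
  have hs : ContDiffAt ℝ ∞ (fun z => (u z).1) z := contDiffAt_fst.comp z hz1
  refine ⟨hs, fun v w => ?_⟩
  have e2 : fderiv ℝ (fderiv ℝ fun z => (u z).1) z =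
      (ContinuousLinearMap.snd ℝ E₂ (E₁ →L[ℝ] E₂)) ∘L jetField Γ₁ Γ₂ (z, u z) := by
    rw [EventuallyEq.fderiv_eq hz3]
    exact hz2.snd.fderiv
  have hsym := hs.isSymmSndFDerivAt (by simp; exact WithTop.coe_le_coe.2 (le_top (a := (2 : ℕ∞)))) v w
  rw [hsym, e2, hz3.self_of_nhds]
  simp

end

end LocalGeometry

theorem two_le_infty : (2 : WithTop ℕ∞) ≤ ∞ := WithTop.coe_le_coe.2 (le_top (a := (2 : ℕ∞)))

/-! ### Invariance of the tensor condition; local existence and uniqueness of affine maps. -/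

section LocalExistence

open Set Metric Filter Topology

variable {E : Type*} [NormedAddCommGroup E] [NormedSpace ℝ E]
  {E₁ : Type*} [NormedAddCommGroup E₁] [NormedSpace ℝ E₁]
  {E₂ : Type*} [NormedAddCommGroup E₂] [NormedSpace ℝ E₂]
  {E₃ : Type*} [NormedAddCommGroup E₃] [NormedSpace ℝ E₃]
  {Γ₁ : E₁ → E₁ →L[ℝ] E₁ →L[ℝ] E₁} {Γ₂ : E₂ → E₂ →L[ℝ] E₂ →L[ℝ] E₂}
  {Γ₃ : E₃ → E₃ →L[ℝ] E₃ →L[ℝ] E₃} {Γ : E → E →L[ℝ] E →L[ℝ] E}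

/-- Leibniz rule in the form needed for `ParallelTensorsAt`, where the tensor is differentiated with
frozen arguments. The explicit formula `key` is used for the given fields and for constant ones; the
latter identifies the frozen term. -/
theorem HasDerivAt.localTorsion {c V W : ℝ → E} {d v' w' : E} {t : ℝ}
    (hΓ : DifferentiableAt ℝ Γ (c t)) (hc : HasDerivAt c d t) (hV : HasDerivAt V v' t)
    (hW : HasDerivAt W w' t) :
    HasDerivAt (fun t => localTorsion Γ (c t) (V t) (W t))
      (fderiv ℝ (fun y => localTorsion Γ y (V t) (W t)) (c t) d + localTorsion Γ (c t) v' (W t)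
        + localTorsion Γ (c t) (V t) w') t := by
  have hG : HasDerivAt (fun t => Γ (c t)) (fderiv ℝ Γ (c t) d) t :=
    HasFDerivAt.comp_hasDerivAt (l := Γ) t hΓ.hasFDerivAt hc
  have key : ∀ {V W : ℝ → E} {v' w' : E}, HasDerivAt V v' t → HasDerivAt W w' t →
      HasDerivAt (fun t => _root_.localTorsion Γ (c t) (V t) (W t))
        ((fderiv ℝ Γ (c t) d (V t) (W t) - fderiv ℝ Γ (c t) d (W t) (V t))
          + _root_.localTorsion Γ (c t) v' (W t) + _root_.localTorsion Γ (c t) (V t) w') t := by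
    intro V W v' w' hV hW
    refine (((hG.clm_apply hV).clm_apply hW).sub ((hG.clm_apply hW).clm_apply hV)).congr_deriv ?_
    simp only [_root_.localTorsion, add_apply]
    abel
  have hdiff : DifferentiableAt ℝ (fun y => _root_.localTorsion Γ y (V t) (W t)) (c t) := by
    unfold _root_.localTorsion
    fun_prop
  have h1 := hdiff.hasFDerivAt.comp_hasDerivAt t hc
  have h2 := key (hasDerivAt_const t (V t)) (hasDerivAt_const t (W t))
  have h3 := h1.unique h2
  refine (key hV hW).congr_deriv ?_
  rw [h3]
  simp [_root_.localTorsion]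

/-- Same argument as for the torsion. Since the curvature contains a derivative of `Γ`, two
derivatives of `Γ` are needed. -/
theorem HasDerivAt.localCurvature {c V W Z : ℝ → E} {d v' w' z' : E} {t : ℝ}
    (hΓ : ContDiffAt ℝ 2 Γ (c t)) (hc : HasDerivAt c d t) (hV : HasDerivAt V v' t)
    (hW : HasDerivAt W w' t) (hZ : HasDerivAt Z z' t) :
    HasDerivAt (fun t => localCurvature Γ (c t) (V t) (W t) (Z t))
      (fderiv ℝ (fun y => localCurvature Γ y (V t) (W t) (Z t)) (c t) d
        + localCurvature Γ (c t) v' (W t) (Z t) + localCurvature Γ (c t) (V t) w' (Z t)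
        + localCurvature Γ (c t) (V t) (W t) z') t := by
  have hΓd : DifferentiableAt ℝ Γ (c t) := hΓ.differentiableAt (by norm_num)
  have hΓd' : DifferentiableAt ℝ (fderiv ℝ Γ) (c t) :=
    (hΓ.fderiv_right (m := 1) (by norm_num)).differentiableAt (by norm_num)
  have hG : HasDerivAt (fun t => Γ (c t)) (fderiv ℝ Γ (c t) d) t :=
    HasFDerivAt.comp_hasDerivAt (l := Γ) t hΓd.hasFDerivAt hc
  have hG' : HasDerivAt (fun t => fderiv ℝ Γ (c t)) (fderiv ℝ (fderiv ℝ Γ) (c t) d) t :=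
    hΓd'.hasFDerivAt.comp_hasDerivAt_of_eq t hc rfl
  set G' := fderiv ℝ Γ (c t) d with hG'def
  set G'' := fderiv ℝ (fderiv ℝ Γ) (c t) d with hG''def
  have key : ∀ {V W Z : ℝ → E} {v' w' z' : E}, HasDerivAt V v' t → HasDerivAt W w' t →
      HasDerivAt Z z' t → HasDerivAt (fun t => _root_.localCurvature Γ (c t) (V t) (W t) (Z t))
        ((G' (Γ (c t) (Z t) (W t)) (V t) + Γ (c t) (G' (Z t) (W t)) (V t)
          - G' (Γ (c t) (Z t) (V t)) (W t) - Γ (c t) (G' (Z t) (V t)) (W t)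
          + G'' (W t) (Z t) (V t) - G'' (V t) (Z t) (W t))
          + _root_.localCurvature Γ (c t) v' (W t) (Z t)
          + _root_.localCurvature Γ (c t) (V t) w' (Z t)
          + _root_.localCurvature Γ (c t) (V t) (W t) z') t := by
    intro V W Z v' w' z' hV hW hZ
    have hZW := (hG.clm_apply hZ).clm_apply hW
    have hZV := (hG.clm_apply hZ).clm_apply hV
    have h1 := (hG.clm_apply hZW).clm_apply hV
    have h2 := (hG.clm_apply hZV).clm_apply hW
    have h3 := ((hG'.clm_apply hW).clm_apply hZ).clm_apply hV
    have h4 := ((hG'.clm_apply hV).clm_apply hZ).clm_apply hW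
    refine (((h1.sub h2).add h3).sub h4).congr_deriv ?_
    simp only [_root_.localCurvature, add_apply, map_add]
    abel
  have hdiff : DifferentiableAt ℝ (fun y => _root_.localCurvature Γ y (V t) (W t) (Z t)) (c t) := by
    unfold _root_.localCurvature
    fun_prop
  have h1 := hdiff.hasFDerivAt.comp_hasDerivAt t hc
  have h2 := key (hasDerivAt_const t (V t)) (hasDerivAt_const t (W t)) (hasDerivAt_const t (Z t))
  have h3 := h1.unique h2
  refine (key hV hW hZ).congr_deriv ?_
  rw [h3]
  simp [_root_.localCurvature]

/-- If the torsion is parallel, it maps parallel fields along a curve to parallel fields. -/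
theorem ParallelTensorsAt.hasDerivAt_localTorsion {c V W : ℝ → E} {d : E} {t : ℝ}
    (hp : ParallelTensorsAt Γ (c t)) (hΓ : DifferentiableAt ℝ Γ (c t)) (hc : HasDerivAt c d t)
    (hV : HasDerivAt V (Γ (c t) (V t) d) t) (hW : HasDerivAt W (Γ (c t) (W t) d) t) :
    HasDerivAt (fun t => localTorsion Γ (c t) (V t) (W t))
      (Γ (c t) (localTorsion Γ (c t) (V t) (W t)) d) t := by
  refine (HasDerivAt.localTorsion hΓ hc hV hW).congr_deriv ?_
  rw [← sub_eq_zero, ← hp.1 d (V t) (W t)]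
  abel

/-- If the curvature is parallel, it maps parallel fields along a curve to parallel fields. -/
theorem ParallelTensorsAt.hasDerivAt_localCurvature {c V W Z : ℝ → E} {d : E} {t : ℝ}
    (hp : ParallelTensorsAt Γ (c t)) (hΓ : ContDiffAt ℝ 2 Γ (c t)) (hc : HasDerivAt c d t)
    (hV : HasDerivAt V (Γ (c t) (V t) d) t) (hW : HasDerivAt W (Γ (c t) (W t) d) t)
    (hZ : HasDerivAt Z (Γ (c t) (Z t) d) t) :
    HasDerivAt (fun t => localCurvature Γ (c t) (V t) (W t) (Z t))
      (Γ (c t) (localCurvature Γ (c t) (V t) (W t) (Z t)) d) t := by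
  refine (HasDerivAt.localCurvature hΓ hc hV hW hZ).congr_deriv ?_
  rw [← sub_eq_zero, ← hp.2 d (V t) (W t) (Z t)]
  abel

/-- Solutions of the jet equation map parallel fields to parallel fields. -/
theorem hasDerivAt_jet_apply_parallel {c : ℝ → E₁} {d : E₁} {u : ℝ → E₂ × (E₁ →L[ℝ] E₂)}
    {V : ℝ → E₁} {t : ℝ} (hu : HasDerivAt u (jetField Γ₁ Γ₂ (c t, u t) d) t)
    (hV : HasDerivAt V (Γ₁ (c t) (V t) d) t) :
    HasDerivAt (fun t => (u t).2 (V t)) (Γ₂ (u t).1 ((u t).2 (V t)) ((u t).2 d)) t := by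
  have h2 : HasDerivAt (fun t => (u t).2) (jetField Γ₁ Γ₂ (c t, u t) d).2 t := hu.snd
  refine (h2.clm_apply hV).congr_deriv ?_
  simp

/-- The set of jets that respect torsion and curvature is invariant under the jet equation along
curves, if the tensors are parallel. -/
theorem intertwines_of_hasDerivAt_jetField {s : Set ℝ} (hs : IsOpen s) (hsc : IsPreconnected s)
    {c d : ℝ → E₁} {u : ℝ → E₂ × (E₁ →L[ℝ] E₂)} (hd : ContinuousOn d s)
    (hc : ∀ t ∈ s, HasDerivAt c (d t) t)
    (hu : ∀ t ∈ s, HasDerivAt u (jetField Γ₁ Γ₂ (c t, u t) (d t)) t)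
    (h₁ : ∀ t ∈ s, ContDiffAt ℝ 2 Γ₁ (c t)) (h₂ : ∀ t ∈ s, ContDiffAt ℝ 2 Γ₂ (u t).1)
    (p₁ : ∀ t ∈ s, ParallelTensorsAt Γ₁ (c t)) (p₂ : ∀ t ∈ s, ParallelTensorsAt Γ₂ (u t).1)
    (hpar : ∀ t₁ ∈ s, ∀ v, ∃ V : ℝ → E₁, V t₁ = v ∧
      ∀ t ∈ s, HasDerivAt V (Γ₁ (c t) (V t) (d t)) t)
    {t₀ : ℝ} (ht₀ : t₀ ∈ s) (h₀ : Intertwines Γ₁ Γ₂ (c t₀) (u t₀).1 (u t₀).2) :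
    ∀ t ∈ s, Intertwines Γ₁ Γ₂ (c t) (u t).1 (u t).2 := by
  have huc : ContinuousOn u s := fun t ht => (hu t ht).continuousAt.continuousWithinAt
  have hec : ContinuousOn (fun t => ((u t).1, (u t).2 (d t))) s :=
    huc.fst.prodMk (huc.snd.clm_apply hd)
  have hGc : ∀ (f : ℝ → E₂), ∀ t ∈ s, ContDiffAt ℝ 1
      (fun q : (E₂ × E₂) × E₂ => Γ₂ q.1.1 q.2 q.1.2) (((u t).1, (u t).2 (d t)), f t) := by
    intro f t ht
    have hg : ContDiffAt ℝ 1 (fun q : (E₂ × E₂) × E₂ => Γ₂ q.1.1)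
        (((u t).1, (u t).2 (d t)), f t) :=
      ContDiffAt.comp _ (g := Γ₂) (f := fun q : (E₂ × E₂) × E₂ => q.1.1)
        ((h₂ t ht).of_le (by norm_num)) (by fun_prop)
    exact (hg.clm_apply (by fun_prop)).clm_apply (by fun_prop)
  have hyd : ∀ t ∈ s, HasDerivAt (fun t => (u t).1) ((u t).2 (d t)) t := fun t ht => (hu t ht).fst
  -- Parallel fields along the image curve that agree at t₀ agree throughout. Both sides of each
  -- identity to be shown are such fields when the arguments are parallel.
  have huniq : ∀ f g : ℝ → E₂,
      (∀ t ∈ s, HasDerivAt f (Γ₂ (u t).1 (f t) ((u t).2 (d t))) t) →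
      (∀ t ∈ s, HasDerivAt g (Γ₂ (u t).1 (g t) ((u t).2 (d t))) t) → f t₀ = g t₀ → EqOn f g s :=
    fun f g hf hg h => ode_unique_of_contDiffAt hs hsc hec (hGc f) hf hg ht₀ h
  intro t ht
  constructor
  · intro v w
    -- The parallel fields are prescribed at the time t in question; `h₀` covers whatever values
    -- they take at t₀.
    obtain ⟨V, rfl, hV⟩ := hpar t ht v
    obtain ⟨W, rfl, hW⟩ := hpar t ht w
    refine huniq (fun t => (u t).2 (localTorsion Γ₁ (c t) (V t) (W t)))
      (fun t => localTorsion Γ₂ (u t).1 ((u t).2 (V t)) ((u t).2 (W t))) ?_ ?_ (h₀.1 _ _) ht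
    · exact fun τ hτ => hasDerivAt_jet_apply_parallel (hu τ hτ) ((p₁ τ hτ).hasDerivAt_localTorsion
        ((h₁ τ hτ).differentiableAt (by norm_num)) (hc τ hτ) (hV τ hτ) (hW τ hτ))
    · exact fun τ hτ => ParallelTensorsAt.hasDerivAt_localTorsion (c := fun t => (u t).1) (p₂ τ hτ)
        ((h₂ τ hτ).differentiableAt (by norm_num)) (hyd τ hτ)
        (hasDerivAt_jet_apply_parallel (hu τ hτ) (hV τ hτ))
        (hasDerivAt_jet_apply_parallel (hu τ hτ) (hW τ hτ))
  · intro v w z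
    obtain ⟨V, rfl, hV⟩ := hpar t ht v
    obtain ⟨W, rfl, hW⟩ := hpar t ht w
    obtain ⟨Z, rfl, hZ⟩ := hpar t ht z
    refine huniq (fun t => (u t).2 (localCurvature Γ₁ (c t) (V t) (W t) (Z t)))
      (fun t => localCurvature Γ₂ (u t).1 ((u t).2 (V t)) ((u t).2 (W t)) ((u t).2 (Z t))) ?_ ?_
      (h₀.2 _ _ _) ht
    · exact fun τ hτ => hasDerivAt_jet_apply_parallel (hu τ hτ)
        ((p₁ τ hτ).hasDerivAt_localCurvature (h₁ τ hτ) (hc τ hτ) (hV τ hτ) (hW τ hτ) (hZ τ hτ))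
    · exact fun τ hτ => ParallelTensorsAt.hasDerivAt_localCurvature (c := fun t => (u t).1)
        (p₂ τ hτ) (h₂ τ hτ) (hyd τ hτ)
        (hasDerivAt_jet_apply_parallel (hu τ hτ) (hV τ hτ))
        (hasDerivAt_jet_apply_parallel (hu τ hτ) (hW τ hτ))
        (hasDerivAt_jet_apply_parallel (hu τ hτ) (hZ τ hτ))

/-- Parallel fields with prescribed value exist along short curves. -/
theorem exists_parallel_field [CompleteSpace E] {c d : ℝ → E} {a b C : ℝ}
    (hΓ : ContinuousOn (fun t => Γ (c t)) (Icc a b)) (hd : ContinuousOn d (Icc a b))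
    (hC : ∀ t ∈ Icc a b, ‖Γ (c t)‖ * ‖d t‖ ≤ C) (hab : (b - a) * C ≤ 1 / 2) {t₁ : ℝ}
    (ht₁ : t₁ ∈ Ioo a b) (v : E) :
    ∃ V : ℝ → E, V t₁ = v ∧ ∀ t ∈ Ioo a b, HasDerivAt V (Γ (c t) (V t) (d t)) t := by
  refine exists_solution_linear_ode (L := fun t => (Γ (c t)).flip (d t)) (C := C) ?_ ?_ hab
    (Ioo_subset_Icc_self ht₁) v
  · exact ((ContinuousLinearMap.flipₗᵢ ℝ E E E).continuous.comp_continuousOn hΓ).clm_apply hd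
  · intro t ht
    refine (ContinuousLinearMap.le_opNorm _ _).trans ?_
    rw [ContinuousLinearMap.opNorm_flip]
    exact hC t ht

/-- The connection is smooth with parallel tensors near `x`. -/
def GoodNear (Γ : E → E →L[ℝ] E →L[ℝ] E) (x : E) : Prop :=
  ∀ᶠ z in 𝓝 x, ContDiffAt ℝ ∞ Γ z ∧ ParallelTensorsAt Γ z

theorem GoodNear.contDiffAt {x : E} (h : GoodNear Γ x) {n : ℕ} : ContDiffAt ℝ n Γ x :=
  h.self_of_nhds.1.of_le (by exact_mod_cast le_top)

/-- Local existence of affine maps with given 1-jet. -/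
theorem exists_isAffineNear [CompleteSpace E₁] [CompleteSpace E₂] {x₀ : E₁} {y₀ : E₂}
    {A : E₁ →L[ℝ] E₂} (h₁ : GoodNear Γ₁ x₀) (h₂ : GoodNear Γ₂ y₀)
    (hA : Intertwines Γ₁ Γ₂ x₀ y₀ A) :
    ∃ F : E₁ → E₂, F x₀ = y₀ ∧ fderiv ℝ F x₀ = A ∧ IsAffineNear Γ₁ Γ₂ F x₀ := by
  set C : ℝ := ‖Γ₁ x₀‖ + 1 with hCdef
  have hC0 : 0 < C := by positivity
  have hb : ∀ᶠ z in 𝓝 x₀, ‖Γ₁ z‖ < C :=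
    have hc : ContinuousAt Γ₁ x₀ := (h₁.contDiffAt (n := 0)).continuousAt
    have hn := hc.norm
    hn.eventually_lt continuousAt_const (lt_add_one ‖Γ₁ x₀‖)
  have hN : ∀ᶠ p : E₁ × (E₂ × (E₁ →L[ℝ] E₂)) in 𝓝 (x₀, (y₀, A)),
      ((ContDiffAt ℝ ∞ Γ₁ p.1 ∧ ParallelTensorsAt Γ₁ p.1) ∧ ‖Γ₁ p.1‖ < C) ∧
        (ContDiffAt ℝ ∞ Γ₂ p.2.1 ∧ ParallelTensorsAt Γ₂ p.2.1) := by
    have e1 := (continuous_fst.tendsto (x₀, (y₀, A))).eventually (h₁.and hb)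
    have hc2 : Continuous fun p : E₁ × (E₂ × (E₁ →L[ℝ] E₂)) => p.2.1 := by fun_prop
    have e2 := (hc2.tendsto (x₀, (y₀, A))).eventually h₂
    exact e1.and e2
  -- Subintervals of (-2, 2) have length at most 4, so C‖v‖ ≤ 1/8 is what `exists_parallel_field`
  -- requires.
  have hinv : ∀ v : E₁, ‖v‖ < 1 / (8 * C) → ∀ u : ℝ → E₂ × (E₁ →L[ℝ] E₂), u 0 = (y₀, A) →
      (∀ t ∈ Ioo (-2 : ℝ) 2, HasDerivAt u (jetField Γ₁ Γ₂ (x₀ + t • v, u t) v) t ∧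
        (((ContDiffAt ℝ ∞ Γ₁ (x₀ + t • v) ∧ ParallelTensorsAt Γ₁ (x₀ + t • v)) ∧
          ‖Γ₁ (x₀ + t • v)‖ < C) ∧
            (ContDiffAt ℝ ∞ Γ₂ (u t).1 ∧ ParallelTensorsAt Γ₂ (u t).1))) →
      ∀ t ∈ Ioo (-2 : ℝ) 2, Intertwines Γ₁ Γ₂ (x₀ + t • v) (u t).1 (u t).2 := by
    intro v hv u hu0 hu t ht
    -- Parallel fields are constructed from data on a closed interval, so (-2, 2) is shrunk to some
    -- [-b, b] whose interior contains 0 and t.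
    obtain ⟨b, hb1, hb2⟩ := exists_between (max_lt (abs_lt.2 ht) (zero_lt_two' ℝ))
    obtain ⟨hb1, hb0⟩ := max_lt_iff.1 hb1
    have hsub : Icc (-b) b ⊆ Ioo (-2 : ℝ) 2 := Icc_subset_Ioo (by linarith) hb2
    have hsub' : Ioo (-b) b ⊆ Ioo (-2 : ℝ) 2 := Ioo_subset_Icc_self.trans hsub
    have hcd : ∀ t, HasDerivAt (fun t : ℝ => x₀ + t • v) v t := fun t => by
      simpa using ((hasDerivAt_id t).smul_const v).const_add x₀
    refine intertwines_of_hasDerivAt_jetField (s := Ioo (-b) b) isOpen_Ioo isPreconnected_Ioo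
      (c := fun t => x₀ + t • v) (d := fun _ => v) (u := u) continuousOn_const (fun t _ => hcd t)
      (fun t ht => (hu t (hsub' ht)).1)
      (fun t ht => (hu t (hsub' ht)).2.1.1.1.of_le two_le_infty)
      (fun t ht => (hu t (hsub' ht)).2.2.1.of_le two_le_infty)
      (fun t ht => (hu t (hsub' ht)).2.1.1.2) (fun t ht => (hu t (hsub' ht)).2.2.2)
      ?_ (t₀ := 0) ⟨by linarith, hb0⟩ (by simpa [hu0] using hA) t (abs_lt.1 hb1)
    intro t₁ ht₁ w
    refine exists_parallel_field (c := fun t => x₀ + t • v) (d := fun _ => v) (C := C * ‖v‖)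
      (fun τ hτ => ?_) continuousOn_const (fun τ hτ => ?_) ?_ ht₁ w
    · exact ContinuousAt.continuousWithinAt (ContinuousAt.comp (g := Γ₁)
        (hu τ (hsub hτ)).2.1.1.1.continuousAt (hcd τ).continuousAt)
    · exact mul_le_mul_of_nonneg_right (hu τ (hsub hτ)).2.1.2.le (norm_nonneg _)
    · have h1 : C * ‖v‖ ≤ 1 / 8 := by
        have := (lt_div_iff₀ (by positivity)).1 hv
        linarith
      nlinarith [mul_nonneg hC0.le (norm_nonneg v)]
  obtain ⟨u, hu0, hu⟩ := exists_hasFDerivAt_of_integrable_on (F := jetField Γ₁ Γ₂)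
    (S := {p | Intertwines Γ₁ Γ₂ p.1 p.2.1 p.2.2}) (x₀ := x₀) (y₀ := (y₀, A))
    (contDiffAt_jetField (h₁.contDiffAt (n := 2)) (h₂.contDiffAt (n := 2))) hN
    (ρ := 1 / (8 * C)) (by positivity)
    (fun p hp hpS => (fderiv_jetField_symm_iff (h₁ := hp.1.1.1.of_le (by exact_mod_cast le_top))
      (h₂ := hp.2.1.of_le (by exact_mod_cast le_top))).2 hpS) hinv
  have := isAffineNear_of_hasFDerivAt_jetField (Γ₁ := Γ₁) (Γ₂ := Γ₂) (u := u) (x := x₀)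
    (h₁.mono fun _ h => h.1) (by rw [hu0]; exact h₂.mono fun _ h => h.1) hu
  exact ⟨fun z => (u z).1, by simp [hu0], by rw [this.2, hu0], this.1⟩

/-- The jet of an affine map along a curve solves the jet equation. -/
theorem hasDerivAt_jet_comp {F : E₁ → E₂} {c : ℝ → E₁} {d : E₁} {t : ℝ}
    (hF : IsAffineNear Γ₁ Γ₂ F (c t)) (hc : HasDerivAt c d t) :
    HasDerivAt (fun t => (F (c t), fderiv ℝ F (c t)))
      (jetField Γ₁ Γ₂ (c t, (F (c t), fderiv ℝ F (c t))) d) t :=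
  hF.hasFDerivAt_jet.self_of_nhds.comp_hasDerivAt t hc

/-- Affine maps on an open convex set are determined by their 1-jet at a point. -/
theorem eqOn_of_isAffineNear {W : Set E₁} (hW : IsOpen W) (hWc : Convex ℝ W) {F G : E₁ → E₂}
    (hF : ∀ x ∈ W, IsAffineNear Γ₁ Γ₂ F x) (hG : ∀ x ∈ W, IsAffineNear Γ₁ Γ₂ G x)
    (h₁ : ∀ x ∈ W, ContDiffAt ℝ 1 Γ₁ x) (h₂ : ∀ x ∈ W, ContDiffAt ℝ 1 Γ₂ (F x)) {x₀ : E₁}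
    (hx₀ : x₀ ∈ W) (h0 : F x₀ = G x₀) (h0' : fderiv ℝ F x₀ = fderiv ℝ G x₀) : EqOn F G W := by
  intro x hx
  set c : ℝ → E₁ := fun t => x₀ + t • (x - x₀) with hc
  have hcc : Continuous c := by fun_prop
  have hcd : ∀ t, HasDerivAt c (x - x₀) t := fun t => by
    simpa [hc] using ((hasDerivAt_id t).smul_const (x - x₀)).const_add x₀
  have hconv : Convex ℝ (c ⁻¹' W) := by
    have : c = AffineMap.lineMap x₀ x := by
      ext t; simp [hc, AffineMap.lineMap_apply, add_comm]
    rw [this]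
    exact hWc.affine_preimage _
  -- Restricted to the line through x₀ and x, both jets solve the same ordinary differential
  -- equation with the same initial value.
  have key := ode_unique_of_contDiffAt (s := c ⁻¹' W) (hW.preimage hcc) hconv.isPreconnected
    (G := fun p : E₁ × (E₂ × (E₁ →L[ℝ] E₂)) => jetField Γ₁ Γ₂ p (x - x₀)) (e := c)
    (f := fun t => (F (c t), fderiv ℝ F (c t))) (g := fun t => (G (c t), fderiv ℝ G (c t)))
    hcc.continuousOn
    (fun t ht => (contDiffAt_jetField (p := (c t, (F (c t), fderiv ℝ F (c t))))
      (h₁ _ ht) (h₂ _ ht)).clm_apply contDiffAt_const)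
    (fun t ht => hasDerivAt_jet_comp (hF _ ht) (hcd t))
    (fun t ht => hasDerivAt_jet_comp (hG _ ht) (hcd t)) (t₀ := 0) (by simpa [hc] using hx₀)
    (by simp [hc, h0, h0'])
  have := key (x := 1) (by simpa [hc] using hx)
  simpa [hc] using congrArg Prod.fst this

/-- Compositions of affine maps are affine. -/
theorem IsAffineNear.comp {G : E₂ → E₃} {F : E₁ → E₂} {x : E₁} (hG : IsAffineNear Γ₂ Γ₃ G (F x))
    (hF : IsAffineNear Γ₁ Γ₂ F x) : IsAffineNear Γ₁ Γ₃ (G ∘ F) x := by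
  have hc : ContinuousAt F x := hF.self_of_nhds.1.continuousAt
  have hG' := hc.eventually hG
  have hd : ∀ᶠ z in 𝓝 x, fderiv ℝ (G ∘ F) z = fderiv ℝ G (F z) ∘L fderiv ℝ F z := by
    filter_upwards [hF, hG'] with z h1 h2
    exact fderiv_comp z (h2.1.differentiableAt (by simp)) (h1.1.differentiableAt (by simp))
  filter_upwards [hF, hG', eventually_eventually_nhds.2 hd] with z h1 h2 h3
  refine ⟨h2.1.comp z h1.1, fun v w => ?_⟩
  have e1 := ((h1.1.fderiv_right (m := ∞) (by simp)).differentiableAt (by simp)).hasFDerivAt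
  have e2 := ((h2.1.fderiv_right (m := ∞) (by simp)).differentiableAt (by simp)).hasFDerivAt
  have e0 := (h1.1.differentiableAt (by simp)).hasFDerivAt
  have e3 := (HasFDerivAt.comp z (g := fderiv ℝ G) e2 e0).clm_comp e1
  have e4 : fderiv ℝ (fderiv ℝ (G ∘ F)) z = _ := (EventuallyEq.fderiv_eq h3).trans e3.fderiv
  rw [e4, h3.self_of_nhds]
  have := h2.2 (fderiv ℝ F z v) (fderiv ℝ F z w)
  simp only [Function.comp_apply, ContinuousLinearMap.comp_apply, ← this, ← h1.2 v w, map_add,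
    add_apply, ContinuousLinearMap.compL_apply, ContinuousLinearMap.flip_apply]
  abel

end LocalExistence

/-! ### Geodesics from a point fill a neighbourhood of it. -/

section Geodesics

open Set Metric Filter Topology

variable {E : Type*} [NormedAddCommGroup E] [NormedSpace ℝ E] {Γ : E → E →L[ℝ] E →L[ℝ] E}

/-- The geodesic vector field. -/
noncomputable def geodesicField (Γ : E → E →L[ℝ] E →L[ℝ] E) (p : E × E) : E × E :=
  (p.2, Γ p.1 p.2 p.2)

theorem contDiffAt_geodesicField {n : WithTop ℕ∞} {p : E × E} (h : ContDiffAt ℝ n Γ p.1) :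
    ContDiffAt ℝ n (geodesicField Γ) p := by
  have h1 : ContDiffAt ℝ n (fun p : E × E => Γ p.1) p := h.comp p contDiffAt_fst
  exact contDiffAt_snd.prodMk ((h1.clm_apply contDiffAt_snd).clm_apply contDiffAt_snd)

/-- The flow of the geodesic field near the stationary point (x₀, 0), started at positions x₀ only.
The Lipschitz estimate in the initial velocity takes the place of differentiability of the
exponential map when that map is inverted. -/
theorem exists_geodesic_flow [CompleteSpace E] {x₀ : E} (hΓ : ContDiffAt ℝ 1 Γ x₀) {V : Set E}
    (hV : V ∈ 𝓝 x₀) :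
    ∃ ρ > 0, ∃ τ > 0, ∃ K : NNReal, ∃ β : E → ℝ → E × E,
      (∀ v ∈ ball (0 : E) ρ, β v 0 = (x₀, v) ∧ ∀ t ∈ Ioo (-τ) τ,
        HasDerivAt (β v) (geodesicField Γ (β v t)) t ∧ (β v t).1 ∈ V) ∧
      (∀ v ∈ ball (0 : E) ρ, ∀ w ∈ ball (0 : E) ρ, ∀ t ∈ Ioo (-τ) τ,
        ‖geodesicField Γ (β v t) - geodesicField Γ (β w t)‖ ≤ K * ‖v - w‖) ∧
      ContinuousOn (fun q : E × ℝ => β q.1 q.2) (ball (0 : E) ρ ×ˢ Ioo (-τ) τ) ∧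
      ∀ t ∈ Ioo (-τ) τ, β 0 t = (x₀, 0) := by
  have hX : ContDiffAt ℝ 1 (geodesicField Γ) (x₀, 0) := contDiffAt_geodesicField hΓ
  obtain ⟨ε, hε, a, r, L, K', hr, hP⟩ := IsPicardLindelof.of_contDiffAt_one hX
  obtain ⟨α, hα, L', hL'⟩ :=
    (hP 0).exists_forall_mem_closedBall_eq_hasDerivWithinAt_lipschitzOnWith
  simp only [zero_sub, zero_add] at hα hL'
  have hcont : ContinuousOn (fun q : (E × E) × ℝ => α q.1 q.2)
      (closedBall (x₀, 0) r ×ˢ Icc (-ε) ε) :=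
    continuousOn_prod_of_continuousOn_lipschitzOnWith _ L'
      (fun p hp => fun t ht => ((hα p hp).2 t ht).continuousWithinAt) hL'
  have hr' : (0 : ℝ) < r := hr
  have hcen : ((x₀, 0) : E × E) ∈ closedBall (x₀, 0) (r : ℝ) := mem_closedBall_self hr'.le
  have hc0 : ContinuousAt (fun q : (E × E) × ℝ => α q.1 q.2) ((x₀, 0), 0) :=
    hcont.continuousAt (prod_mem_nhds (closedBall_mem_nhds _ hr') (Icc_mem_nhds (by linarith) hε))
  obtain ⟨K, N, hN, hK⟩ := hX.exists_lipschitzOnWith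
  have hN' : {p : E × E | p ∈ N ∧ p.1 ∈ V} ∈ 𝓝 (α (x₀, 0) 0) := by
    rw [(hα _ hcen).1]
    exact inter_mem hN (continuousAt_fst hV)
  have hpre := hc0.preimage_mem_nhds hN'
  have hemb : Continuous fun q : E × ℝ => (((x₀, q.1), q.2) : (E × E) × ℝ) := by fun_prop
  have hpre' : ∀ᶠ q : E × ℝ in 𝓝 ((0 : E), (0 : ℝ)),
      α (x₀, q.1) q.2 ∈ N ∧ (α (x₀, q.1) q.2).1 ∈ V := (hemb.tendsto (0, 0)).eventually hpre
  rw [Metric.eventually_nhds_iff_ball] at hpre'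
  obtain ⟨δ, hδ, hδ'⟩ := hpre'
  set ρ := min δ r with hρdef
  set τ := min δ ε with hτdef
  have hρ : 0 < ρ := lt_min hδ hr'
  have hτ : 0 < τ := lt_min hδ hε
  have hvmem : ∀ v ∈ ball (0 : E) ρ, (x₀, v) ∈ closedBall ((x₀, 0) : E × E) (r : ℝ) := by
    intro v hv
    rw [← closedBall_prod_same]
    exact ⟨mem_closedBall_self hr'.le,
      ball_subset_closedBall (ball_subset_ball (min_le_right _ _) hv)⟩
  have htmem : ∀ t ∈ Ioo (-τ) τ, t ∈ Ioo (-ε) ε := fun t ht =>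
    ⟨by linarith [ht.1, min_le_right δ ε], by linarith [ht.2, min_le_right δ ε]⟩
  have hin : ∀ v ∈ ball (0 : E) ρ, ∀ t ∈ Ioo (-τ) τ,
      α (x₀, v) t ∈ N ∧ (α (x₀, v) t).1 ∈ V := by
    intro v hv t ht
    refine hδ' (v, t) ?_
    rw [← ball_prod_same]
    refine ⟨ball_subset_ball (min_le_left _ _) hv, ?_⟩
    rw [Real.ball_eq_Ioo]
    exact ⟨by linarith [ht.1, min_le_left δ ε], by linarith [ht.2, min_le_left δ ε]⟩
  have hder : ∀ v ∈ ball (0 : E) ρ, ∀ t ∈ Ioo (-τ) τ,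
      HasDerivAt (α (x₀, v)) (geodesicField Γ (α (x₀, v) t)) t := fun v hv t ht =>
    ((hα _ (hvmem v hv)).2 t (Ioo_subset_Icc_self (htmem t ht))).hasDerivAt
      (Icc_mem_nhds (htmem t ht).1 (htmem t ht).2)
  refine ⟨ρ, hρ, τ, hτ, K * L', fun v => α (x₀, v), fun v hv => ⟨(hα _ (hvmem v hv)).1,
    fun t ht => ⟨hder v hv t ht, (hin v hv t ht).2⟩⟩, ?_, ?_, ?_⟩
  · intro v hv w hw t ht
    have h1 := hK.dist_le_mul _ (hin v hv t ht).1 _ (hin w hw t ht).1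
    have h2 := (hL' t (Ioo_subset_Icc_self (htmem t ht))).dist_le_mul _ (hvmem v hv) _ (hvmem w hw)
    have h3 : dist (x₀, v) (x₀, w) = ‖v - w‖ := by simp [dist_eq_norm]
    rw [h3] at h2
    rw [← dist_eq_norm]
    push_cast
    calc _ ≤ K * dist (α (x₀, v) t) (α (x₀, w) t) := h1
      _ ≤ K * (L' * ‖v - w‖) := by gcongr
      _ = _ := by ring
  · refine hcont.comp hemb.continuousOn fun q hq => ⟨hvmem _ hq.1, ?_⟩
    exact Ioo_subset_Icc_self (htmem _ hq.2)
  · intro t ht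
    have h0 : (0 : E) ∈ ball (0 : E) ρ := mem_ball_self hρ
    refine (ode_unique_of_contDiffAt (G := fun q : ℝ × (E × E) => geodesicField Γ q.2)
      (e := fun _ => (0 : ℝ)) (f := fun _ => ((x₀, 0) : E × E)) (g := α (x₀, 0)) isOpen_Ioo
      isPreconnected_Ioo continuousOn_const
      (fun t _ => ContDiffAt.comp _ (g := geodesicField Γ) hX contDiffAt_snd) (fun t _ => ?_)
      (fun t ht => hder 0 h0 t ht) (t₀ := 0) ⟨by linarith, hτ⟩ (hα _ hcen).1.symm ht).symm
    exact (hasDerivAt_const t ((x₀, 0) : E × E)).congr_deriv (by simp [geodesicField]; rfl)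

/-- Every point has a neighbourhood whose points are connected to it by geodesics that depend
continuously on the end point. -/
theorem exists_geodesic_star_neighborhood [CompleteSpace E] {x₀ : E} (hΓ : ContDiffAt ℝ 1 Γ x₀)
    {V : Set E} (hV : V ∈ 𝓝 x₀) :
    ∃ U : Set E, IsOpen U ∧ x₀ ∈ U ∧ IsPreconnected U ∧ ∃ c d : E → ℝ → E,
      ContinuousOn (fun q : E × ℝ => c q.1 q.2) (U ×ˢ Icc 0 1) ∧
      ∀ x ∈ U, c x 0 = x₀ ∧ c x 1 = x ∧ ∀ t ∈ Ioo (-2 : ℝ) 2, HasDerivAt (c x) (d x t) t ∧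
        HasDerivAt (d x) (Γ (c x t) (d x t) (d x t)) t ∧ c x t ∈ V := by
  obtain ⟨ρ, hρ, τ, hτ, K, β, hβ, hK, hβc, hβ0⟩ := exists_geodesic_flow hΓ hV
  -- Time is rescaled by `lam`: 2 lam ≤ τ makes the rescaled geodesics live on (-2, 2), and K lam <
  -- 1 makes the exponential map a perturbation of the identity.
  obtain ⟨lam, hl0, hlτ, hlK⟩ : ∃ lam : ℝ, 0 < lam ∧ 2 * lam ≤ τ ∧ K * lam < 1 := by
    refine ⟨min (τ / 2) (1 / (2 * (K + 1))), by positivity, ?_, ?_⟩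
    · have := min_le_left (τ / 2) (1 / (2 * ((K : ℝ) + 1)))
      linarith
    · have hK0 : (0 : ℝ) ≤ K := K.2
      calc (K : ℝ) * min (τ / 2) (1 / (2 * (K + 1))) ≤ K * (1 / (2 * (K + 1))) := by
            gcongr; exact min_le_right _ _
        _ = K / (2 * (K + 1)) := by ring
        _ < 1 := by rw [div_lt_one (by positivity)]; linarith
  have hmemτ : ∀ t ∈ Ioo (-2 : ℝ) 2, lam * t ∈ Ioo (-τ) τ := fun t ht =>
    ⟨by nlinarith [ht.1], by nlinarith [ht.2]⟩
  have hIcc : ∀ t ∈ Icc (0 : ℝ) lam, t ∈ Ioo (-τ) τ := fun t ht =>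
    ⟨by linarith [ht.1], by linarith [ht.2]⟩
  -- The Lipschitz bound on the field is integrated twice, once for velocities and once for
  -- positions.
  have hest : ∀ v ∈ ball (0 : E) ρ, ∀ w ∈ ball (0 : E) ρ,
      ‖(β v lam).1 - (β w lam).1 - lam • (v - w)‖ ≤ K * ‖v - w‖ * lam * lam := by
    intro v hv w hw
    have hd : ∀ t ∈ Icc (0 : ℝ) lam, HasDerivAt (fun t => (β v t).2 - (β w t).2)
        ((geodesicField Γ (β v t)).2 - (geodesicField Γ (β w t)).2) t := fun t ht =>
      HasDerivAt.sub ((hβ v hv).2 t (hIcc t ht)).1.snd ((hβ w hw).2 t (hIcc t ht)).1.snd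
    have h2 : ∀ t ∈ Icc (0 : ℝ) lam, ‖(β v t).2 - (β w t).2 - (v - w)‖ ≤ K * ‖v - w‖ * lam := by
      intro t ht
      have := norm_image_sub_le_of_norm_deriv_le_segment' (C := K * ‖v - w‖)
        (fun t ht => (hd t ht).hasDerivWithinAt)
        (fun t ht => (norm_snd_le _).trans (hK v hv w hw t (hIcc t (Ico_subset_Icc_self ht)))) t ht
      rw [(hβ v hv).1, (hβ w hw).1, sub_zero] at this
      exact this.trans (by gcongr; exact ht.2)
    have hd1 : ∀ t ∈ Icc (0 : ℝ) lam, HasDerivAt (fun t => (β v t).1 - (β w t).1 - t • (v - w))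
        ((β v t).2 - (β w t).2 - (v - w)) t := by
      intro t ht
      have h1 : HasDerivAt (fun t => (β v t).1) ((β v t).2) t :=
        ((hβ v hv).2 t (hIcc t ht)).1.fst
      have h1' : HasDerivAt (fun t => (β w t).1) ((β w t).2) t :=
        ((hβ w hw).2 t (hIcc t ht)).1.fst
      exact ((h1.sub h1').sub ((hasDerivAt_id t).smul_const (v - w))).congr_deriv (by simp)
    have := norm_image_sub_le_of_norm_deriv_le_segment' (C := K * ‖v - w‖ * lam)
      (fun t ht => (hd1 t ht).hasDerivWithinAt) (fun t ht => h2 t (Ico_subset_Icc_self ht)) lam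
      (right_mem_Icc.2 hl0.le)
    simpa [(hβ v hv).1, (hβ w hw).1] using this
  have hscale : ∀ v ∈ ball (0 : E) (lam * ρ), lam⁻¹ • v ∈ ball (0 : E) ρ := by
    intro v hv
    rw [mem_ball_zero_iff] at hv ⊢
    rw [norm_smul, norm_inv, Real.norm_of_nonneg hl0.le, inv_mul_lt_iff₀ hl0]
    exact hv
  -- This is the exponential map at x₀: velocity v / lam for time lam amounts to velocity v for time
  -- 1. It differs from the identity by a map with Lipschitz constant K lam < 1, hence is a
  -- homeomorphism onto an open set.
  set e : E → E := fun v => (β (lam⁻¹ • v) lam).1 with he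
  obtain ⟨κ, hκ⟩ : ∃ κ : NNReal, (κ : ℝ) = K * lam := ⟨K * ⟨lam, hl0.le⟩, rfl⟩
  have happ : ApproximatesLinearOn e
      ((ContinuousLinearEquiv.refl ℝ E : E ≃L[ℝ] E) : E →L[ℝ] E) (ball 0 (lam * ρ)) κ := by
    intro v hv w hw
    have := hest _ (hscale v hv) _ (hscale w hw)
    rw [← smul_sub, smul_inv_smul₀ hl0.ne', norm_smul, norm_inv, Real.norm_of_nonneg hl0.le] at this
    refine this.trans (le_of_eq ?_)
    rw [hκ]
    field_simp
  have hκ1 : κ < 1 := by rw [← NNReal.coe_lt_coe, hκ]; exact_mod_cast hlK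
  have hN : Subsingleton E ∨
      κ < ‖((ContinuousLinearEquiv.refl ℝ E).symm : E →L[ℝ] E)‖₊⁻¹ := by
    rcases subsingleton_or_nontrivial E with h | h
    · exact Or.inl h
    · refine Or.inr (hκ1.trans_le ?_)
      have : ‖((ContinuousLinearEquiv.refl ℝ E).symm : E →L[ℝ] E)‖₊ = 1 := by
        simp
      rw [this, inv_one]
  set Φ := happ.toOpenPartialHomeomorph e (ball 0 (lam * ρ)) hN isOpen_ball with hΦ
  have hΦe : ∀ v, Φ v = e v := fun _ => rfl
  have hsrc : Φ.source = ball 0 (lam * ρ) := rfl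
  have hsymm : ∀ x ∈ Φ.target, Φ.symm x ∈ ball (0 : E) (lam * ρ) := fun x hx =>
    hsrc ▸ Φ.map_target hx
  refine ⟨Φ.target, Φ.open_target, ?_, ?_, fun x t => (β (lam⁻¹ • Φ.symm x) (lam * t)).1,
    fun x t => lam • (β (lam⁻¹ • Φ.symm x) (lam * t)).2, ?_, fun x hx => ⟨?_, ?_, fun t ht => ?_⟩⟩
  · refine ⟨0, mem_ball_self (by positivity), ?_⟩
    simp only [he, smul_zero]
    rw [hβ0 lam ⟨by linarith, by linarith⟩]
  · have : Φ.target = e '' ball 0 (lam * ρ) := rfl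
    rw [this]
    exact (convex_ball _ _).isPreconnected.image _ happ.continuousOn
  · refine ContinuousOn.fst (hβc.comp (f := fun q : E × ℝ => (lam⁻¹ • Φ.symm q.1, lam * q.2)) ?_ ?_)
    · refine ContinuousOn.prodMk (ContinuousOn.const_smul (Φ.continuousOn_symm.comp
        continuousOn_fst fun q hq => hq.1) _) (by fun_prop)
    · exact fun q hq => ⟨hscale _ (hsymm _ hq.1), hmemτ _ ⟨by linarith [hq.2.1], by linarith [hq.2.2]⟩⟩
  · simp [(hβ _ (hscale _ (hsymm x hx))).1]
  · have := Φ.right_inv hx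
    rw [hΦe] at this
    simpa using this
  · obtain ⟨h1, h2⟩ := (hβ _ (hscale _ (hsymm x hx))).2 _ (hmemτ t ht)
    have hm : HasDerivAt (fun t : ℝ => lam * t) lam t := by
      simpa using (hasDerivAt_id t).const_mul lam
    have h3 := h1.scomp t hm
    have h4 : HasDerivAt (fun t => (β (lam⁻¹ • Φ.symm x) (lam * t)).1)
      (lam • (geodesicField Γ (β (lam⁻¹ • Φ.symm x) (lam * t)))).1 t := h3.fst
    have h5 : HasDerivAt (fun t => (β (lam⁻¹ • Φ.symm x) (lam * t)).2)
      (lam • (geodesicField Γ (β (lam⁻¹ • Φ.symm x) (lam * t)))).2 t := h3.snd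
    refine ⟨h4, (h5.const_smul lam).congr_deriv ?_, h2⟩
    simp [geodesicField]

end Geodesics

/-! ### Germs of maps, coverings and monodromy. -/

section EtaleSpace

open Set Filter Topology unitInterval

variable {X Y : Type*} [TopologicalSpace X] {P : X → (X → Y) → Prop}

/-- A local condition on maps near a point that satisfies the identity principle. -/
structure IsRigidLocalCondition (P : X → (X → Y) → Prop) : Prop where
  eventually : ∀ {x f}, P x f → ∀ᶠ x' in 𝓝 x, P x' f
  congr : ∀ {x f g}, f =ᶠ[𝓝 x] g → P x f → P x g
  separated : ∀ {x f g}, P x f → P x g → (∃ᶠ x' in 𝓝 x, f =ᶠ[𝓝 x'] g) → f =ᶠ[𝓝 x] g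

/-- Equality of germs. -/
def etaleSetoid (P : X → (X → Y) → Prop) : Setoid {q : X × (X → Y) // P q.1 q.2} where
  r a b := a.1.1 = b.1.1 ∧ a.1.2 =ᶠ[𝓝 a.1.1] b.1.2
  iseqv := ⟨fun _ => ⟨rfl, EventuallyEq.rfl⟩, fun h => ⟨h.1.symm, h.1 ▸ h.2.symm⟩,
    fun h h' => ⟨h.1.trans h'.1, h.2.trans (h.1 ▸ h'.2)⟩⟩

/-- The space of germs of maps that satisfy a local condition. -/
def EtaleSpace (P : X → (X → Y) → Prop) : Type _ := Quotient (etaleSetoid P)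

namespace EtaleSpace

/-- The germ of `f` at `x`. -/
def mk (x : X) (f : X → Y) (h : P x f) : EtaleSpace P := Quotient.mk (etaleSetoid P) ⟨(x, f), h⟩

theorem mk_eq_mk {x x' : X} {f f' : X → Y} {h : P x f} {h' : P x' f'} :
    mk x f h = mk x' f' h' ↔ x = x' ∧ f =ᶠ[𝓝 x] f' :=
  Quotient.eq (r := etaleSetoid P)

theorem exists_mk (e : EtaleSpace P) : ∃ x f h, e = mk x f h := by
  obtain ⟨⟨⟨x, f⟩, h⟩, rfl⟩ := Quotient.exists_rep e
  exact ⟨x, f, h, rfl⟩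

/-- The base point of a germ. -/
def proj (e : EtaleSpace P) : X :=
  Quotient.lift (s := etaleSetoid P) (fun q => q.1.1) (fun _ _ h => h.1) e

/-- The value of a germ. -/
def eval (e : EtaleSpace P) : Y :=
  Quotient.lift (s := etaleSetoid P) (fun q => q.1.2 q.1.1)
    (fun _ _ h => h.1 ▸ h.2.self_of_nhds) e

@[simp] theorem proj_mk {x : X} {f : X → Y} {h : P x f} : proj (mk x f h) = x := rfl

@[simp] theorem eval_mk {x : X} {f : X → Y} {h : P x f} : eval (mk x f h) = f x := rfl

/-- The sheet topology, phrased through representatives so that it makes sense for any `P`. The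
quantifier over `h'` passes over nearby points at which `P` fails for f. -/
instance : TopologicalSpace (EtaleSpace P) where
  IsOpen W := ∀ x f h, mk x f h ∈ W → ∀ᶠ x' in 𝓝 x, ∀ h', mk x' f h' ∈ W
  isOpen_univ := fun _ _ _ _ => Eventually.of_forall fun _ _ => trivial
  isOpen_inter := fun W W' hW hW' x f h hx => by
    filter_upwards [hW x f h hx.1, hW' x f h hx.2] with x' h1 h2 h' using ⟨h1 h', h2 h'⟩
  isOpen_sUnion := fun S hS x f h ⟨W, hW, hx⟩ => by
    filter_upwards [hS W hW x f h hx] with x' h1 h' using ⟨W, hW, h1 h'⟩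

/-- The germs of `f` at the points of `U`. -/
def sheet (P : X → (X → Y) → Prop) (f : X → Y) (U : Set X) : Set (EtaleSpace P) :=
  {e | ∃ x h, x ∈ U ∧ e = mk x f h}

theorem mk_mem_sheet {f : X → Y} {U : Set X} {x : X} (h : P x f) (hx : x ∈ U) :
    mk x f h ∈ sheet P f U := ⟨x, h, hx, rfl⟩

theorem isOpen_sheet (hP : IsRigidLocalCondition P) (f : X → Y) {U : Set X} (hU : IsOpen U) :
    IsOpen (sheet P f U) := by
  rintro x g h ⟨x', h', hx', he⟩
  obtain ⟨rfl, hfg⟩ := mk_eq_mk.1 he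
  filter_upwards [hU.mem_nhds hx', eventually_eventually_nhds.2 hfg] with y hy hfg' h''
  exact ⟨y, hP.congr hfg' h'', hy, mk_eq_mk.2 ⟨rfl, hfg'⟩⟩

theorem continuous_proj : Continuous (proj : EtaleSpace P → X) := by
  refine continuous_def.2 fun O hO x f h hx => ?_
  filter_upwards [hO.mem_nhds hx] with x' hx' h' using hx'

/-- This turns continuation along a path into continuity of a lift: a family of germs that locally
come from a single map stays in one sheet. -/
theorem continuousAt_mk (hP : IsRigidLocalCondition P) {A : Type*} [TopologicalSpace A] {γ : A → X}
    {G : A → X → Y} (h : ∀ a, P (γ a) (G a)) {a : A} (hγ : ContinuousAt γ a)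
    (hG : ∀ᶠ b in 𝓝 a, G b =ᶠ[𝓝 (γ b)] G a) :
    ContinuousAt (fun a => mk (γ a) (G a) (h a)) a := by
  refine tendsto_nhds.2 fun W hW ha => ?_
  filter_upwards [hγ.eventually (hW _ _ _ ha), hG] with b h1 h2
  have h3 := h1 (hP.congr h2 (h b))
  rwa [← mk_eq_mk.2 ⟨rfl, h2⟩] at h3

/-- A sheet of one map f over an open set on which `P` holds is mapped bijectively to that set, with
inverse x' ↦ germ of f at x'. -/
theorem isLocalHomeomorph_proj (hP : IsRigidLocalCondition P) :
    IsLocalHomeomorph (proj : EtaleSpace P → X) := by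
  classical
  refine IsLocalHomeomorph.mk _ fun e => ?_
  obtain ⟨x, f, h, rfl⟩ := exists_mk e
  obtain ⟨U, hU, hUo, hxU⟩ := eventually_nhds_iff.1 (hP.eventually h)
  let inv : X → EtaleSpace P := fun x' => if hx' : P x' f then mk x' f hx' else mk x f h
  have hinv : ∀ x' (hx' : P x' f), inv x' = mk x' f hx' := fun x' hx' => dif_pos hx'
  refine ⟨{ toFun := proj, invFun := inv, source := sheet P f U, target := U,
            map_source' := ?_, map_target' := ?_, left_inv' := ?_, right_inv' := ?_,
            open_source := isOpen_sheet hP f hUo, open_target := hUo,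
            continuousOn_toFun := continuous_proj.continuousOn,
            continuousOn_invFun := ?_ }, mk_mem_sheet h hxU, fun _ _ => rfl⟩
  · rintro _ ⟨x', h', hx', rfl⟩
    exact hx'
  · intro x' hx'
    rw [hinv x' (hU x' hx')]
    exact mk_mem_sheet _ hx'
  · rintro _ ⟨x', h', hx', rfl⟩
    exact hinv x' h'
  · intro x' hx'
    rw [hinv x' (hU x' hx')]
    rfl
  · rw [continuousOn_iff_continuous_domRestrict]
    have : U.domRestrict inv = fun a : U => mk (a : X) f (hU a a.2) :=
      funext fun a => hinv a (hU a a.2)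
    rw [this]
    exact continuous_iff_continuousAt.2 fun a => continuousAt_mk hP (γ := fun a : U => (a : X))
      (G := fun _ => f) (fun a => hU a a.2) continuous_subtype_val.continuousAt
      (Eventually.of_forall fun _ => EventuallyEq.rfl)

/-- By the identity principle, two different germs at x have representatives whose germs differ at
all nearby points, so their sheets over a small neighbourhood are disjoint. -/
theorem isSeparatedMap_proj (hP : IsRigidLocalCondition P) :
    IsSeparatedMap (proj : EtaleSpace P → X) := by
  intro e₁ e₂ he hne
  obtain ⟨x, f, hf, rfl⟩ := exists_mk e₁
  obtain ⟨x', g, hg, rfl⟩ := exists_mk e₂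
  obtain rfl : x = x' := he
  have hnf : ¬ ∃ᶠ x' in 𝓝 x, f =ᶠ[𝓝 x'] g := fun hfr =>
    hne (mk_eq_mk.2 ⟨rfl, hP.separated hf hg hfr⟩)
  obtain ⟨U, hU, hUo, hxU⟩ := eventually_nhds_iff.1 (not_frequently.1 hnf)
  refine ⟨sheet P f U, sheet P g U, isOpen_sheet hP f hUo, isOpen_sheet hP g hUo,
    mk_mem_sheet hf hxU, mk_mem_sheet hg hxU, ?_⟩
  rw [Set.disjoint_left]
  rintro _ ⟨y, h1, hy, rfl⟩ ⟨z, h2, hz, he⟩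
  exact hU y hy (mk_eq_mk.1 he).2

/-- Maps satisfying the condition on a preconnected set that agree near one point agree near all
points. -/
theorem _root_.IsRigidLocalCondition.eventuallyEq_of_isPreconnected (hP : IsRigidLocalCondition P)
    {U : Set X} (hU : IsPreconnected U) {f g : X → Y} (hf : ∀ x ∈ U, P x f) (hg : ∀ x ∈ U, P x g)
    {x₀ : X} (hx₀ : x₀ ∈ U) (h₀ : f =ᶠ[𝓝 x₀] g) : ∀ x ∈ U, f =ᶠ[𝓝 x] g := by
  refine hU.subset_of_closure_inter_subset (isOpen_iff_mem_nhds.2 fun t ht =>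
    eventually_eventually_nhds.2 ht) ⟨x₀, hx₀, h₀⟩ ?_
  rintro x ⟨hxc, hxU⟩
  exact hP.separated (hf x hxU) (hg x hxU) (mem_closure_iff_frequently.1 hxc)

/-- A continuous section of the space of germs over an open set comes from a map. -/
theorem exists_of_section (hP : IsRigidLocalCondition P) {U : Set X} (hU : IsOpen U)
    (hne : U.Nonempty) {s : U → EtaleSpace P} (hs : Continuous s) (hp : ∀ x, proj (s x) = x) :
    ∃ f : X → Y, ∀ x : U, ∃ h : P x f, s x = mk (x : X) f h := by
  classical
  obtain ⟨x₁, hx₁⟩ := hne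
  -- `Y` might be empty, so the value outside `U` is borrowed from the section; this is why `U` must
  -- be nonempty.
  let f : X → Y := fun x => if hx : x ∈ U then eval (s ⟨x, hx⟩) else eval (s ⟨x₁, hx₁⟩)
  have hf : ∀ (x : X) (hx : x ∈ U), f x = eval (s ⟨x, hx⟩) := fun x hx => dif_pos hx
  refine ⟨f, fun x => ?_⟩
  obtain ⟨y, g, hg, hsx⟩ := exists_mk (s x)
  obtain rfl : y = x := by rw [← hp x, hsx, proj_mk]
  have hev : f =ᶠ[𝓝 (x : X)] g := by
    have h1 : ∀ᶠ a in 𝓝 x, s a ∈ sheet P g univ :=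
      hs.continuousAt.eventually ((isOpen_sheet hP g isOpen_univ).mem_nhds
        (hsx ▸ mk_mem_sheet hg trivial))
    have h2 : ∀ᶠ a in 𝓝 (x : X), ∀ ha : a ∈ U, s ⟨a, ha⟩ ∈ sheet P g univ := by
      rw [nhds_subtype_eq_comap, eventually_comap] at h1
      filter_upwards [h1] with a ha hau using ha ⟨a, hau⟩ rfl
    filter_upwards [h2, hU.mem_nhds x.2] with a ha haU
    obtain ⟨z, hz, -, he⟩ := ha haU
    have : z = a := by
      have := hp ⟨a, haU⟩
      rwa [he] at this
    subst this
    rw [hf z haU, he, eval_mk]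
  exact ⟨hP.congr hev.symm hg, hsx.trans (mk_eq_mk.2 ⟨rfl, hev.symm⟩)⟩

/-- If germs extend over suitable neighbourhoods, the space of germs is a covering. -/
theorem isCoveringMap_proj (hP : IsRigidLocalCondition P)
    (hext : ∀ p : X, ∃ U : Set X, IsOpen U ∧ p ∈ U ∧ IsPreconnected U ∧
      ∀ x ∈ U, ∀ f, P x f → ∃ f', (∀ x' ∈ U, P x' f') ∧ f' =ᶠ[𝓝 x] f) :
    IsCoveringMap (proj : EtaleSpace P → X) := by
  intro p
  obtain ⟨U, hU, hpU, hUc, hUe⟩ := hext p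
  let ι := {i : EtaleSpace P // proj i = p}
  let : TopologicalSpace ι := ⊥
  have : DiscreteTopology ι := ⟨rfl⟩
  -- One sheet over `U` for each germ at p, made of the germs of its extensions. By rigidity all
  -- extensions of a germ give the same sheet.
  let S : ι → Set (EtaleSpace P) := fun i =>
    {e | ∃ f, (∀ x ∈ U, P x f) ∧ (∃ h : P p f, i.1 = mk p f h) ∧ e ∈ sheet P f U}
  have hcov : proj ⁻¹' U ⊆ ⋃ i, S i := by
    intro e he
    obtain ⟨x, f, h, rfl⟩ := exists_mk e
    obtain ⟨f', hf', hff'⟩ := hUe x he f h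
    refine mem_iUnion.2 ⟨⟨mk p f' (hf' p hpU), rfl⟩, f', hf', ⟨_, rfl⟩, x, hf' x he, he, ?_⟩
    exact mk_eq_mk.2 ⟨rfl, hff'.symm⟩
  have hagree : ∀ (i : ι) f g, (∀ x ∈ U, P x f) → (∀ x ∈ U, P x g) →
      (∃ h : P p f, i.1 = mk p f h) → (∃ h : P p g, i.1 = mk p g h) → ∀ x ∈ U, f =ᶠ[𝓝 x] g := by
    rintro i f g hf hg ⟨h, hi⟩ ⟨h', hi'⟩
    exact hP.eventuallyEq_of_isPreconnected hUc hf hg hpU (mk_eq_mk.1 (hi.symm.trans hi')).2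
  have hsec : ∀ i : ι, ∃ f, (∀ x ∈ U, P x f) ∧ ∃ h : P p f, i.1 = mk p f h := by
    rintro ⟨i, hi⟩
    obtain ⟨x, f, h, rfl⟩ := exists_mk i
    obtain rfl : x = p := hi
    obtain ⟨f', hf', hff'⟩ := hUe x hpU f h
    exact ⟨f', hf', hf' x hpU, mk_eq_mk.2 ⟨rfl, hff'.symm⟩⟩
  -- An empty fibre means that nothing lies over `U`. It is split off because the trivialization
  -- needs some function `X → EtaleSpace P`.
  rcases isEmpty_or_nonempty ι with hE | hne
  · have : proj ⁻¹' U = (∅ : Set (EtaleSpace P)) := by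
      refine Set.eq_empty_of_subset_empty (hcov.trans ?_)
      rw [Set.iUnion_of_empty]
    exact (IsEvenlyCovered.of_preimage_eq_empty ι (hU.mem_nhds hpU) this).to_isEvenlyCovered_preimage
  · have : Nonempty (X → EtaleSpace P) := ⟨fun _ => hne.some.1⟩
    have hinj : ∀ i, (S i).InjOn proj := by
      rintro i _ ⟨f, hf, hi, x, h, hx, rfl⟩ _ ⟨g, hg, hi', y, h', hy, rfl⟩ hxy
      obtain rfl : x = y := hxy
      exact mk_eq_mk.2 ⟨rfl, hagree i f g hf hg hi hi' x hx⟩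
    have hsurj : ∀ i, (S i).SurjOn proj U := by
      intro i x hx
      obtain ⟨f, hf, hi⟩ := hsec i
      exact ⟨mk x f (hf x hx), ⟨f, hf, hi, mk_mem_sheet _ hx⟩, rfl⟩
    have hdisj : Pairwise (Function.onFun Disjoint S) := by
      intro i j hij
      refine Set.disjoint_left.2 ?_
      rintro _ ⟨f, hf, ⟨h1, hi⟩, x, h, hx, rfl⟩ ⟨g, hg, ⟨h2, hj⟩, y, h', hy, he⟩
      refine hij (Subtype.ext ?_)
      rw [hi, hj]
      exact mk_eq_mk.2 ⟨rfl, hP.eventuallyEq_of_isPreconnected hUc hf hg hx (mk_eq_mk.1 he).2 p hpU⟩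
    have hopen : ∀ i {W : Set X}, W ⊆ U → (IsOpen W ↔ IsOpen (proj ⁻¹' W ∩ S i)) := by
      intro i W hWU
      obtain ⟨f, hf, hi⟩ := hsec i
      have hSi : S i = sheet P f U := by
        refine Set.Subset.antisymm ?_ fun e he => ⟨f, hf, hi, he⟩
        rintro _ ⟨g, hg, hi', x, h, hx, rfl⟩
        exact ⟨x, hf x hx, hx, mk_eq_mk.2 ⟨rfl, hagree i g f hg hf hi' hi x hx⟩⟩
      constructor
      · intro hW
        rw [hSi]
        exact (hW.preimage continuous_proj).inter (isOpen_sheet hP f hU)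
      · intro hW
        refine isOpen_iff_mem_nhds.2 fun x hx => ?_
        have hfx := hf x (hWU hx)
        have := hW x f hfx ⟨hx, f, hf, hi, mk_mem_sheet _ (hWU hx)⟩
        filter_upwards [this, hP.eventually hfx] with y hy hfy using (hy hfy).1
    exact (IsEvenlyCovered.of_trivialization (t := IsOpen.trivializationDiscrete S U hU
      hopen hinj hsurj hdisj hcov) hpU).to_isEvenlyCovered_preimage

end EtaleSpace

/-- The germ of a map can be continued along the path `γ`. -/
def ContinuableAlong (P : X → (X → Y) → Prop) (γ : ℝ → X) : Prop :=
  ∀ f, P (γ 0) f → ∃ G : ℝ → X → Y, G 0 =ᶠ[𝓝 (γ 0)] f ∧ ∀ t ∈ Icc (0 : ℝ) 1, P (γ t) (G t) ∧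
    ∀ᶠ s in 𝓝[Icc 0 1] t, G s =ᶠ[𝓝 (γ s)] G t

open EtaleSpace in
/-- If germs can be continued along paths joining a point to the points of a neighbourhood and
back, then they extend to this neighbourhood. -/
theorem IsRigidLocalCondition.exists_extension (hP : IsRigidLocalCondition P) {p : X} {U : Set X}
    (hU : IsOpen U) {c : X → ℝ → X}
    (hc : ContinuousOn (fun q : X × ℝ => c q.1 q.2) (U ×ˢ Icc 0 1))
    (hcU : ∀ x ∈ U, c x 0 = p ∧ c x 1 = x ∧ ContinuableAlong P (c x) ∧
      ContinuableAlong P (fun t => c x (1 - t))) :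
    ∀ x ∈ U, ∀ f, P x f → ∃ f', (∀ x' ∈ U, P x' f') ∧ f' =ᶠ[𝓝 x] f := by
  intro x hx f hf
  obtain ⟨-, hc1, -, hback⟩ := hcU x hx
  -- The germ is first carried back to the centre p, where it becomes `H 1`; from there it is
  -- carried out to every y in `U`.
  obtain ⟨H, hH0, hH⟩ := hback f (by simpa [hc1] using hf)
  have hj : P p (H 1) := by
    have := (hH 1 (by simp)).1
    simpa [(hcU x hx).1] using this
  have hlift : ∀ y : U, ∃ G : ℝ → X → Y, G 0 =ᶠ[𝓝 p] H 1 ∧ ∀ t ∈ Icc (0 : ℝ) 1, P (c y t) (G t) ∧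
      ∀ᶠ s in 𝓝[Icc 0 1] t, G s =ᶠ[𝓝 (c y s)] G t := by
    intro y
    have := (hcU y y.2).2.2.1 (H 1) (by rw [(hcU y y.2).1]; exact hj)
    rwa [(hcU y y.2).1] at this
  choose G hG0 hG using hlift
  have hI : ∀ {γ : ℝ → X} {F : ℝ → X → Y} (hγ : ContinuousOn γ (Icc 0 1))
      (hF : ∀ t ∈ Icc (0 : ℝ) 1, P (γ t) (F t) ∧ ∀ᶠ s in 𝓝[Icc 0 1] t, F s =ᶠ[𝓝 (γ s)] F t),
      Continuous fun t : I => EtaleSpace.mk (γ t) (F t) (hF t t.2).1 := by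
    intro γ F hγ hF
    refine continuous_iff_continuousAt.2 fun t => continuousAt_mk hP (γ := fun t : I => γ t)
      (G := fun t : I => F t) _ (continuousOn_iff_continuous_domRestrict.1 hγ).continuousAt ?_
    have := (hF t t.2).2
    rw [← map_nhds_subtype_val (s := Icc (0 : ℝ) 1) t, eventually_map] at this
    exact this
  have hcy : ∀ y ∈ U, ContinuousOn (c y) (Icc 0 1) := fun y hy =>
    hc.comp (f := fun t : ℝ => (y, t)) (by fun_prop) fun t ht => ⟨hy, ht⟩
  let g : I × U → EtaleSpace P := fun q => EtaleSpace.mk (c q.2 q.1) (G q.2 q.1) (hG q.2 q.1 q.1.2).1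
  let F : C(I × U, X) := ⟨fun q => c q.2 q.1,
    hc.comp_continuous (f := fun q : I × U => ((q.2 : X), (q.1 : ℝ))) (by fun_prop)
      fun q => ⟨q.2.2, q.1.2⟩⟩
  -- The continuations along different paths are chosen independently of each other. Joint
  -- continuity comes from lifting through a separated local homeomorphism: `g` is continuous on
  -- each path and constant at t = 0.
  have hg : Continuous g := by
    refine (isLocalHomeomorph_proj hP).continuous_lift (isSeparatedMap_proj hP) F rfl ?_ ?_
    · have : (fun y : U => g (0, y)) = fun _ => EtaleSpace.mk p (H 1) hj := by
        funext y
        refine mk_eq_mk.2 ⟨(hcU y y.2).1, ?_⟩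
        have := hG0 y
        simpa [(hcU y y.2).1] using this
      rw [this]
      exact continuous_const
    · exact fun y => hI (hcy y y.2) (hG y)
  have hs : Continuous fun y : U => g (1, y) := hg.comp (by fun_prop)
  obtain ⟨f', hf'⟩ := exists_of_section hP hU ⟨x, hx⟩ hs fun y => (hcU y y.2).2.1
  refine ⟨f', fun y hy => (hf' ⟨y, hy⟩).1, ?_⟩
  have hrev : ∀ t ∈ Icc (0 : ℝ) 1, (1 - t) ∈ Icc (0 : ℝ) 1 := fun t ht =>
    ⟨by linarith [ht.2], by linarith [ht.1]⟩
  have hH' : ∀ t ∈ Icc (0 : ℝ) 1, P (c x t) (H (1 - t)) ∧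
      ∀ᶠ s in 𝓝[Icc 0 1] t, H (1 - s) =ᶠ[𝓝 (c x s)] H (1 - t) := by
    intro t ht
    obtain ⟨h1, h2⟩ := hH (1 - t) (hrev t ht)
    refine ⟨by simpa using h1, ?_⟩
    have ht' : Tendsto (fun s : ℝ => 1 - s) (𝓝[Icc 0 1] t) (𝓝[Icc 0 1] (1 - t)) :=
      tendsto_nhdsWithin_of_tendsto_nhds_of_eventually_within _
        ((by fun_prop : Continuous fun s : ℝ => 1 - s).continuousAt.tendsto.mono_left
          nhdsWithin_le_nhds) (eventually_mem_nhdsWithin.mono hrev)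
    have := ht'.eventually h2
    simpa using this
  -- Going back to p and out again along the same path returns the original germ, by uniqueness of
  -- lifts.
  have huniq := (isSeparatedMap_proj hP).eq_of_comp_eq
    (isLocalHomeomorph_proj hP).isLocallyInjective
    (hI (hcy x hx) (hG ⟨x, hx⟩)) (hI (hcy x hx) hH') rfl 0 (mk_eq_mk.2 ⟨rfl, by
      have := hG0 ⟨x, hx⟩
      simpa [(hcU x hx).1] using this⟩)
  have h1 := congrFun huniq 1
  have h2 := (hf' ⟨x, hx⟩).2.symm.trans h1
  have h3 := (mk_eq_mk.1 h2).2
  refine h3.trans ?_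
  simpa [hc1] using hH0

open EtaleSpace in
/-- Monodromy theorem for germs that can be continued along the paths of a suitable family. -/
theorem IsRigidLocalCondition.exists_global [SimplyConnectedSpace X] [LocallyPathConnectedSpace X]
    (hP : IsRigidLocalCondition P)
    (hext : ∀ p : X, ∃ U : Set X, IsOpen U ∧ p ∈ U ∧ IsPreconnected U ∧ ∃ c : X → ℝ → X,
      ContinuousOn (fun q : X × ℝ => c q.1 q.2) (U ×ˢ Icc 0 1) ∧
      ∀ x ∈ U, c x 0 = p ∧ c x 1 = x ∧ ContinuableAlong P (c x) ∧
        ContinuableAlong P (fun t => c x (1 - t)))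
    {b : X} {f₀ : X → Y} (h₀ : P b f₀) : ∃ f, (∀ x, P x f) ∧ f =ᶠ[𝓝 b] f₀ := by
  have hcov : IsCoveringMap (proj : EtaleSpace P → X) := by
    refine isCoveringMap_proj hP fun p => ?_
    obtain ⟨U, hU, hpU, hUc, c, hc, hcU⟩ := hext p
    exact ⟨U, hU, hpU, hUc, hP.exists_extension hU hc hcU⟩
  -- A lift of the identity through the covering is a global section.
  obtain ⟨F, ⟨hF0, hF⟩, -⟩ :=
    hcov.existsUnique_continuousMap_lifts (ContinuousMap.id X) b (EtaleSpace.mk b f₀ h₀) rfl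
  obtain ⟨f, hf⟩ := exists_of_section hP isOpen_univ ⟨b, trivial⟩ (s := fun x : (univ : Set X) => F x)
    (F.continuous.comp continuous_subtype_val) fun x => congrFun hF x
  refine ⟨f, fun x => (hf ⟨x, trivial⟩).1, ?_⟩
  obtain ⟨h1, h2⟩ := hf ⟨b, trivial⟩
  exact (mk_eq_mk.1 (hF0.symm.trans h2)).2.symm

end EtaleSpace

/-! ### Continuation of affine maps along curves. -/

section Continuation

open Set Filter Topology

/-- Germs that can be continued along short pieces of a path can be continued along the path. -/
theorem exists_continuation_of_local {X Y : Type*} [TopologicalSpace X] {γ : ℝ → X}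
    (hγ : ContinuousOn γ (Icc 0 1)) {Q : ℝ → (X → Y) → Prop}
    (hloc : ∀ t₀ ∈ Icc (0 : ℝ) 1, ∃ δ > 0, ∀ t₁ ∈ Ioo (t₀ - δ) (t₀ + δ), t₁ ∈ Icc (0 : ℝ) 1 →
      ∀ f, Q t₁ f → ∃ G : ℝ → X → Y, G t₁ =ᶠ[𝓝 (γ t₁)] f ∧
        ∀ t ∈ Ioo (t₀ - δ) (t₀ + δ), t ∈ Icc (0 : ℝ) 1 →
          Q t (G t) ∧ ∀ᶠ s in 𝓝[Icc 0 1] t, G s =ᶠ[𝓝 (γ s)] G t)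
    {f₀ : X → Y} (h₀ : Q 0 f₀) :
    ∃ G : ℝ → X → Y, G 0 =ᶠ[𝓝 (γ 0)] f₀ ∧ ∀ t ∈ Icc (0 : ℝ) 1,
      Q t (G t) ∧ ∀ᶠ s in 𝓝[Icc 0 1] t, G s =ᶠ[𝓝 (γ s)] G t := by
  classical
  choose! δ hδ hstep using hloc
  -- A Lebesgue subdivision: each [T n, T (n + 1)] lies in one of the intervals of `hloc`, and T n =
  -- 1 from n = m on.
  obtain ⟨T, hT0, hTm, ⟨m, hm⟩, hTc⟩ := exists_monotone_Icc_subset_open_cover_unitInterval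
    (ι := Icc (0 : ℝ) 1)
    (c := fun i => ((↑) : unitInterval → ℝ) ⁻¹' Ioo (i.1 - δ i.1) (i.1 + δ i.1))
    (fun i => isOpen_Ioo.preimage continuous_subtype_val)
    (fun t _ => mem_iUnion.2 ⟨t, by
      have := hδ t t.2
      exact ⟨by linarith, by linarith⟩⟩)
  have key : ∀ n : ℕ, ∃ G : ℝ → X → Y, G 0 =ᶠ[𝓝 (γ 0)] f₀ ∧ ∀ t ∈ Icc (0 : ℝ) (T n),
      Q t (G t) ∧ ∀ᶠ s in 𝓝 t, s ∈ Icc (0 : ℝ) (T n) → G s =ᶠ[𝓝 (γ s)] G t := by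
    intro n
    induction n with
    | zero =>
      refine ⟨fun _ => f₀, EventuallyEq.rfl, fun t ht => ?_⟩
      rw [hT0] at ht
      obtain rfl : t = 0 := le_antisymm ht.2 ht.1
      exact ⟨h₀, Eventually.of_forall fun _ _ => EventuallyEq.rfl⟩
    | succ n ih =>
      obtain ⟨G, hG0, hG⟩ := ih
      obtain ⟨i, hi⟩ := hTc n
      have hTn : (T n : ℝ) ≤ T (n + 1) := hTm n.le_succ
      have hTn0 : (0 : ℝ) ≤ T n := (T n).2.1
      have hsub : ∀ t ∈ Icc (T n : ℝ) (T (n + 1)),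
          t ∈ Ioo (i.1 - δ i.1) (i.1 + δ i.1) ∧ t ∈ Icc (0 : ℝ) 1 := by
        intro t ht
        have ht1 : t ∈ Icc (0 : ℝ) 1 := ⟨hTn0.trans ht.1, ht.2.trans (T (n + 1)).2.2⟩
        exact ⟨hi (show (⟨t, ht1⟩ : unitInterval) ∈ Icc (T n) (T (n + 1)) from ht), ht1⟩
      obtain ⟨G', hG'0, hG'⟩ := hstep i.1 i.2 (T n) (hsub _ ⟨le_rfl, hTn⟩).1 (T n).2 (G (T n))
        (hG (T n) ⟨hTn0, le_rfl⟩).1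
      have hG'' : ∀ t ∈ Icc (T n : ℝ) (T (n + 1)), Q t (G' t) ∧
          ∀ᶠ s in 𝓝 t, s ∈ Icc (0 : ℝ) 1 → G' s =ᶠ[𝓝 (γ s)] G' t := fun t ht => by
        rw [← eventually_nhdsWithin_iff]
        exact hG' t (hsub t ht).1 (hsub t ht).2
      refine ⟨fun s => if s ≤ T n then G s else G' s, by simpa [hTn0] using hG0, fun t ht => ?_⟩
      rcases lt_trichotomy t (T n) with hlt | heq | hgt
      · obtain ⟨h1, h2⟩ := hG t ⟨ht.1, hlt.le⟩
        refine ⟨by simpa [hlt.le] using h1, ?_⟩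
        filter_upwards [h2, eventually_lt_nhds hlt] with s hs1 hs2 hs3
        simp only [if_pos hs2.le, if_pos hlt.le]
        exact hs1 ⟨hs3.1, hs2.le⟩
      · obtain ⟨h1, h2⟩ := hG (T n) ⟨hTn0, le_rfl⟩
        obtain ⟨h3, h4⟩ := hG'' (T n) ⟨le_rfl, hTn⟩
        -- At the joint the old and the new germ coincide near γ (T n), hence also near γ s for s
        -- close to T n.
        have h5 : ∀ᶠ s in 𝓝 (T n : ℝ), s ∈ Icc (0 : ℝ) 1 → G' (T n) =ᶠ[𝓝 (γ s)] G (T n) := by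
          rw [← eventually_nhdsWithin_iff]
          exact (hγ (T n) (T n).2).eventually (eventually_eventually_nhds.2 hG'0)
        subst heq
        refine ⟨by simpa using h1, ?_⟩
        filter_upwards [h2, h4, h5] with s hs1 hs2 hs3 hs4
        have hs5 : s ∈ Icc (0 : ℝ) 1 := ⟨hs4.1, hs4.2.trans (T (n + 1)).2.2⟩
        rcases le_or_gt s (T n) with hs | hs
        · simp only [if_pos hs, le_refl, if_true]
          exact hs1 ⟨hs4.1, hs⟩
        · simp only [if_neg hs.not_ge, le_refl, if_true]
          exact (hs2 hs5).trans (hs3 hs5)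
      · obtain ⟨h3, h4⟩ := hG'' t ⟨hgt.le, ht.2⟩
        refine ⟨by simpa [hgt.not_ge] using h3, ?_⟩
        filter_upwards [h4, eventually_gt_nhds hgt] with s hs1 hs2 hs3
        simp only [if_neg hs2.not_ge, if_neg hgt.not_ge]
        exact hs1 ⟨hs3.1, hs3.2.trans (T (n + 1)).2.2⟩
  obtain ⟨G, hG0, hG⟩ := key m
  rw [hm m le_rfl] at hG
  refine ⟨G, hG0, fun t ht => ⟨(hG t ht).1, ?_⟩⟩
  rw [eventually_nhdsWithin_iff]
  exact (hG t ht).2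

variable {E₁ : Type*} [NormedAddCommGroup E₁] [NormedSpace ℝ E₁]
  {E₂ : Type*} [NormedAddCommGroup E₂] [NormedSpace ℝ E₂]
  {Γ₁ : E₁ → E₁ →L[ℝ] E₁ →L[ℝ] E₁} {Γ₂ : E₂ → E₂ →L[ℝ] E₂ →L[ℝ] E₂}

theorem IsAffineNear.congr {F G : E₁ → E₂} {x : E₁} (hF : IsAffineNear Γ₁ Γ₂ F x)
    (h : F =ᶠ[𝓝 x] G) : IsAffineNear Γ₁ Γ₂ G x := by
  filter_upwards [hF, eventually_eventually_nhds.2 h] with z hz1 (hz2 : F =ᶠ[𝓝 z] G)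
  refine ⟨hz1.1.congr_of_eventuallyEq hz2.symm, ?_⟩
  rw [← hz2.fderiv.fderiv_eq, ← hz2.fderiv_eq, ← hz2.self_of_nhds]
  exact hz1.2

/-- Affine maps with the same 1-jet at a point agree near this point. -/
theorem IsAffineNear.eventuallyEq {F G : E₁ → E₂} {x : E₁} (hF : IsAffineNear Γ₁ Γ₂ F x)
    (hG : IsAffineNear Γ₁ Γ₂ G x) (h₁ : ∀ᶠ z in 𝓝 x, ContDiffAt ℝ 1 Γ₁ z)
    (h₂ : ∀ᶠ y in 𝓝 (F x), ContDiffAt ℝ 1 Γ₂ y) (h0 : F x = G x)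
    (h0' : fderiv ℝ F x = fderiv ℝ G x) : F =ᶠ[𝓝 x] G := by
  have hc : ContinuousAt F x := hF.self_of_nhds.1.continuousAt
  obtain ⟨ε, hε, hball⟩ := Metric.eventually_nhds_iff_ball.1
    (hF.eventually.and (hG.eventually.and (h₁.and (hc.eventually h₂))))
  filter_upwards [Metric.ball_mem_nhds x hε] with z hz
  exact eqOn_of_isAffineNear Metric.isOpen_ball (convex_ball x ε) (fun z hz => (hball z hz).1)
    (fun z hz => (hball z hz).2.1) (fun z hz => (hball z hz).2.2.1)
    (fun z hz => (hball z hz).2.2.2) (Metric.mem_ball_self hε) h0 h0' hz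

/-- An affine map whose jet agrees at one time with a solution of the jet equation along a curve
has this solution as its jet along the curve near that time. -/
theorem eventuallyEq_jet_comp {F : E₁ → E₂} {c d : ℝ → E₁} {u : ℝ → E₂ × (E₁ →L[ℝ] E₂)} {t : ℝ}
    (hF : IsAffineNear Γ₁ Γ₂ F (c t)) (hc : ∀ᶠ s in 𝓝 t, HasDerivAt c (d s) s)
    (hd : ∀ᶠ s in 𝓝 t, ContinuousAt d s)
    (hu : ∀ᶠ s in 𝓝 t, HasDerivAt u (jetField Γ₁ Γ₂ (c s, u s) (d s)) s)
    (h₁ : ∀ᶠ s in 𝓝 t, ContDiffAt ℝ 1 Γ₁ (c s)) (h₂ : ∀ᶠ s in 𝓝 t, ContDiffAt ℝ 1 Γ₂ (u s).1)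
    (h0 : (F (c t), fderiv ℝ F (c t)) = u t) :
    ∀ᶠ s in 𝓝 t, (F (c s), fderiv ℝ F (c s)) = u s := by
  have hF' : ∀ᶠ s in 𝓝 t, IsAffineNear Γ₁ Γ₂ F (c s) :=
    hc.self_of_nhds.continuousAt.eventually hF.eventually
  obtain ⟨ε, hε, hball⟩ := Metric.eventually_nhds_iff_ball.1
    (hF'.and (hc.and (hd.and (hu.and (h₁.and h₂)))))
  have huniq := ode_unique_of_contDiffAt (s := Metric.ball t ε) Metric.isOpen_ball
    (convex_ball t ε).isPreconnected
    (G := fun q : (E₁ × E₁) × (E₂ × (E₁ →L[ℝ] E₂)) => jetField Γ₁ Γ₂ (q.1.1, q.2) q.1.2)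
    (e := fun s => (c s, d s)) (f := u) (g := fun s => (F (c s), fderiv ℝ F (c s)))
    (fun s hs => ((hball s hs).2.1.continuousAt.prodMk (hball s hs).2.2.1).continuousWithinAt)
    (fun s hs => ?_) (fun s hs => (hball s hs).2.2.2.1)
    (fun s hs => hasDerivAt_jet_comp (hball s hs).1 (hball s hs).2.1) (Metric.mem_ball_self hε)
    h0.symm
  · filter_upwards [Metric.ball_mem_nhds t hε] with s hs using (huniq hs).symm
  · have hj : ContDiffAt ℝ 1 (jetField Γ₁ Γ₂) (c s, u s) :=
      contDiffAt_jetField (hball s hs).2.2.2.2.1 (hball s hs).2.2.2.2.2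
    exact (ContDiffAt.comp ((c s, d s), u s) (g := jetField Γ₁ Γ₂)
      (f := fun q : (E₁ × E₁) × (E₂ × (E₁ →L[ℝ] E₂)) => (q.1.1, q.2)) hj
      (by fun_prop)).clm_apply (by fun_prop)

/-- Continuation of affine maps along a geodesic, over a short interval, if there is a geodesic in
the target that can serve as the image. -/
theorem exists_affine_continuation [CompleteSpace E₁] [CompleteSpace E₂] {a b C : ℝ}
    {c d : ℝ → E₁} {y e : ℝ → E₂} (hc : ∀ t ∈ Icc a b, HasDerivAt c (d t) t)
    (hd : ∀ t ∈ Icc a b, HasDerivAt d (Γ₁ (c t) (d t) (d t)) t)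
    (hy : ∀ t ∈ Icc a b, HasDerivAt y (e t) t)
    (he : ∀ t ∈ Icc a b, HasDerivAt e (Γ₂ (y t) (e t) (e t)) t)
    (h₁ : ∀ t ∈ Icc a b, GoodNear Γ₁ (c t)) (h₂ : ∀ t ∈ Icc a b, GoodNear Γ₂ (y t))
    (hC₁ : ∀ t ∈ Icc a b, ‖Γ₁ (c t)‖ * ‖d t‖ ≤ C) (hC₂ : ∀ t ∈ Icc a b, ‖Γ₂ (y t)‖ * ‖e t‖ ≤ C)
    (hab : (b - a) * (2 * C) ≤ 1 / 2) {t₁ : ℝ} (ht₁ : t₁ ∈ Ioo a b) {F : E₁ → E₂}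
    (hF : IsAffineNear Γ₁ Γ₂ F (c t₁)) (hF0 : F (c t₁) = y t₁)
    (hF1 : fderiv ℝ F (c t₁) (d t₁) = e t₁) :
    ∃ Φ : ℝ → E₁ → E₂, Φ t₁ =ᶠ[𝓝 (c t₁)] F ∧ ∀ t ∈ Ioo a b, IsAffineNear Γ₁ Γ₂ (Φ t) (c t) ∧
      (∀ᶠ s in 𝓝 t, Φ t (c s) = y s) ∧ ∀ᶠ s in 𝓝 t, Φ s =ᶠ[𝓝 (c s)] Φ t := by
  have hI : Ioo a b ⊆ Icc a b := Ioo_subset_Icc_self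
  have hC0 : 0 ≤ C := (by positivity : (0 : ℝ) ≤ ‖Γ₁ (c t₁)‖ * ‖d t₁‖).trans (hC₁ t₁ (hI ht₁))
  have hba : 0 ≤ b - a := by linarith [ht₁.1, ht₁.2]
  have hcc : ContinuousOn c (Icc a b) := fun t ht => (hc t ht).continuousAt.continuousWithinAt
  have hdc : ContinuousOn d (Icc a b) := fun t ht => (hd t ht).continuousAt.continuousWithinAt
  have hyc : ContinuousOn y (Icc a b) := fun t ht => (hy t ht).continuousAt.continuousWithinAt
  have hec : ContinuousOn e (Icc a b) := fun t ht => (he t ht).continuousAt.continuousWithinAt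
  have hΓ₁c : ContinuousOn (fun t => Γ₁ (c t)) (Icc a b) := fun t ht =>
    ((h₁ t ht).contDiffAt (n := 0)).continuousAt.comp_continuousWithinAt (hcc t ht)
  have hΓ₂c : ContinuousOn (fun t => Γ₂ (y t)) (Icc a b) := fun t ht =>
    ((h₂ t ht).contDiffAt (n := 0)).continuousAt.comp_continuousWithinAt (hyc t ht)
  -- Parallel fields along c and y are the solutions of V' = S V and W' = R W. A linear map carrying
  -- the former to the latter satisfies A' = R A - A S.
  set S : ℝ → E₁ →L[ℝ] E₁ := fun t => (Γ₁ (c t)).flip (d t) with hS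
  set R : ℝ → E₂ →L[ℝ] E₂ := fun t => (Γ₂ (y t)).flip (e t) with hR
  have hSc : ContinuousOn S (Icc a b) :=
    ((ContinuousLinearMap.flipₗᵢ ℝ E₁ E₁ E₁).continuous.comp_continuousOn hΓ₁c).clm_apply hdc
  have hRc : ContinuousOn R (Icc a b) :=
    ((ContinuousLinearMap.flipₗᵢ ℝ E₂ E₂ E₂).continuous.comp_continuousOn hΓ₂c).clm_apply hec
  have hSn : ∀ t ∈ Icc a b, ‖S t‖ ≤ C := fun t ht =>
    ((ContinuousLinearMap.le_opNorm _ _).trans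
      (by rw [ContinuousLinearMap.opNorm_flip])).trans (hC₁ t ht)
  have hRn : ∀ t ∈ Icc a b, ‖R t‖ ≤ C := fun t ht =>
    ((ContinuousLinearMap.le_opNorm _ _).trans
      (by rw [ContinuousLinearMap.opNorm_flip])).trans (hC₂ t ht)
  -- Since the image curve y is given, the equation for A is linear with coefficient norm at most
  -- 2C. It is solvable on the whole interval whatever the size of the initial value.
  obtain ⟨A, hA0, hA⟩ := exists_solution_linear_ode
    (L := fun t => ContinuousLinearMap.compL ℝ E₁ E₂ E₂ (R t) -
      (ContinuousLinearMap.compL ℝ E₁ E₁ E₂).flip (S t)) (C := 2 * C)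
    (((ContinuousLinearMap.continuous _).comp_continuousOn hRc).sub
      ((ContinuousLinearMap.continuous _).comp_continuousOn hSc))
    (fun t ht => ContinuousLinearMap.opNorm_le_bound _ (by positivity) fun B => by
      have e1 : ‖R t ∘L B‖ ≤ C * ‖B‖ := (ContinuousLinearMap.opNorm_comp_le _ _).trans
        (mul_le_mul_of_nonneg_right (hRn t ht) (norm_nonneg _))
      have e2 : ‖B ∘L S t‖ ≤ ‖B‖ * C := (ContinuousLinearMap.opNorm_comp_le _ _).trans
        (mul_le_mul_of_nonneg_left (hSn t ht) (norm_nonneg _))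
      calc _ = ‖R t ∘L B - B ∘L S t‖ := rfl
        _ ≤ ‖R t ∘L B‖ + ‖B ∘L S t‖ := norm_sub_le _ _
        _ ≤ 2 * C * ‖B‖ := by linarith) hab (hI ht₁) (fderiv ℝ F (c t₁))
  have hA' : ∀ t ∈ Ioo a b, HasDerivAt A (R t ∘L A t - A t ∘L S t) t := hA
  -- Both curves being geodesics, their velocities are parallel. Hence A d and e both solve W' = R W
  -- and agree at t₁, which makes (y, A) a solution of the jet equation.
  have hAd : ∀ t ∈ Ioo a b, A t (d t) = e t := by
    refine fun t ht => ode_unique_of_contDiffAt (s := Ioo a b) isOpen_Ioo isPreconnected_Ioo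
      (G := fun q : (E₂ →L[ℝ] E₂) × E₂ => q.1 q.2) (e := R) (f := fun t => A t (d t)) (g := e)
      (hRc.mono hI) (fun t _ => by fun_prop) (fun t ht => ?_) (fun t ht => he t (hI ht)) ht₁
      (by rw [hA0, hF1]) ht
    refine ((hA' t ht).clm_apply (hd t (hI ht))).congr_deriv ?_
    simp [hS]
  set u : ℝ → E₂ × (E₁ →L[ℝ] E₂) := fun t => (y t, A t) with hu
  have hud : ∀ t ∈ Ioo a b, HasDerivAt u (jetField Γ₁ Γ₂ (c t, u t) (d t)) t := by
    intro t ht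
    refine ((hy t (hI ht)).prodMk (hA' t ht)).congr_deriv ?_
    refine Prod.ext (hAd t ht).symm (ContinuousLinearMap.ext fun z => ?_)
    simp [hu, hR, hS, hAd t ht]
  have h2le : ∀ {n : ℕ}, (n : WithTop ℕ∞) ≤ ∞ := fun {n} => by exact_mod_cast le_top
  have hint : ∀ t ∈ Ioo a b, Intertwines Γ₁ Γ₂ (c t) (y t) (A t) := by
    refine intertwines_of_hasDerivAt_jetField (u := u) isOpen_Ioo isPreconnected_Ioo
      (hdc.mono hI) (fun t ht => hc t (hI ht)) hud
      (fun t ht => (h₁ t (hI ht)).contDiffAt (n := 2))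
      (fun t ht => (h₂ t (hI ht)).contDiffAt (n := 2)) (fun t ht => (h₁ t (hI ht)).self_of_nhds.2)
      (fun t ht => (h₂ t (hI ht)).self_of_nhds.2)
      (fun t ht v => exists_parallel_field hΓ₁c hdc hC₁ (by nlinarith) ht v) ht₁ ?_
    simp only [hu, hA0, ← hF0]
    exact hF.intertwines ((h₁ t₁ (hI ht₁)).contDiffAt (n := 1))
      (by rw [hF0]; exact (h₂ t₁ (hI ht₁)).contDiffAt (n := 1))
  have hex : ∀ t, ∃ Φ : E₁ → E₂, t ∈ Ioo a b →
      Φ (c t) = y t ∧ fderiv ℝ Φ (c t) = A t ∧ IsAffineNear Γ₁ Γ₂ Φ (c t) := by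
    intro t
    by_cases ht : t ∈ Ioo a b
    · obtain ⟨Φ, hΦ⟩ := exists_isAffineNear (h₁ t (hI ht)) (h₂ t (hI ht)) (hint t ht)
      exact ⟨Φ, fun _ => hΦ⟩
    · exact ⟨F, fun h => (ht h).elim⟩
  choose Φ hΦ using hex
  have hg₁ : ∀ t ∈ Ioo a b, ∀ᶠ z in 𝓝 (c t), ContDiffAt ℝ 1 Γ₁ z := fun t ht =>
    (h₁ t (hI ht)).mono fun z hz => hz.1.of_le (h2le (n := 1))
  have hg₂ : ∀ t ∈ Ioo a b, ∀ᶠ z in 𝓝 (y t), ContDiffAt ℝ 1 Γ₂ z := fun t ht =>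
    (h₂ t (hI ht)).mono fun z hz => hz.1.of_le (h2le (n := 1))
  -- The local maps `Φ t` are chosen separately for each t. They fit together because near t the jet
  -- of `Φ t` along c must follow u, which also prescribes the jet of `Φ s`.
  have hjet : ∀ t ∈ Ioo a b, ∀ᶠ s in 𝓝 t, (Φ t (c s), fderiv ℝ (Φ t) (c s)) = u s := by
    intro t ht
    have hev : ∀ᶠ s in 𝓝 t, s ∈ Ioo a b := isOpen_Ioo.mem_nhds ht
    refine eventuallyEq_jet_comp (hΦ t ht).2.2 (hev.mono fun s hs => hc s (hI hs))
      (hev.mono fun s hs => (hd s (hI hs)).continuousAt) (hev.mono fun s hs => hud s hs)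
      (hev.mono fun s hs => (hg₁ s hs).self_of_nhds) (hev.mono fun s hs => (hg₂ s hs).self_of_nhds)
      ?_
    rw [(hΦ t ht).1, (hΦ t ht).2.1]
  refine ⟨Φ, ?_, fun t ht => ⟨(hΦ t ht).2.2, (hjet t ht).mono fun s hs => congrArg Prod.fst hs, ?_⟩⟩
  · obtain ⟨p1, p2, p3⟩ := hΦ t₁ ht₁
    exact p3.eventuallyEq hF (hg₁ t₁ ht₁) (by rw [p1]; exact hg₂ t₁ ht₁) (by rw [p1, hF0])
      (by rw [p2, hA0])
  · have hev : ∀ᶠ s in 𝓝 t, s ∈ Ioo a b := isOpen_Ioo.mem_nhds ht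
    have haf : ∀ᶠ s in 𝓝 t, IsAffineNear Γ₁ Γ₂ (Φ t) (c s) :=
      (hc t (hI ht)).continuousAt.eventually (hΦ t ht).2.2.eventually
    filter_upwards [hev, hjet t ht, haf] with s hs hj hsa
    obtain ⟨p1, p2, p3⟩ := hΦ s hs
    refine p3.eventuallyEq hsa (hg₁ s hs) (by rw [p1]; exact hg₂ s hs) ?_ ?_
    · rw [p1]; exact (congrArg Prod.fst hj).symm
    · rw [p2]; exact (congrArg Prod.snd hj).symm

end Continuation

/-! ### Passing between charts and manifolds. -/

section Charts

open Filter Topology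

variable {X₁ X₂ Y₁ Y₂ : Type*} [TopologicalSpace X₁] [TopologicalSpace X₂] [TopologicalSpace Y₁]
  [TopologicalSpace Y₂]

theorem OpenPartialHomeomorph.eventuallyEq_of_comp {φ₁ : OpenPartialHomeomorph X₁ Y₁}
    {φ₂ : OpenPartialHomeomorph X₂ Y₂} {f : X₁ → X₂} {x : X₁} (hx : x ∈ φ₁.source)
    (hf : ∀ᶠ x' in 𝓝 x, f x' ∈ φ₂.source) :
    φ₂.symm ∘ (φ₂ ∘ f ∘ φ₁.symm) ∘ φ₁ =ᶠ[𝓝 x] f := by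
  filter_upwards [hf, φ₁.open_source.mem_nhds hx] with y hy1 hy2
  simp [hy2, hy1]

theorem OpenPartialHomeomorph.eventually_symm {φ : OpenPartialHomeomorph X₁ Y₁} {x : X₁}
    (hx : x ∈ φ.source) {p : X₁ → Prop} (hp : ∀ᶠ y in 𝓝 x, p y) :
    ∀ᶠ z in 𝓝 (φ x), p (φ.symm z) := by
  have := φ.symm.continuousAt (φ.map_source hx)
  refine this.eventually ?_
  rwa [φ.left_inv hx]

theorem Filter.EventuallyEq.comp_charts {φ₁ : OpenPartialHomeomorph X₁ Y₁}
    (φ₂ : OpenPartialHomeomorph X₂ Y₂) {F G : Y₁ → Y₂} {z : Y₁} (h : F =ᶠ[𝓝 z] G) (hz : z ∈ φ₁.target) :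
    φ₂.symm ∘ F ∘ φ₁ =ᶠ[𝓝 (φ₁.symm z)] φ₂.symm ∘ G ∘ φ₁ := by
  have : ContinuousAt φ₁ (φ₁.symm z) := φ₁.continuousAt (φ₁.map_target hz)
  rw [ContinuousAt, φ₁.right_inv hz] at this
  filter_upwards [this.eventually h] with y hy
  simp [hy]

end Charts

/-! ### Germs of affine maps between manifolds and the identity principle. -/

section AffineGerms

open Set Filter Topology

variable {E : Type*} [NormedAddCommGroup E] [NormedSpace ℝ E]
  {M : Type*} [TopologicalSpace M] [ChartedSpace E M]
  {E₁ : Type*} [NormedAddCommGroup E₁] [NormedSpace ℝ E₁]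
  {M₁ : Type*} [TopologicalSpace M₁] [ChartedSpace E₁ M₁]
  {E₂ : Type*} [NormedAddCommGroup E₂] [NormedSpace ℝ E₂]
  {M₂ : Type*} [TopologicalSpace M₂] [ChartedSpace E₂ M₂]

theorem AffineConnection.goodNear (B : AffineConnection E M) (hT : B.HasParallelTorsion)
    (hR : B.HasParallelCurvature) {φ : OpenPartialHomeomorph M E}
    (hφ : φ ∈ IsManifold.maximalAtlas 𝓘(ℝ, E) ∞ M) {z : E} (hz : z ∈ φ.target) :
    GoodNear (B.localRep φ) z := by
  filter_upwards [φ.open_target.mem_nhds hz] with y hy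
  exact ⟨(B.contDiffOn_localRep φ hφ).contDiffAt (φ.open_target.mem_nhds hy),
    hT φ hφ y hy, hR φ hφ y hy⟩

/-- The transformation law of the local representations is the equation of affine maps for the
change of charts. Independence of charts thereby reduces to `IsAffineNear.comp`. -/
theorem AffineConnection.isAffineNear_transition [IsManifold 𝓘(ℝ, E) ∞ M]
    (B : AffineConnection E M)
    {φ ψ : OpenPartialHomeomorph M E} (hφ : φ ∈ IsManifold.maximalAtlas 𝓘(ℝ, E) ∞ M)
    (hψ : ψ ∈ IsManifold.maximalAtlas 𝓘(ℝ, E) ∞ M) {z : E} (hz : z ∈ (φ.symm ≫ₕ ψ).source) :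
    IsAffineNear (B.localRep φ) (B.localRep ψ) (ψ ∘ φ.symm) z := by
  filter_upwards [(φ.symm ≫ₕ ψ).open_source.mem_nhds hz] with y hy
  refine ⟨?_, fun v w => (B.localRep_change φ hφ ψ hψ y hy v w).symm⟩
  rw [OpenPartialHomeomorph.trans_source] at hy
  rw [← contMDiffAt_iff_contDiffAt]
  exact (contMDiffAt_of_mem_maximalAtlas hψ hy.2).comp y
    (contMDiffAt_symm_of_mem_maximalAtlas hφ hy.1)

variable (B₁ : AffineConnection E₁ M₁) (B₂ : AffineConnection E₂ M₂)

/-- A map is smooth and affine near a point. -/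
def IsAffineMapAt (x : M₁) (f : M₁ → M₂) : Prop :=
  ∃ φ₁ ∈ IsManifold.maximalAtlas 𝓘(ℝ, E₁) ∞ M₁, ∃ φ₂ ∈ IsManifold.maximalAtlas 𝓘(ℝ, E₂) ∞ M₂,
    x ∈ φ₁.source ∧ (∀ᶠ x' in 𝓝 x, f x' ∈ φ₂.source) ∧
      IsAffineNear (B₁.localRep φ₁) (B₂.localRep φ₂) (φ₂ ∘ f ∘ φ₁.symm) (φ₁ x)

variable {B₁ B₂}

theorem IsAffineMapAt.continuousAt {f : M₁ → M₂} {x : M₁} (hf : IsAffineMapAt B₁ B₂ x f) :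
    ContinuousAt f x := by
  obtain ⟨φ₁, h₁, φ₂, h₂, hx, hs, hF⟩ := hf
  refine ContinuousAt.congr ?_ (OpenPartialHomeomorph.eventuallyEq_of_comp hx hs)
  have e1 := φ₁.continuousAt hx
  have e2 := hF.self_of_nhds.1.continuousAt
  refine ContinuousAt.comp (g := φ₂.symm) ?_ (ContinuousAt.comp e2 e1)
  refine φ₂.symm.continuousAt ?_
  simp only [Function.comp, φ₁.left_inv hx]
  exact φ₂.map_source hs.self_of_nhds

/-- The representation of an affine map is affine in any charts. -/
theorem IsAffineMapAt.isAffineNear [IsManifold 𝓘(ℝ, E₁) ∞ M₁] [IsManifold 𝓘(ℝ, E₂) ∞ M₂]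
    {f : M₁ → M₂} {x : M₁} (hf : IsAffineMapAt B₁ B₂ x f)
    {ψ₁ : OpenPartialHomeomorph M₁ E₁} (k₁ : ψ₁ ∈ IsManifold.maximalAtlas 𝓘(ℝ, E₁) ∞ M₁)
    {ψ₂ : OpenPartialHomeomorph M₂ E₂} (k₂ : ψ₂ ∈ IsManifold.maximalAtlas 𝓘(ℝ, E₂) ∞ M₂)
    (hx : x ∈ ψ₁.source) (hfx : f x ∈ ψ₂.source) :
    IsAffineNear (B₁.localRep ψ₁) (B₂.localRep ψ₂) (ψ₂ ∘ f ∘ ψ₁.symm) (ψ₁ x) := by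
  obtain ⟨φ₁, h₁, φ₂, h₂, hx', hs, hF⟩ := hf
  have t₁ : IsAffineNear (B₁.localRep ψ₁) (B₁.localRep φ₁) (φ₁ ∘ ψ₁.symm) (ψ₁ x) :=
    B₁.isAffineNear_transition k₁ h₁ (by simp [hx, hx'])
  have t₂ : IsAffineNear (B₂.localRep φ₂) (B₂.localRep ψ₂) (ψ₂ ∘ φ₂.symm) (φ₂ (f x)) :=
    B₂.isAffineNear_transition h₂ k₂ (by simp [hfx, hs.self_of_nhds])
  have e1 : (φ₁ ∘ ψ₁.symm) (ψ₁ x) = φ₁ x := by simp [hx]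
  have e2 : (φ₂ ∘ f ∘ φ₁.symm) (φ₁ x) = φ₂ (f x) := by simp [hx']
  have h3 := IsAffineNear.comp (x := φ₁ x) (by rw [e2]; exact t₂) hF
  refine (IsAffineNear.comp (x := ψ₁ x) (by rw [e1]; exact h3) t₁).congr ?_
  filter_upwards [OpenPartialHomeomorph.eventually_symm hx hs, OpenPartialHomeomorph.eventually_symm hx
    (p := (· ∈ φ₁.source)) (φ₁.open_source.mem_nhds hx')] with z hz hz'
  simp [hz, hz']

/-- A map between charts that is affine gives an affine map between the manifolds. -/
theorem IsAffineNear.isAffineMapAt {φ₁ : OpenPartialHomeomorph M₁ E₁}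
    (h₁ : φ₁ ∈ IsManifold.maximalAtlas 𝓘(ℝ, E₁) ∞ M₁) {φ₂ : OpenPartialHomeomorph M₂ E₂}
    (h₂ : φ₂ ∈ IsManifold.maximalAtlas 𝓘(ℝ, E₂) ∞ M₂) {F : E₁ → E₂} {z : E₁}
    (hF : IsAffineNear (B₁.localRep φ₁) (B₂.localRep φ₂) F z) (hz : z ∈ φ₁.target)
    (hFz : F z ∈ φ₂.target) : IsAffineMapAt B₁ B₂ (φ₁.symm z) (φ₂.symm ∘ F ∘ φ₁) := by
  have hev : ∀ᶠ y in 𝓝 z, F y ∈ φ₂.target :=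
    hF.self_of_nhds.1.continuousAt.eventually (φ₂.open_target.mem_nhds hFz)
  refine ⟨φ₁, h₁, φ₂, h₂, φ₁.map_target hz, ?_, ?_⟩
  · have : ContinuousAt φ₁ (φ₁.symm z) := φ₁.continuousAt (φ₁.map_target hz)
    rw [ContinuousAt, φ₁.right_inv hz] at this
    filter_upwards [this.eventually hev] with y hy using φ₂.map_target hy
  · rw [φ₁.right_inv hz]
    refine hF.congr ?_
    filter_upwards [hev, φ₁.open_target.mem_nhds hz] with y hy1 hy2
    simp [hy1, hy2]

theorem IsAffineMapAt.eventually {f : M₁ → M₂} {x : M₁} (hf : IsAffineMapAt B₁ B₂ x f) :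
    ∀ᶠ x' in 𝓝 x, IsAffineMapAt B₁ B₂ x' f := by
  obtain ⟨φ₁, h₁, φ₂, h₂, hx, hs, hF⟩ := hf
  filter_upwards [φ₁.open_source.mem_nhds hx, eventually_eventually_nhds.2 hs,
    (φ₁.continuousAt hx).eventually hF.eventually] with y hy1 hy2 hy3
  exact ⟨φ₁, h₁, φ₂, h₂, hy1, hy2, hy3⟩

theorem IsAffineMapAt.congr {f g : M₁ → M₂} {x : M₁} (hfg : f =ᶠ[𝓝 x] g)
    (hf : IsAffineMapAt B₁ B₂ x f) : IsAffineMapAt B₁ B₂ x g := by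
  obtain ⟨φ₁, h₁, φ₂, h₂, hx, hs, hF⟩ := hf
  refine ⟨φ₁, h₁, φ₂, h₂, hx, ?_, hF.congr ?_⟩
  · filter_upwards [hs, hfg] with y hy1 hy2 using hy2 ▸ hy1
  · filter_upwards [OpenPartialHomeomorph.eventually_symm hx hfg] with y hy
    simp [hy]

/-- If the germs agree at points arbitrarily close to x, the Hausdorff property gives f x = g x, so
one pair of charts serves both maps. On a ball in the chart at x, equal jets at a single point force
the representations to agree. -/
theorem isRigidLocalCondition_isAffineMapAt [IsManifold 𝓘(ℝ, E₁) ∞ M₁]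
    [IsManifold 𝓘(ℝ, E₂) ∞ M₂] [T2Space M₂] :
    IsRigidLocalCondition (IsAffineMapAt B₁ B₂) where
  eventually := IsAffineMapAt.eventually
  congr := IsAffineMapAt.congr
  separated := by
    intro x f g hf hg hfr
    have hfgx : f x = g x := tendsto_nhds_unique_of_frequently_eq hf.continuousAt hg.continuousAt
      (hfr.mono fun y hy => hy.self_of_nhds)
    set φ₁ := chartAt E₁ x
    set φ₂ := chartAt E₂ (f x)
    have h₁ : φ₁ ∈ IsManifold.maximalAtlas 𝓘(ℝ, E₁) ∞ M₁ := IsManifold.chart_mem_maximalAtlas x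
    have h₂ : φ₂ ∈ IsManifold.maximalAtlas 𝓘(ℝ, E₂) ∞ M₂ := IsManifold.chart_mem_maximalAtlas (f x)
    have hx : x ∈ φ₁.source := mem_chart_source E₁ x
    have hfx : f x ∈ φ₂.source := mem_chart_source E₂ (f x)
    have hF := hf.isAffineNear h₁ h₂ hx hfx
    have hG := hg.isAffineNear h₁ h₂ hx (hfgx ▸ hfx)
    have hsf := hf.continuousAt.eventually (φ₂.open_source.mem_nhds hfx)
    have hsg := hg.continuousAt.eventually (φ₂.open_source.mem_nhds (hfgx ▸ hfx))
    have hall : ∀ᶠ z in 𝓝 (φ₁ x),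
        (IsAffineNear (B₁.localRep φ₁) (B₂.localRep φ₂) (φ₂ ∘ f ∘ φ₁.symm) z ∧
        IsAffineNear (B₁.localRep φ₁) (B₂.localRep φ₂) (φ₂ ∘ g ∘ φ₁.symm) z) ∧
        z ∈ φ₁.target ∧ f (φ₁.symm z) ∈ φ₂.source ∧ g (φ₁.symm z) ∈ φ₂.source := by
      filter_upwards [hF.eventually, hG.eventually, φ₁.open_target.mem_nhds (φ₁.map_source hx),
        OpenPartialHomeomorph.eventually_symm hx hsf,
        OpenPartialHomeomorph.eventually_symm hx hsg] with z a b c d e using ⟨⟨a, b⟩, c, d, e⟩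
    obtain ⟨ε, hε, hball⟩ := Metric.eventually_nhds_iff_ball.1 hall
    have hU : ∀ᶠ y in 𝓝 x, y ∈ φ₁.source ∧ φ₁ y ∈ Metric.ball (φ₁ x) ε :=
      (show ∀ᶠ y in 𝓝 x, y ∈ φ₁.source from φ₁.open_source.mem_nhds hx).and
        ((φ₁.continuousAt hx).eventually (Metric.ball_mem_nhds _ hε))
    obtain ⟨y, hfgy, hy, hyb⟩ := (hfr.and_eventually hU).exists
    have hrep : φ₂ ∘ f ∘ φ₁.symm =ᶠ[𝓝 (φ₁ y)] φ₂ ∘ g ∘ φ₁.symm := by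
      filter_upwards [OpenPartialHomeomorph.eventually_symm hy hfgy] with z hz
      simp [hz]
    have heq := eqOn_of_isAffineNear Metric.isOpen_ball (convex_ball (φ₁ x) ε)
      (fun z hz => (hball z hz).1.1) (fun z hz => (hball z hz).1.2)
      (fun z hz => ((B₁.contDiffOn_localRep φ₁ h₁).contDiffAt
        (φ₁.open_target.mem_nhds (hball z hz).2.1)).of_le (by exact_mod_cast le_top))
      (fun z hz => ((B₂.contDiffOn_localRep φ₂ h₂).contDiffAt
        (φ₂.open_target.mem_nhds (φ₂.map_source (hball z hz).2.2.1))).of_le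
          (by exact_mod_cast le_top))
      hyb hrep.self_of_nhds hrep.fderiv_eq
    filter_upwards [hU] with w hw
    have := heq hw.2
    have hb := (hball _ hw.2).2
    simp only [Function.comp, φ₁.left_inv hw.1] at this hb
    exact φ₂.injOn hb.2.1 hb.2.2 this

end AffineGerms

/-! ### Images of geodesics under affine maps. -/

section Geodesics

open Set Filter Topology

variable {E : Type*} [NormedAddCommGroup E] [NormedSpace ℝ E]
  {M : Type*} [TopologicalSpace M] [ChartedSpace E M]
  {E₁ : Type*} [NormedAddCommGroup E₁] [NormedSpace ℝ E₁]
  {M₁ : Type*} [TopologicalSpace M₁] [ChartedSpace E₁ M₁]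
  {E₂ : Type*} [NormedAddCommGroup E₂] [NormedSpace ℝ E₂]
  {M₂ : Type*} [TopologicalSpace M₂] [ChartedSpace E₂ M₂]

theorem AffineConnection.IsGeodesic.hasDerivAt {B : AffineConnection E M} {α : ℝ → M}
    (hα : B.IsGeodesic α) {ψ : OpenPartialHomeomorph M E}
    (hψ : ψ ∈ IsManifold.maximalAtlas 𝓘(ℝ, E) ∞ M) {t : ℝ} (ht : α t ∈ ψ.source) :
    HasDerivAt (ψ ∘ α) (deriv (ψ ∘ α) t) t ∧ HasDerivAt (deriv (ψ ∘ α))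
      (B.localRep ψ ((ψ ∘ α) t) (deriv (ψ ∘ α) t) (deriv (ψ ∘ α) t)) t := by
  have hs : ContDiffAt ℝ ∞ (ψ ∘ α) t := by
    rw [← contMDiffAt_iff_contDiffAt]
    exact (contMDiffAt_of_mem_maximalAtlas hψ ht).comp t hα.1.contMDiffAt
  refine ⟨(hs.differentiableAt (by simp)).hasDerivAt, ?_⟩
  have h1 : ContDiffAt ℝ 1 (fderiv ℝ (ψ ∘ α)) t := hs.fderiv_right two_le_infty
  have h2 : DifferentiableAt ℝ (deriv (ψ ∘ α)) t :=
    (h1.differentiableAt (by simp)).clm_apply (differentiableAt_const 1)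
  have h3 := h2.hasDerivAt
  rwa [hα.2 ψ hψ t ht] at h3

/-- Tangent spaces are identified with the model space by preferred charts, so `mfderiv` is the
derivative of the representation in exactly these charts. -/
theorem tangentMap_eq_iff {f : M₁ → M₂} {x : M₁} (hf : MDifferentiableAt 𝓘(ℝ, E₁) 𝓘(ℝ, E₂) f x)
    {v : TangentSpace 𝓘(ℝ, E₁) x} {q : M₂} {w : TangentSpace 𝓘(ℝ, E₂) q} :
    tangentMap 𝓘(ℝ, E₁) 𝓘(ℝ, E₂) f ⟨x, v⟩ = ⟨q, w⟩ ↔ f x = q ∧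
      fderiv ℝ (chartAt E₂ q ∘ f ∘ (chartAt E₁ x).symm) (chartAt E₁ x x) v = w := by
  have key : mfderiv 𝓘(ℝ, E₁) 𝓘(ℝ, E₂) f x =
      fderiv ℝ (chartAt E₂ (f x) ∘ f ∘ (chartAt E₁ x).symm) (chartAt E₁ x x) := by
    refine hf.mfderiv.trans ?_
    simp only [mfld_simps, writtenInExtChartAt, fderivWithin_univ]
    rfl
  constructor
  · intro h
    obtain rfl : f x = q := congrArg Bundle.TotalSpace.proj h
    have h2 := eq_of_heq (Bundle.TotalSpace.mk.inj h).2
    exact ⟨rfl, by rw [← h2]; exact (congrArg (fun L : E₁ →L[ℝ] E₂ => L v) key).symm⟩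
  · rintro ⟨rfl, h⟩
    have h2 : mfderiv 𝓘(ℝ, E₁) 𝓘(ℝ, E₂) f x v = w :=
      (congrArg (fun L : E₁ →L[ℝ] E₂ => L v) key).trans h
    simp only [tangentMap, h2]

variable [IsManifold 𝓘(ℝ, E₁) ∞ M₁] [IsManifold 𝓘(ℝ, E₂) ∞ M₂]
  {B₁ : AffineConnection E₁ M₁} {B₂ : AffineConnection E₂ M₂}

/-- The image of a geodesic under an affine map is the geodesic with the image velocity. -/
theorem IsAffineMapAt.exists_isGeodesic (hcomplete : B₂.IsGeodesicallyComplete)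
    {φ : OpenPartialHomeomorph M₁ E₁} (hφ : φ ∈ IsManifold.maximalAtlas 𝓘(ℝ, E₁) ∞ M₁)
    {c d : ℝ → E₁} (hc : ∀ᶠ t in 𝓝 0, HasDerivAt c (d t) t)
    (hd : ∀ᶠ t in 𝓝 0, HasDerivAt d (B₁.localRep φ (c t) (d t) (d t)) t) (hc0 : c 0 ∈ φ.target)
    {f : M₁ → M₂} (hf : IsAffineMapAt B₁ B₂ (φ.symm (c 0)) f) :
    ∃ α, B₂.IsGeodesic α ∧ ∀ᶠ t in 𝓝 0, f (φ.symm (c t)) = α t := by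
  set q := f (φ.symm (c 0)) with hq
  set ψ := chartAt E₂ q with hψ'
  have hψ : ψ ∈ IsManifold.maximalAtlas 𝓘(ℝ, E₂) ∞ M₂ := IsManifold.chart_mem_maximalAtlas q
  have hqs : q ∈ ψ.source := mem_chart_source E₂ q
  set F := ψ ∘ f ∘ φ.symm with hFdef
  have hF : IsAffineNear (B₁.localRep φ) (B₂.localRep ψ) F (c 0) := by
    have := hf.isAffineNear hφ hψ (φ.map_target hc0) hqs
    rwa [φ.right_inv hc0] at this
  -- The complete geodesic with the velocity of the image curve. Both curves solve the geodesic
  -- equation near time 0, so they agree there.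
  obtain ⟨α, hα, hα0⟩ := hcomplete ⟨q, fderiv ℝ F (c 0) (d 0)⟩
  obtain ⟨h0, h1⟩ := (tangentMap_eq_iff (hα.1.mdifferentiable (by simp) 0)).1 hα0
  have hcc : ContinuousAt c 0 := hc.self_of_nhds.continuousAt
  have hγ : ContinuousAt (fun t => φ.symm (c t)) 0 := (φ.symm.continuousAt hc0).comp hcc
  have hfγ : ContinuousAt (fun t => f (φ.symm (c t))) 0 :=
    ContinuousAt.comp (f := fun t => φ.symm (c t)) hf.continuousAt hγ
  have hαs : ∀ᶠ t in 𝓝 0, α t ∈ ψ.source :=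
    hα.1.continuous.continuousAt.eventually (ψ.open_source.mem_nhds (by rw [h0]; exact hqs))
  have hfs : ∀ᶠ t in 𝓝 0, f (φ.symm (c t)) ∈ ψ.source :=
    hfγ.eventually (ψ.open_source.mem_nhds hqs)
  obtain ⟨ε, hε, hball⟩ := Metric.eventually_nhds_iff_ball.1
    ((hc.and hd).and ((hαs.and hfs).and (hcc.eventually hF.eventually)))
  refine ⟨α, hα, ?_⟩
  have huniq := ode_unique_of_contDiffAt (s := Metric.ball (0 : ℝ) ε) Metric.isOpen_ball
    (convex_ball _ _).isPreconnected
    (G := fun p : ℝ × (E₂ × E₂) => geodesicField (B₂.localRep ψ) p.2) (e := id)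
    (f := fun t => (F (c t), fderiv ℝ F (c t) (d t)))
    (g := fun t => ((ψ ∘ α) t, deriv (ψ ∘ α) t)) continuousOn_id
    (fun t ht => ?_) (fun t ht => ?_) (fun t ht => ?_) (Metric.mem_ball_self hε) ?_
  · filter_upwards [Metric.ball_mem_nhds 0 hε] with t ht
    have := congrArg Prod.fst (huniq ht)
    exact ψ.injOn (hball t ht).2.1.2 (hball t ht).2.1.1 this
  · have hΓ : ContDiffAt ℝ 1 (B₂.localRep ψ) (F (c t)) :=
      ((B₂.contDiffOn_localRep ψ hψ).contDiffAt
        (ψ.open_target.mem_nhds (ψ.map_source (hball t ht).2.1.2))).of_le (by exact_mod_cast le_top)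
    exact ContDiffAt.comp (id t, (F (c t), fderiv ℝ F (c t) (d t))) (f := Prod.snd)
      (contDiffAt_geodesicField hΓ) contDiffAt_snd
  · have hu := hasDerivAt_jet_comp (hball t ht).2.2 (hball t ht).1.1
    exact hu.fst.prodMk (hasDerivAt_jet_apply_parallel hu (hball t ht).1.2)
  · have := hα.hasDerivAt hψ (hball t ht).2.1.1
    exact this.1.prodMk this.2
  · refine Prod.ext ?_ h1.symm
    simp only [Function.comp, hFdef, h0]
    rfl

end Geodesics

/-! ### Continuation of germs along geodesics into a complete manifold. -/

section Geodesics

open Set Filter Topology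

variable {E₁ : Type*} [NormedAddCommGroup E₁] [NormedSpace ℝ E₁] [CompleteSpace E₁]
  {M₁ : Type*} [TopologicalSpace M₁] [ChartedSpace E₁ M₁] [IsManifold 𝓘(ℝ, E₁) ∞ M₁]
  {E₂ : Type*} [NormedAddCommGroup E₂] [NormedSpace ℝ E₂] [CompleteSpace E₂]
  {M₂ : Type*} [TopologicalSpace M₂] [ChartedSpace E₂ M₂] [IsManifold 𝓘(ℝ, E₂) ∞ M₂]
  {B₁ : AffineConnection E₁ M₁} {B₂ : AffineConnection E₂ M₂}

/-- Germs of affine maps can be continued along a short piece of a geodesic in a chart. -/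
theorem exists_affine_continuation_of_isGeodesic
    (hT₁ : B₁.HasParallelTorsion) (hR₁ : B₁.HasParallelCurvature)
    (hT₂ : B₂.HasParallelTorsion) (hR₂ : B₂.HasParallelCurvature)
    {φ : OpenPartialHomeomorph M₁ E₁} (hφ : φ ∈ IsManifold.maximalAtlas 𝓘(ℝ, E₁) ∞ M₁)
    {c d : ℝ → E₁} {t₀ : ℝ} (hc : ∀ᶠ t in 𝓝 t₀, HasDerivAt c (d t) t)
    (hd : ∀ᶠ t in 𝓝 t₀, HasDerivAt d (B₁.localRep φ (c t) (d t) (d t)) t)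
    (hct : ∀ᶠ t in 𝓝 t₀, c t ∈ φ.target) {α : ℝ → M₂} (hα : B₂.IsGeodesic α) :
    ∃ δ > 0, ∀ t₁ ∈ Ioo (t₀ - δ) (t₀ + δ), ∀ f : M₁ → M₂,
      IsAffineMapAt B₁ B₂ (φ.symm (c t₁)) f → (∀ᶠ s in 𝓝 t₁, f (φ.symm (c s)) = α s) →
      ∃ G : ℝ → M₁ → M₂, G t₁ =ᶠ[𝓝 (φ.symm (c t₁))] f ∧ ∀ t ∈ Ioo (t₀ - δ) (t₀ + δ),
        (IsAffineMapAt B₁ B₂ (φ.symm (c t)) (G t) ∧ ∀ᶠ s in 𝓝 t, G t (φ.symm (c s)) = α s) ∧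
        ∀ᶠ s in 𝓝 t, G s =ᶠ[𝓝 (φ.symm (c s))] G t := by
  set ψ := chartAt E₂ (α t₀)
  have hψ : ψ ∈ IsManifold.maximalAtlas 𝓘(ℝ, E₂) ∞ M₂ := IsManifold.chart_mem_maximalAtlas _
  have hαs : ∀ᶠ t in 𝓝 t₀, α t ∈ ψ.source :=
    hα.1.continuous.continuousAt.eventually (ψ.open_source.mem_nhds (mem_chart_source E₂ _))
  set y := ψ ∘ α with hy
  set e := deriv y with he
  set Γ₁ := B₁.localRep φ
  set Γ₂ := B₂.localRep ψ
  have hy0 : ContinuousAt y t₀ := (hα.hasDerivAt hψ hαs.self_of_nhds).1.continuousAt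
  have he0 : ContinuousAt e t₀ := (hα.hasDerivAt hψ hαs.self_of_nhds).2.continuousAt
  have hg₁ : ∀ z ∈ φ.target, GoodNear Γ₁ z := fun z hz => B₁.goodNear hT₁ hR₁ hφ hz
  have hg₂ : ∀ z ∈ ψ.target, GoodNear Γ₂ z := fun z hz => B₂.goodNear hT₂ hR₂ hψ hz
  have hn₁ : ContinuousAt (fun t => ‖Γ₁ (c t)‖ * ‖d t‖) t₀ :=
    (ContinuousAt.comp (f := c) ((hg₁ _ hct.self_of_nhds).contDiffAt (n := 0)).continuousAt
      hc.self_of_nhds.continuousAt).norm.mul hd.self_of_nhds.continuousAt.norm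
  have hn₂ : ContinuousAt (fun t => ‖Γ₂ (y t)‖ * ‖e t‖) t₀ :=
    (ContinuousAt.comp (f := y) ((hg₂ _ (ψ.map_source hαs.self_of_nhds)).contDiffAt
      (n := 0)).continuousAt hy0).norm.mul he0.norm
  set C := max (‖Γ₁ (c t₀)‖ * ‖d t₀‖) (‖Γ₂ (y t₀)‖ * ‖e t₀‖) + 1 with hC
  have hC0 : 0 < C := by positivity
  have hC₁ := hn₁.eventually_lt_const (u := C) (by
    have := le_max_left (‖Γ₁ (c t₀)‖ * ‖d t₀‖) (‖Γ₂ (y t₀)‖ * ‖e t₀‖); linarith)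
  have hC₂ := hn₂.eventually_lt_const (u := C) (by
    have := le_max_right (‖Γ₁ (c t₀)‖ * ‖d t₀‖) (‖Γ₂ (y t₀)‖ * ‖e t₀‖); linarith)
  obtain ⟨ε, hε, hball⟩ := Metric.eventually_nhds_iff_ball.1
    ((hc.and hd).and ((hct.and hαs).and (hC₁.and hC₂)))
  -- The interval has length 2δ, and 2δ · 2C ≤ 1/2. As δ depends neither on t₁ nor on the germ, the
  -- steps can be chained.
  set δ := min (ε / 2) (1 / (8 * C)) with hδ
  have hδ0 : 0 < δ := by positivity
  have hsub : Icc (t₀ - δ) (t₀ + δ) ⊆ Metric.ball t₀ ε := by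
    rw [← Real.closedBall_eq_Icc]
    exact Metric.closedBall_subset_ball ((min_le_left _ _).trans_lt (half_lt_self hε))
  have hab : (t₀ + δ - (t₀ - δ)) * (2 * C) ≤ 1 / 2 := by
    have h1 : δ ≤ 1 / (8 * C) := min_le_right _ _
    rw [le_div_iff₀ (by positivity)] at h1
    linarith
  have hI : Ioo (t₀ - δ) (t₀ + δ) ⊆ Metric.ball t₀ ε := Ioo_subset_Icc_self.trans hsub
  refine ⟨δ, hδ0, fun t₁ ht₁ f hf hfα => ?_⟩
  have hct₁ := (hball t₁ (hI ht₁)).2.1.1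
  have hft₁ : f (φ.symm (c t₁)) = α t₁ := hfα.self_of_nhds
  have hfs : f (φ.symm (c t₁)) ∈ ψ.source := by rw [hft₁]; exact (hball t₁ (hI ht₁)).2.1.2
  have hF : IsAffineNear Γ₁ Γ₂ (ψ ∘ f ∘ φ.symm) (c t₁) := by
    have := hf.isAffineNear hφ hψ (φ.map_target hct₁) hfs
    rwa [φ.right_inv hct₁] at this
  have hF1 : fderiv ℝ (ψ ∘ f ∘ φ.symm) (c t₁) (d t₁) = e t₁ := by
    have e1 : HasDerivAt (fun s => (ψ ∘ f ∘ φ.symm) (c s)) _ t₁ :=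
      (hF.self_of_nhds.1.differentiableAt (by simp)).hasFDerivAt.comp_hasDerivAt t₁
        (hball t₁ (hI ht₁)).1.1
    refine (e1.congr_of_eventuallyEq ?_).unique
      (hα.hasDerivAt hψ (hball t₁ (hI ht₁)).2.1.2).1
    filter_upwards [hfα] with s hs
    simp [hs]
  obtain ⟨Φ, hΦ1, hΦ⟩ := exists_affine_continuation (C := C) (c := c) (d := d) (y := y) (e := e)
    (fun t ht => (hball t (hsub ht)).1.1) (fun t ht => (hball t (hsub ht)).1.2)
    (fun t ht => (hα.hasDerivAt hψ (hball t (hsub ht)).2.1.2).1)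
    (fun t ht => (hα.hasDerivAt hψ (hball t (hsub ht)).2.1.2).2)
    (fun t ht => hg₁ _ (hball t (hsub ht)).2.1.1)
    (fun t ht => hg₂ _ (ψ.map_source (hball t (hsub ht)).2.1.2))
    (fun t ht => (hball t (hsub ht)).2.2.1.le) (fun t ht => (hball t (hsub ht)).2.2.2.le)
    hab ht₁ hF (by simp [hft₁, hy]) hF1
  refine ⟨fun t => ψ.symm ∘ Φ t ∘ φ, ?_, fun t ht => ⟨⟨?_, ?_⟩, ?_⟩⟩
  · exact (hΦ1.comp_charts ψ hct₁).trans (OpenPartialHomeomorph.eventuallyEq_of_comp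
      (φ.map_target hct₁) (hf.continuousAt.eventually (ψ.open_source.mem_nhds hfs)))
  · refine (hΦ t ht).1.isAffineMapAt hφ hψ (hball t (hI ht)).2.1.1 ?_
    rw [(hΦ t ht).2.1.self_of_nhds]
    exact ψ.map_source (hball t (hI ht)).2.1.2
  · filter_upwards [(hΦ t ht).2.1, isOpen_Ioo.mem_nhds ht] with s hs hsI
    simp only [Function.comp, φ.right_inv (hball s (hI hsI)).2.1.1, hs]
    exact ψ.left_inv (hball s (hI hsI)).2.1.2
  · filter_upwards [(hΦ t ht).2.2, isOpen_Ioo.mem_nhds ht] with s hs hsI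
    exact hs.comp_charts ψ (hball s (hI hsI)).2.1.1

/-- Germs of affine maps into a complete manifold can be continued along geodesics in a chart. -/
theorem continuableAlong_of_geodesic (hcomplete : B₂.IsGeodesicallyComplete)
    (hT₁ : B₁.HasParallelTorsion) (hR₁ : B₁.HasParallelCurvature)
    (hT₂ : B₂.HasParallelTorsion) (hR₂ : B₂.HasParallelCurvature)
    {φ : OpenPartialHomeomorph M₁ E₁} (hφ : φ ∈ IsManifold.maximalAtlas 𝓘(ℝ, E₁) ∞ M₁)
    {c d : ℝ → E₁} (hc : ∀ t ∈ Ioo (-1 : ℝ) 2, HasDerivAt c (d t) t)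
    (hd : ∀ t ∈ Ioo (-1 : ℝ) 2, HasDerivAt d (B₁.localRep φ (c t) (d t) (d t)) t)
    (hct : ∀ t ∈ Ioo (-1 : ℝ) 2, c t ∈ φ.target) :
    ContinuableAlong (IsAffineMapAt B₁ B₂) (fun t => φ.symm (c t)) := by
  intro f hf
  have hI : ∀ t ∈ Icc (0 : ℝ) 1, ∀ᶠ s in 𝓝 t, s ∈ Ioo (-1 : ℝ) 2 := fun t ht =>
    isOpen_Ioo.mem_nhds ⟨by linarith [ht.1], by linarith [ht.2]⟩
  have h0 := hI 0 (by simp)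
  obtain ⟨α, hα, hfα⟩ := IsAffineMapAt.exists_isGeodesic hcomplete hφ (h0.mono hc) (h0.mono hd)
    (hct 0 h0.self_of_nhds) hf
  -- One geodesic α serves the whole path. The condition `Q` records that the germ maps the path to
  -- α, so that each step can start where the previous one ended.
  obtain ⟨G, hG0, hG⟩ := exists_continuation_of_local (γ := fun t => φ.symm (c t))
    (Q := fun t f => IsAffineMapAt B₁ B₂ (φ.symm (c t)) f ∧
      ∀ᶠ s in 𝓝 t, f (φ.symm (c s)) = α s)
    (fun t ht => ((φ.symm.continuousAt (hct t (hI t ht).self_of_nhds)).comp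
      (hc t (hI t ht).self_of_nhds).continuousAt).continuousWithinAt)
    (fun t₀ ht₀ => by
      obtain ⟨δ, hδ, h⟩ := exists_affine_continuation_of_isGeodesic hT₁ hR₁ hT₂ hR₂ hφ
        ((hI t₀ ht₀).mono hc) ((hI t₀ ht₀).mono hd) ((hI t₀ ht₀).mono hct) hα
      refine ⟨δ, hδ, fun t₁ ht₁ _ f hf => ?_⟩
      obtain ⟨G, hG1, hG⟩ := h t₁ ht₁ f hf.1 hf.2
      exact ⟨G, hG1, fun t ht _ => ⟨(hG t ht).1, (hG t ht).2.filter_mono nhdsWithin_le_nhds⟩⟩)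
    ⟨hf, hfα⟩
  exact ⟨G, hG0, fun t ht => ⟨(hG t ht).1.1, (hG t ht).2⟩⟩

/-- Every point has a neighbourhood that is swept out by paths along which germs of affine maps
can be continued. -/
theorem exists_continuable_neighborhood (hcomplete : B₂.IsGeodesicallyComplete)
    (hT₁ : B₁.HasParallelTorsion) (hR₁ : B₁.HasParallelCurvature)
    (hT₂ : B₂.HasParallelTorsion) (hR₂ : B₂.HasParallelCurvature) (p : M₁) :
    ∃ U : Set M₁, IsOpen U ∧ p ∈ U ∧ IsPreconnected U ∧ ∃ c : M₁ → ℝ → M₁,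
      ContinuousOn (fun q : M₁ × ℝ => c q.1 q.2) (U ×ˢ Icc 0 1) ∧
      ∀ x ∈ U, c x 0 = p ∧ c x 1 = x ∧ ContinuableAlong (IsAffineMapAt B₁ B₂) (c x) ∧
        ContinuableAlong (IsAffineMapAt B₁ B₂) (fun t => c x (1 - t)) := by
  set φ := chartAt E₁ p
  have hφ : φ ∈ IsManifold.maximalAtlas 𝓘(ℝ, E₁) ∞ M₁ := IsManifold.chart_mem_maximalAtlas p
  have hp : p ∈ φ.source := mem_chart_source E₁ p
  obtain ⟨U, hU, hpU, hUc, c, d, hcont, hcd⟩ := exists_geodesic_star_neighborhood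
    (((B₁.goodNear hT₁ hR₁ hφ (φ.map_source hp)).contDiffAt (n := 1)))
    (φ.open_target.mem_nhds (φ.map_source hp))
  have hUt : U ⊆ φ.target := fun x hx => by
    have := ((hcd x hx).2.2 1 (by norm_num)).2.2
    rwa [(hcd x hx).2.1] at this
  refine ⟨φ.symm '' U, φ.symm.isOpen_image_of_subset_source hU hUt,
    ⟨φ p, hpU, φ.left_inv hp⟩, hUc.image _ (φ.symm.continuousOn.mono hUt),
    fun x t => φ.symm (c (φ x) t), ?_, ?_⟩
  · refine φ.symm.continuousOn.comp (s := (φ.symm '' U) ×ˢ Icc (0 : ℝ) 1) (t := φ.target)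
      (f := fun q : M₁ × ℝ => c (φ q.1) q.2) ?_ ?_
    · refine hcont.comp (f := fun q : M₁ × ℝ => (φ q.1, q.2))
        (s := (φ.symm '' U) ×ˢ Icc (0 : ℝ) 1) ?_ ?_
      · refine ContinuousOn.prodMk (φ.continuousOn.comp continuousOn_fst ?_) continuousOn_snd
        rintro ⟨_, t⟩ ⟨⟨x, hx, rfl⟩, -⟩
        exact φ.map_target (hUt hx)
      · rintro ⟨_, t⟩ ⟨⟨x, hx, rfl⟩, ht⟩
        exact ⟨by simpa [φ.right_inv (hUt hx)] using hx, ht⟩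
    · rintro ⟨_, t⟩ ⟨⟨x, hx, rfl⟩, ht⟩
      simp only [φ.right_inv (hUt hx)]
      exact ((hcd x hx).2.2 t ⟨by linarith [ht.1], by linarith [ht.2]⟩).2.2
  · rintro _ ⟨x, hx, rfl⟩
    obtain ⟨h0, h1, h⟩ := hcd x hx
    simp only [φ.right_inv (hUt hx)]
    refine ⟨by rw [h0, φ.left_inv hp], by rw [h1], ?_, ?_⟩
    · have hI : ∀ t ∈ Ioo (-1 : ℝ) 2, t ∈ Ioo (-2 : ℝ) 2 := fun t ht => ⟨by linarith [ht.1], ht.2⟩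
      exact continuableAlong_of_geodesic hcomplete hT₁ hR₁ hT₂ hR₂ hφ
        (fun t ht => (h t (hI t ht)).1) (fun t ht => (h t (hI t ht)).2.1)
        (fun t ht => (h t (hI t ht)).2.2)
    · have hI : ∀ t ∈ Ioo (-1 : ℝ) 2, 1 - t ∈ Ioo (-2 : ℝ) 2 := fun t ht =>
        ⟨by linarith [ht.2], by linarith [ht.1]⟩
      -- The geodesic equation is quadratic in the velocity, so a geodesic run backwards is again a
      -- geodesic.
      refine continuableAlong_of_geodesic (d := fun t => -d x (1 - t)) hcomplete hT₁ hR₁ hT₂ hR₂ hφ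
        (fun t ht => ?_) (fun t ht => ?_) (fun t ht => (h _ (hI t ht)).2.2)
      · exact ((h _ (hI t ht)).1.scomp t ((hasDerivAt_id t).const_sub 1)).congr_deriv (by simp)
      · exact ((h _ (hI t ht)).2.1.scomp t ((hasDerivAt_id t).const_sub 1)).neg.congr_deriv (by simp)

end Geodesics

/-! ### Global affine maps and the Integrability Theorem. -/

section GlobalAffine

open Set Filter Topology

variable {E₁ : Type*} [NormedAddCommGroup E₁] [NormedSpace ℝ E₁]
  {M₁ : Type*} [TopologicalSpace M₁] [ChartedSpace E₁ M₁] [IsManifold 𝓘(ℝ, E₁) ∞ M₁]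
  {E₂ : Type*} [NormedAddCommGroup E₂] [NormedSpace ℝ E₂]
  {M₂ : Type*} [TopologicalSpace M₂] [ChartedSpace E₂ M₂] [IsManifold 𝓘(ℝ, E₂) ∞ M₂]
  {B₁ : AffineConnection E₁ M₁} {B₂ : AffineConnection E₂ M₂}

theorem IsAffineMapAt.contMDiffAt {f : M₁ → M₂} {x : M₁} (hf : IsAffineMapAt B₁ B₂ x f) :
    ContMDiffAt 𝓘(ℝ, E₁) 𝓘(ℝ, E₂) ∞ f x := by
  have hF := hf.isAffineNear (IsManifold.chart_mem_maximalAtlas x)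
    (IsManifold.chart_mem_maximalAtlas (f x)) (mem_chart_source E₁ x) (mem_chart_source E₂ (f x))
  rw [contMDiffAt_iff]
  refine ⟨hf.continuousAt, ?_⟩
  simpa [mfld_simps] using hF.self_of_nhds.1.contDiffWithinAt

theorem isAffineMap_iff {f : M₁ → M₂} :
    IsAffineMap B₁ B₂ f ↔ ∀ x, IsAffineMapAt B₁ B₂ x f := by
  constructor
  · rintro ⟨hf, h⟩ x
    set φ₁ := chartAt E₁ x
    set φ₂ := chartAt E₂ (f x)
    have h₁ : φ₁ ∈ IsManifold.maximalAtlas 𝓘(ℝ, E₁) ∞ M₁ := IsManifold.chart_mem_maximalAtlas x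
    have h₂ : φ₂ ∈ IsManifold.maximalAtlas 𝓘(ℝ, E₂) ∞ M₂ :=
      IsManifold.chart_mem_maximalAtlas (f x)
    have hx : x ∈ φ₁.source := mem_chart_source E₁ x
    have hs : ∀ᶠ x' in 𝓝 x, f x' ∈ φ₂.source :=
      hf.continuous.continuousAt.eventually (φ₂.open_source.mem_nhds (mem_chart_source E₂ (f x)))
    refine ⟨φ₁, h₁, φ₂, h₂, hx, hs, ?_⟩
    filter_upwards [OpenPartialHomeomorph.eventually_symm hx hs,
      φ₁.open_target.mem_nhds (φ₁.map_source hx)] with z hz1 hz2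
    refine ⟨?_, h φ₁ h₁ φ₂ h₂ z hz2 hz1⟩
    rw [← contMDiffAt_iff_contDiffAt]
    exact (contMDiffAt_of_mem_maximalAtlas h₂ hz1).comp z
      (hf.contMDiffAt.comp z (contMDiffAt_symm_of_mem_maximalAtlas h₁ hz2))
  · intro h
    refine ⟨fun x => (h x).contMDiffAt, fun φ₁ h₁ φ₂ h₂ x hx hfx => ?_⟩
    have := (h (φ₁.symm x)).isAffineNear h₁ h₂ (φ₁.map_target hx) hfx
    rw [φ₁.right_inv hx] at this
    exact this.self_of_nhds.2

end GlobalAffine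

theorem mainTheorem2
    {E₁ : Type*} [NormedAddCommGroup E₁] [NormedSpace ℝ E₁] [CompleteSpace E₁]
    {M₁ : Type*} [TopologicalSpace M₁] [T2Space M₁] [ChartedSpace E₁ M₁]
    [IsManifold 𝓘(ℝ, E₁) ∞ M₁]
    {E₂ : Type*} [NormedAddCommGroup E₂] [NormedSpace ℝ E₂] [CompleteSpace E₂]
    {M₂ : Type*} [TopologicalSpace M₂] [T2Space M₂] [ChartedSpace E₂ M₂]
    [IsManifold 𝓘(ℝ, E₂) ∞ M₂]
    (B₁ : AffineConnection E₁ M₁) (B₂ : AffineConnection E₂ M₂)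
    (b₁ : M₁) (b₂ : M₂)
    [SimplyConnectedSpace M₁]
    (hcomplete : B₂.IsGeodesicallyComplete)
    (hT₁ : B₁.HasParallelTorsion) (hR₁ : B₁.HasParallelCurvature)
    (hT₂ : B₂.HasParallelTorsion) (hR₂ : B₂.HasParallelCurvature)
    (A : TangentSpace 𝓘(ℝ, E₁) b₁ →L[ℝ] TangentSpace 𝓘(ℝ, E₂) b₂)
    (hAT : ∀ v w, A (B₁.torsion b₁ v w) = B₂.torsion b₂ (A v) (A w))
    (hAR : ∀ v w z, A (B₁.curvature b₁ v w z) = B₂.curvature b₂ (A v) (A w) (A z)) :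
    ∃! f : M₁ → M₂, IsAffineMap B₁ B₂ f ∧
      ∀ v : TangentSpace 𝓘(ℝ, E₁) b₁,
        tangentMap 𝓘(ℝ, E₁) 𝓘(ℝ, E₂) f ⟨b₁, v⟩ = ⟨b₂, A v⟩ := by
  have : LocallyPathConnectedSpace M₁ := ChartedSpace.locallyPathConnectedSpace E₁ M₁
  set φ₁ := chartAt E₁ b₁
  set φ₂ := chartAt E₂ b₂
  have h₁ : φ₁ ∈ IsManifold.maximalAtlas 𝓘(ℝ, E₁) ∞ M₁ := IsManifold.chart_mem_maximalAtlas b₁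
  have h₂ : φ₂ ∈ IsManifold.maximalAtlas 𝓘(ℝ, E₂) ∞ M₂ := IsManifold.chart_mem_maximalAtlas b₂
  have hb₁ : b₁ ∈ φ₁.source := mem_chart_source E₁ b₁
  have hb₂ : b₂ ∈ φ₂.source := mem_chart_source E₂ b₂
  have g₁ := B₁.goodNear hT₁ hR₁ h₁ (φ₁.map_source hb₁)
  have g₂ := B₂.goodNear hT₂ hR₂ h₂ (φ₂.map_source hb₂)
  have hP : IsRigidLocalCondition (IsAffineMapAt B₁ B₂) := isRigidLocalCondition_isAffineMapAt
  -- In the preferred charts at the base points, the hypotheses on A are by definition the two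
  -- halves of `Intertwines`.
  let L : E₁ →L[ℝ] E₂ := A
  obtain ⟨F, hF0, hF1, hF⟩ := exists_isAffineNear (A := L) g₁ g₂ ⟨hAT, hAR⟩
  have hf₀ : IsAffineMapAt B₁ B₂ b₁ (φ₂.symm ∘ F ∘ φ₁) := by
    have := hF.isAffineMapAt h₁ h₂ (φ₁.map_source hb₁) (by rw [hF0]; exact φ₂.map_source hb₂)
    rwa [φ₁.left_inv hb₁] at this
  obtain ⟨f, hf, hff₀⟩ := hP.exists_global
    (exists_continuable_neighborhood hcomplete hT₁ hR₁ hT₂ hR₂) hf₀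
  have hjet : ∀ {g : M₁ → M₂}, (∀ x, IsAffineMapAt B₁ B₂ x g) →
      ((∀ v : TangentSpace 𝓘(ℝ, E₁) b₁,
        tangentMap 𝓘(ℝ, E₁) 𝓘(ℝ, E₂) g ⟨b₁, v⟩ = ⟨b₂, A v⟩) ↔
      g b₁ = b₂ ∧ fderiv ℝ (φ₂ ∘ g ∘ φ₁.symm) (φ₁ b₁) = L) := by
    intro g hg
    have hd := (hg b₁).contMDiffAt.mdifferentiableAt (by simp)
    constructor
    · intro h
      exact ⟨((tangentMap_eq_iff hd).1 (h 0)).1,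
        ContinuousLinearMap.ext fun v => ((tangentMap_eq_iff hd).1 (h v)).2⟩
    · intro h v
      exact (tangentMap_eq_iff hd).2 ⟨h.1, congrArg (fun T : E₁ →L[ℝ] E₂ => T v) h.2⟩
  have hfb : f b₁ = b₂ := by
    rw [hff₀.self_of_nhds]
    simp [φ₁, φ₂, hF0]
  have hfj : fderiv ℝ (φ₂ ∘ f ∘ φ₁.symm) (φ₁ b₁) = L := by
    rw [← hF1]
    refine Filter.EventuallyEq.fderiv_eq ?_
    have hFt := hF.self_of_nhds.1.continuousAt.eventually
      (φ₂.open_target.mem_nhds (by rw [hF0]; exact φ₂.map_source hb₂))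
    filter_upwards [OpenPartialHomeomorph.eventually_symm hb₁ hff₀, hFt,
      φ₁.open_target.mem_nhds (φ₁.map_source hb₁)] with z hz1 hz2 hz3
    simp only [Function.comp, hz1, φ₁.right_inv hz3]
    exact φ₂.right_inv hz2
  refine ⟨f, ⟨isAffineMap_iff.2 hf, (hjet hf).2 ⟨hfb, hfj⟩⟩, ?_⟩
  rintro g ⟨hg, hgA⟩
  rw [isAffineMap_iff] at hg
  obtain ⟨hgb, hgj⟩ := (hjet hg).1 hgA
  have hrf := (hf b₁).isAffineNear h₁ h₂ hb₁ (by rw [hfb]; exact hb₂)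
  have hrg := (hg b₁).isAffineNear h₁ h₂ hb₁ (by rw [hgb]; exact hb₂)
  -- Equal 1-jets at b₁ give equal germs there; connectedness of M₁ then propagates the equality.
  have hrep := hrg.eventuallyEq hrf
    (g₁.mono fun z hz => hz.1.of_le (by exact_mod_cast le_top))
    (by
      have e : (φ₂ ∘ g ∘ φ₁.symm) (φ₁ b₁) = φ₂ b₂ := by simp [φ₁, hgb]
      rw [e]
      exact g₂.mono fun z hz => hz.1.of_le (by exact_mod_cast le_top))
    (by simp [φ₁, hgb, hfb]) (by rw [hgj, hfj])
  have hgf : g =ᶠ[nhds b₁] f := by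
    have e := hrep.comp_charts φ₂ (φ₁.map_source hb₁)
    rw [φ₁.left_inv hb₁] at e
    have hs : ∀ {k : M₁ → M₂}, (∀ x, IsAffineMapAt B₁ B₂ x k) → k b₁ = b₂ →
        φ₂.symm ∘ (φ₂ ∘ k ∘ φ₁.symm) ∘ φ₁ =ᶠ[nhds b₁] k := fun hk hkb =>
      OpenPartialHomeomorph.eventuallyEq_of_comp hb₁ ((hk b₁).continuousAt.eventually
        (φ₂.open_source.mem_nhds (by rw [hkb]; exact hb₂)))
    exact (hs hg hgb).symm.trans (e.trans (hs hf hfb))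
  funext x
  exact (hP.eventuallyEq_of_isPreconnected isPreconnected_univ (fun x _ => hg x)
    (fun x _ => hf x) (Set.mem_univ b₁) hgf x (Set.mem_univ x)).self_of_nhds
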